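/- **Setting.** Let $\Omega\subset\mathbb R^d$, $d\ge 1$, be a bounded Lipschitz domain with a conforming simplicial triangulation $\mathcal T_0$ of $\overline\Omega$ that is quasi-uniform: $\operatorname{diam}\tau\le\rho\operatorname{diam}\tau'$ for all $\tau,\tau'\in\mathcal T_0$. A bisection method on $\mathcal T_0$ assigns to every simplex, initial or created later, a refinement edge; bisecting a simplex cuts it into two children through the midpoint of that edge. Elements of $\mathcal T_0$ have generation $g(\tau)=0$, and children have generation one more than their father. Let $\mathbb T(\mathcal T_0)$ be the set of conforming meshes obtained from $\mathcal T_0$ by finitely many bisections, and assume (A1) $\mathbb T(\mathcal T_0)$ is shape regular with constant $\sigma$: every element $\tau$ of each of these meshes contains a ball of some radius $r>0$ with $\operatorname{diam}\tau\le\sigma r$; (A2) for every $k\geq 0$ the uniform refinement $\overline{\mathcal T}_k$ (with $\overline{\mathcal T}_0=\mathcal T_0$, and $\overline{\mathcal T}_k$ obtained by bisecting all elements of $\overline{\mathcal T}_{k-1}$) belongs to $\mathbb T(\mathcal T_0)$. An edge $e$ of a mesh is compatible if it is the refinement edge of all elements containing it; the corresponding compatible bisection bisects all these elements. Let $\mathcal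 T_j=\mathcal T_{j-1}+b_j$, $1\le j\le J$, where $b_j$ is a compatible bisection of an edge $e_j$ of $\mathcal T_{j-1}$ with end points $p_j^\pm$ and midpoint $p_j$. Let $T_j=\{p_j,p_j^+,p_j^-\}$, and let $g_j$ be the least $k$ such that $p_j$ is a vertex of $\overline{\mathcal T}_k$. Put $\mathcal T=\mathcal T_J$ and $\bar J=\max_{\tau\in\mathcal T}g(\tau)$. The ring $\mathcal R_p$ of a vertex $p$ of a mesh is the set of elements having $p$ as a vertex. Let $\mathcal P$ be the set of interior vertices of $\mathcal T$ and $\ell(p)$ the maximal generation of the elements of $\mathcal T$ containing $p$. For a conforming mesh $\mathcal T'$ let $\mathbb V(\mathcal T')$ be the space of continuous piecewise linear functions over $\mathcal T'$ that vanish on $\partial\Omega$. Let $V_p$, $p\in\mathcal P$, be the span of the nodal basis function of $\mathbb V(\mathcal T)$ at $p$; let $V_j$, $1\le j\le J$, be the span of the nodal basis functions of $\mathbb V(\mathcal T_j)$ at the interior vertices that belong to $T_j$; let $V_0=\mathbb V(\mathcal T_0)$ and $g_0=0$. For $k\ge0$ set $$W_k=\sum_{0\le j\le J,\ g_j\le k}V_j+\sum_{p\in\mathcal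 P,\ \ell(p)\le k}V_p .$$ Consider integers $k_*$ such that, for all $0\le j\le J$ and all vertices $p$ of $\mathcal T_j$, $$\max_{\tau\in\mathcal R_p}g(\tau)-\min_{\tau\in\mathcal R_p}g(\tau)\le k_*,\qquad \#\mathcal R_p\le k_*.\tag{1}$$ **Corollary ($L^2$-stable decomposition of $W_k$).** If $d\ge2$, there is an integer $k_*$ depending only on $d$, $\sigma$ and $\rho$ that satisfies (1) for every such sequence of compatible bisections. Moreover, for $d\ge1$ and every integer $k_*$ there is a constant $C>0$ depending only on $d$, $\sigma$, $\rho$ and $k_*$ (in particular not on $J$ or $\bar J$) such that, whenever (1) holds, the following is true for every $0\le k\le\bar J$. Let $$\mathcal P_{k+k_*}=\{q\in\mathcal P:\ \ell(q)\le k+k_*\},\qquad \mathcal I_{k+k_*}=\{1\le j\le J:\ k-k_*\le g_j\le k+k_*\}.$$ Every $w\in W_k$ can be written as $$w=\sum_{q\in\mathcal P_{k+k_*}}w_q+\sum_{j\in\mathcal I_{k+k_*}}w_j,\qquad w_q\in V_q,\quad w_j\in V_j,$$ with $$C^{-1}\|w\|_{L^2(\Omega)}^2\le\sum_{q\in\mathcal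 P_{k+k_*}}\|w_q\|_{L^2(\Omega)}^2+\sum_{j\in\mathcal I_{k+k_*}}\|w_j\|_{L^2(\Omega)}^2\le C\,\|w\|_{L^2(\Omega)}^2 .$$ -/

import Mathlib

/-- The ambient space `ℝ^d` with its Euclidean norm. -/
abbrev Pt (d : ℕ) : Type := EuclideanSpace ℝ (Fin d)

/-- Bounded Lipschitz domain: a bounded, connected (nonempty) open set which, near each of its
boundary points, is the part of a ball lying strictly above the graph of a Lipschitz function, in
the direction of a unit vector `n`. The function is evaluated at the projection
`x - ⟪n, x⟫ n` of `x` onto the hyperplane orthogonal to `n`. -/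
structure IsBoundedLipschitzDomain {d : ℕ} (Ω : Set (Pt d)) : Prop where
  isOpen : IsOpen Ω
  isConnected : IsConnected Ω
  isBounded : Bornology.IsBounded Ω
  lipschitz_boundary : ∀ p ∈ frontier Ω, ∃ (n : Pt d) (r : ℝ) (K : NNReal) (g : Pt d → ℝ),
    ‖n‖ = 1 ∧ 0 < r ∧ LipschitzWith K g ∧
      ∀ x ∈ Metric.ball p r, (x ∈ Ω ↔ g (x - (inner ℝ n x) • n) < inner ℝ n x)

/-- A simplex, given by its vertices, together with its generation. -/
structure Elem (d : ℕ) where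
  verts : Finset (Pt d)
  gen : ℕ

/-- The closed simplex spanned by the vertices. -/
def Elem.hull {d : ℕ} (τ : Elem d) : Set (Pt d) := convexHull ℝ (τ.verts : Set (Pt d))

/-- A mesh is a finite collection of simplices. -/
abbrev Mesh (d : ℕ) : Type := Finset (Elem d)

namespace Mesh

variable {d : ℕ}

/-- Conformity: any two elements meet in the simplex spanned by their common vertices (which may be
empty). -/
def IsConforming (T : Mesh d) : Prop :=
  ∀ τ ∈ T, ∀ τ' ∈ T,
    τ.hull ∩ τ'.hull = convexHull ℝ ((τ.verts : Set (Pt d)) ∩ (τ'.verts : Set (Pt d)))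

open scoped Classical in
/-- The set of vertices of a mesh. -/
noncomputable def vertices (T : Mesh d) : Finset (Pt d) := T.biUnion Elem.verts

open scoped Classical in
/-- The set of interior vertices of a mesh of `Ω`. -/
noncomputable def interiorVertices (Ω : Set (Pt d)) (T : Mesh d) : Finset (Pt d) :=
  T.vertices.filter (fun p => p ∈ Ω)

open scoped Classical in
/-- The first ring of a vertex. -/
noncomputable def ring (T : Mesh d) (p : Pt d) : Mesh d := T.filter (fun τ => p ∈ τ.verts)

open scoped Classical in
/-- The first ring of an edge, the edge being given by the set of its two end points. -/
noncomputable def edgeRing (T : Mesh d) (e : Finset (Pt d)) : Mesh d :=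
  T.filter (fun τ => e ⊆ τ.verts)

/-- The level of a vertex: the maximal generation in its first ring. -/
noncomputable def level (T : Mesh d) (p : Pt d) : ℕ := (T.ring p).sup Elem.gen

/-- The maximal generation of the elements of a mesh. -/
noncomputable def maxGen (T : Mesh d) : ℕ := T.sup Elem.gen

/-- Continuous piecewise affine functions over a mesh of `Ω` which vanish on the boundary of `Ω`.
They are regarded as functions on `ℝ^d` through their extension by zero. -/
def feSpace (Ω : Set (Pt d)) (T : Mesh d) : Submodule ℝ (Pt d → ℝ) where
  carrier := {v | Continuous v ∧
    (∀ τ ∈ T, ∃ f : Pt d →ᵃ[ℝ] ℝ, ∀ x ∈ τ.hull, v x = f x) ∧ ∀ x, x ∉ Ω → v x = 0}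
  zero_mem' := ⟨continuous_const, fun _ _ => ⟨0, fun _ _ => rfl⟩, fun _ _ => rfl⟩
  add_mem' := by
    rintro u v ⟨hu, hu', hu''⟩ ⟨hv, hv', hv''⟩
    refine ⟨hu.add hv, fun τ hτ => ?_, fun x hx => ?_⟩
    · obtain ⟨f, hf⟩ := hu' τ hτ
      obtain ⟨g, hg⟩ := hv' τ hτ
      exact ⟨f + g, fun x hx => by simp [hf x hx, hg x hx]⟩
    · simp [hu'' x hx, hv'' x hx]
  smul_mem' := by
    rintro c u ⟨hu, hu', hu''⟩
    refine ⟨hu.const_smul c, fun τ hτ => ?_, fun x hx => ?_⟩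
    · obtain ⟨f, hf⟩ := hu' τ hτ
      exact ⟨c • f, fun x hx => by simp [hf x hx]⟩
    · simp [hu'' x hx]

/-- `φ` is the nodal basis function of `feSpace Ω T` associated with the vertex `p`. -/
def IsNodalBasisFunction (Ω : Set (Pt d)) (T : Mesh d) (p : Pt d) (φ : Pt d → ℝ) : Prop :=
  φ ∈ T.feSpace Ω ∧ φ p = 1 ∧ ∀ q ∈ T.vertices, q ≠ p → φ q = 0

/-- The span of the nodal basis functions associated with the interior vertices that belong to
`S`. -/
def nodalSpan (Ω : Set (Pt d)) (T : Mesh d) (S : Set (Pt d)) : Submodule ℝ (Pt d → ℝ) :=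
  Submodule.span ℝ
    {φ | ∃ p ∈ T.interiorVertices Ω, p ∈ S ∧ T.IsNodalBasisFunction Ω p φ}

end Mesh

/-- `𝒯` is a conforming triangulation of `Ω` (as sets of vertices of nondegenerate simplices). -/
structure IsTriangulation {d : ℕ} (Ω : Set (Pt d)) (𝒯 : Finset (Finset (Pt d))) : Prop where
  card_eq : ∀ t ∈ 𝒯, t.card = d + 1
  affineIndependent : ∀ t ∈ 𝒯, AffineIndependent ℝ (fun x : t => (x : Pt d))
  cover : (⋃ t ∈ 𝒯, convexHull ℝ (t : Set (Pt d))) = closure Ω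
  conforming : ∀ t ∈ 𝒯, ∀ t' ∈ 𝒯,
    convexHull ℝ (t : Set (Pt d)) ∩ convexHull ℝ (t' : Set (Pt d)) =
      convexHull ℝ ((t : Set (Pt d)) ∩ (t' : Set (Pt d)))

/-- The midpoint of an edge (a set of two points). -/
noncomputable def edgeMidpoint {d : ℕ} (e : Finset (Pt d)) : Pt d := (2 : ℝ)⁻¹ • ∑ x ∈ e, x

/-- The bisection triplet of an edge: its two end points and its midpoint. -/
noncomputable def triplet {d : ℕ} (e : Finset (Pt d)) : Set (Pt d) :=
  {x | x ∈ e ∨ x = edgeMidpoint e}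

/-- A bisection method: an initial triangulation, and the labels of all simplices, that is, the
rule that assigns to each simplex (initial or created later) its refinement edge. -/
structure BisectionMethod (d : ℕ) where
  initial : Finset (Finset (Pt d))
  refEdge : Elem d → Finset (Pt d)

namespace BisectionMethod

variable {d : ℕ} (M : BisectionMethod d)

open scoped Classical in
/-- The initial mesh; its elements have generation `0`. -/
noncomputable def initialMesh : Mesh d := M.initial.image (fun t => ⟨t, 0⟩)

open scoped Classical in
/-- The two children of a simplex: it is cut through the midpoint of its refinement edge, so each
child arises by replacing one end point of that edge by the midpoint. -/
noncomputable def children (τ : Elem d) : Mesh d :=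
  (M.refEdge τ).image
    (fun a => ⟨insert (edgeMidpoint (M.refEdge τ)) (τ.verts.erase a), τ.gen + 1⟩)

open scoped Classical in
/-- The meshes obtained from the initial one by a finite sequence of bisections of elements. -/
inductive Obtainable : Mesh d → Prop
  | initial : Obtainable M.initialMesh
  | bisect (T : Mesh d) (τ : Elem d) (hT : Obtainable T) (hτ : τ ∈ T) :
      Obtainable (T.erase τ ∪ M.children τ)

/-- The conforming meshes obtained from the initial mesh by bisection. -/
def conformingMeshes : Set (Mesh d) := {T | M.Obtainable T ∧ T.IsConforming}

open scoped Classical in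
/-- The uniform refinements: all elements of the previous mesh are bisected. -/
noncomputable def uniformMesh : ℕ → Mesh d
  | 0 => M.initialMesh
  | k + 1 => (uniformMesh k).biUnion M.children

/-- The method refines a triangulation of `Ω`, and the label of each element that it can create is
an edge of that element. -/
structure IsOn (Ω : Set (Pt d)) : Prop where
  triangulation : IsTriangulation Ω M.initial
  refEdge_subset : ∀ k, ∀ τ ∈ M.uniformMesh k, M.refEdge τ ⊆ τ.verts
  refEdge_card : ∀ k, ∀ τ ∈ M.uniformMesh k, (M.refEdge τ).card = 2

/-- Shape regularity with constant `σ`: each element of each conforming mesh contains a ball whose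
radius is at least the diameter of the element divided by `σ`. -/
def IsShapeRegular (σ : ℝ) : Prop :=
  ∀ T ∈ M.conformingMeshes, ∀ τ ∈ T, ∃ (x : Pt d) (r : ℝ),
    0 < r ∧ Metric.closedBall x r ⊆ τ.hull ∧ Metric.diam τ.hull ≤ σ * r

/-- All uniform refinements are conforming meshes. -/
def UniformConformity : Prop := ∀ k, M.uniformMesh k ∈ M.conformingMeshes

/-- The elements of the initial mesh have comparable diameters. -/
def IsQuasiUniform (ρ : ℝ) : Prop :=
  ∀ τ ∈ M.initialMesh, ∀ τ' ∈ M.initialMesh, Metric.diam τ.hull ≤ ρ * Metric.diam τ'.hull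

/-- An edge of the mesh is compatible if it is the refinement edge of all elements containing
it. -/
def IsCompatibleEdge (T : Mesh d) (e : Finset (Pt d)) : Prop :=
  (T.edgeRing e).Nonempty ∧ ∀ τ ∈ T.edgeRing e, M.refEdge τ = e

open scoped Classical in
/-- Compatible bisection: all elements containing the edge are bisected. -/
noncomputable def addBisection (T : Mesh d) (e : Finset (Pt d)) : Mesh d :=
  (T \ T.edgeRing e) ∪ (T.edgeRing e).biUnion M.children

/-- The mesh after the bisections of the edges `e 1, …, e j`, in this order. -/
noncomputable def mesh (e : ℕ → Finset (Pt d)) : ℕ → Mesh d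
  | 0 => M.initialMesh
  | j + 1 => M.addBisection (mesh e j) (e (j + 1))

/-- `e 1, …, e J` are the edges of a sequence of `J` compatible bisections; the other values of `e`
are irrelevant. -/
def IsCompatibleSequence (e : ℕ → Finset (Pt d)) (J : ℕ) : Prop :=
  ∀ j < J, M.IsCompatibleEdge (M.mesh e j) (e (j + 1))

/-- The generation of a vertex: the first uniform refinement that contains it. -/
noncomputable def vertexGen (p : Pt d) : ℕ := sInf {k | p ∈ (M.uniformMesh k).vertices}

/-- The generation of the bisection with index `j ≥ 1` is that of the new vertex; the index `0`,
which stands for the initial mesh, has generation `0`. -/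
noncomputable def bisectionGen (e : ℕ → Finset (Pt d)) (j : ℕ) : ℕ :=
  if j = 0 then 0 else M.vertexGen (edgeMidpoint (e j))

/-- `κ` bounds, for each vertex of each mesh of the sequence, the variation of the generation in
the first ring and the number of elements in it. -/
def RingBound (e : ℕ → Finset (Pt d)) (J κ : ℕ) : Prop :=
  ∀ j ≤ J, ∀ p ∈ (M.mesh e j).vertices,
    (∀ τ ∈ (M.mesh e j).ring p, ∀ τ' ∈ (M.mesh e j).ring p, τ.gen ≤ τ'.gen + κ) ∧
      ((M.mesh e j).ring p).card ≤ κ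

/-- The local space of the bisection with index `j ≥ 1`, spanned by the nodal basis functions of
the `j`-th mesh at the interior vertices in the bisection triplet. The index `0` stands for the
whole finite element space over the initial mesh. -/
noncomputable def localSpace (Ω : Set (Pt d)) (e : ℕ → Finset (Pt d)) (j : ℕ) :
    Submodule ℝ (Pt d → ℝ) :=
  if j = 0 then M.initialMesh.feSpace Ω else (M.mesh e j).nodalSpan Ω (triplet (e j))

/-- The one-dimensional space spanned by the nodal basis function of the finest mesh at `p`. -/
noncomputable def nodalSpace (Ω : Set (Pt d)) (e : ℕ → Finset (Pt d)) (J : ℕ) (p : Pt d) :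
    Submodule ℝ (Pt d → ℝ) := (M.mesh e J).nodalSpan Ω {p}

open scoped Classical in
/-- The interior vertices of the finest mesh whose level is at most `k`. -/
noncomputable def levelVertices (Ω : Set (Pt d)) (e : ℕ → Finset (Pt d)) (J k : ℕ) :
    Finset (Pt d) :=
  ((M.mesh e J).interiorVertices Ω).filter (fun p => (M.mesh e J).level p ≤ k)

/-- The space `W_k`: the sum of the spaces `V_j` with `0 ≤ j ≤ J` of generation at most `k`, and of
the spaces `V_p` with `p` an interior vertex of the finest mesh of level at most `k`. -/
noncomputable def W (Ω : Set (Pt d)) (e : ℕ → Finset (Pt d)) (J k : ℕ) :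
    Submodule ℝ (Pt d → ℝ) :=
  (⨆ j ∈ {j : ℕ | j ≤ J ∧ M.bisectionGen e j ≤ k}, M.localSpace Ω e j) ⊔
    ⨆ p ∈ M.levelVertices Ω e J k, M.nodalSpace Ω e J p

/-- The bisections whose generation differs from `k` by at most `κ`. -/
noncomputable def nearBisections (e : ℕ → Finset (Pt d)) (J k κ : ℕ) : Finset ℕ :=
  (Finset.Icc 1 J).filter
    (fun j => k ≤ M.bisectionGen e j + κ ∧ M.bisectionGen e j ≤ k + κ)

end BisectionMethod

/-- The square of the `L²(Ω)` norm. -/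
noncomputable def normSqL2 {d : ℕ} (Ω : Set (Pt d)) (v : Pt d → ℝ) : ℝ :=
  ∫ x in Ω, (v x) ^ 2

/-! Put m = k + κ, where κ stands for k_*. Cut the refinement forest of the final mesh at generation
m (`coarseMesh`). By (1), every function in `W k` is a finite element function over this cut mesh,
because its generating functions vanish on all elements of generation larger than m
(`W_le_feSpace_coarseMesh`). It therefore suffices to find, for each interior vertex q of the cut
mesh, a function ψ_q in one of the admitted spaces, such that the ψ_q form an L²-stable basis.

If the level of q in the final mesh is at most m, ψ_q is the final nodal function. Otherwise some
intermediate mesh has level exactly m at q (`exists_mesh_level_eq`), and by (1) all generations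
around q lie between k and m there. The nodal function of that mesh arose in the last bisection
whose triplet contains q. Every later bisection of an element around q puts both children into the
ring, so by #R_q ≤ κ fewer than κ of them occurred, and the generation of that last bisection is
close to k (`exists_triplet_or`, `exists_isBasisAt`).

The ψ_q belong to different meshes, so ψ_q may be nonzero at another node q'. It is so only if q'
was born after the elements supporting ψ_q, hence q' has vertex generation larger than k and larger
than that of q (`IsBasisAt.vertexGen_lt`). The nodal matrix is thus triangular, and κ + 1 sweeps,
for generations at most k, then k + 1, ..., k + κ, find the coefficients
(`exists_triangular_decomposition`). Each sweep costs a fixed factor, thanks to two estimates: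
bounded overlap of the supports (`ae_card_le`) and control of nodal values by the L² norm
(`sum_sq_mul_normSqL2_le`). The latter uses that volumes are comparable to 2^(-generation).

For the existence of k_*, shape regularity bounds the number of elements around a vertex by packing
balls (`card_ring_le`) and makes generations comparable across a common edge (`two_pow_gen_le`). If
d ≥ 2, a ring is connected through common edges (`exists_common_edge`), since small spheres, and
Lipschitz domains near boundary points, remain connected without the vertex. Generations in a ring
then have no large gaps. -/

set_option linter.unusedSectionVars false

/-! ### Barycentric coordinates and the two halves of a simplex. -/

section
open scoped Classical

variable {d : ℕ}

/-- The vertex sets of nondegenerate `d`-simplices in `ℝ^d`. -/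
structure IsSimplex (t : Finset (Pt d)) : Prop where
  card_eq : t.card = d + 1
  affineIndependent : AffineIndependent ℝ (fun x : t => (x : Pt d))

namespace IsSimplex

/-- The affine basis formed by the vertices of a simplex. -/
noncomputable def basis {t : Finset (Pt d)} (h : IsSimplex t) : AffineBasis t ℝ (Pt d) :=
  ⟨fun x => (x : Pt d), h.affineIndependent, by
    rw [h.affineIndependent.affineSpan_eq_top_iff_card_eq_finrank_add_one]
    simp [h.card_eq]⟩

lemma range_basis {t : Finset (Pt d)} (h : IsSimplex t) :
    Set.range h.basis = (t : Set (Pt d)) :=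
  Subtype.range_coe

end IsSimplex

/-- The barycentric coordinate of the simplex `t` that belongs to the vertex `v`; it vanishes if
`v` is not a vertex of `t`. -/
noncomputable def bary (t : Finset (Pt d)) (v : Pt d) : Pt d →ᵃ[ℝ] ℝ :=
  if h : IsSimplex t ∧ v ∈ t then h.1.basis.coord ⟨v, h.2⟩ else 0

lemma bary_of_notMem {t : Finset (Pt d)} {v : Pt d} (hv : v ∉ t) (x : Pt d) :
    bary t v x = 0 := by
  rw [bary, dif_neg (fun h => hv h.2)]; rfl

namespace IsSimplex

variable {t t' : Finset (Pt d)} (h : IsSimplex t) (h' : IsSimplex t')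
include h

lemma bary_eq {v : Pt d} (hv : v ∈ t) : bary t v = h.basis.coord ⟨v, hv⟩ := by
  rw [bary, dif_pos ⟨h, hv⟩]

lemma bary_self {v : Pt d} (hv : v ∈ t) : bary t v v = 1 := by
  rw [h.bary_eq hv]
  exact h.basis.coord_apply_eq ⟨v, hv⟩

lemma bary_ne {v w : Pt d} (hw : w ∈ t) (hvw : v ≠ w) : bary t v w = 0 := by
  by_cases hv : v ∈ t
  · rw [h.bary_eq hv]
    exact h.basis.coord_apply_ne (i := ⟨v, hv⟩) (j := ⟨w, hw⟩) (by simpa using hvw)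
  · exact bary_of_notMem hv w

lemma sum_bary (x : Pt d) : ∑ v ∈ t, bary t v x = 1 := by
  rw [← h.basis.sum_coord_apply_eq_one x, ← Finset.sum_coe_sort t]
  exact Finset.sum_congr rfl fun v _ => by rw [h.bary_eq v.2]

lemma sum_bary_smul (x : Pt d) : ∑ v ∈ t, bary t v x • v = x := by
  conv_rhs => rw [← h.basis.linear_combination_coord_eq_self x]
  rw [← Finset.sum_coe_sort t]
  exact Finset.sum_congr rfl fun v _ => by rw [h.bary_eq v.2]; rfl

lemma affine_apply (f : Pt d →ᵃ[ℝ] ℝ) (x : Pt d) : f x = ∑ v ∈ t, bary t v x * f v := by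
  have key := t.map_affineCombination (fun v : Pt d => v) (fun v => bary t v x) (h.sum_bary x) f
  rw [t.affineCombination_eq_linear_combination _ _ (h.sum_bary x),
    t.affineCombination_eq_linear_combination _ _ (h.sum_bary x), h.sum_bary_smul] at key
  simpa using key

lemma affine_ext {f g : Pt d →ᵃ[ℝ] ℝ} (hfg : ∀ v ∈ t, f v = g v) : f = g := by
  ext x
  rw [h.affine_apply f, h.affine_apply g]
  exact Finset.sum_congr rfl fun v hv => by rw [hfg v hv]

lemma mem_hull_iff {x : Pt d} : x ∈ convexHull ℝ (t : Set (Pt d)) ↔ ∀ v, 0 ≤ bary t v x := by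
  rw [← h.range_basis, h.basis.convexHull_eq_nonneg_coord]
  constructor
  · intro hx v
    by_cases hv : v ∈ t
    · rw [h.bary_eq hv]; exact hx _
    · rw [bary_of_notMem hv]
  · rintro hx ⟨v, hv⟩
    rw [← h.bary_eq hv]; exact hx v

lemma mem_interior_iff {x : Pt d} :
    x ∈ interior (convexHull ℝ (t : Set (Pt d))) ↔ ∀ v ∈ t, 0 < bary t v x := by
  rw [← h.range_basis, h.basis.interior_convexHull]
  constructor
  · intro hx v hv
    rw [h.bary_eq hv]; exact hx _
  · rintro hx ⟨v, hv⟩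
    rw [← h.bary_eq hv]; exact hx v hv

lemma interior_nonempty : (interior (convexHull ℝ (t : Set (Pt d)))).Nonempty := by
  rw [← h.range_basis]
  exact ⟨_, h.basis.centroid_mem_interior_convexHull⟩

lemma bary_le_one {x : Pt d} (hx : x ∈ convexHull ℝ (t : Set (Pt d))) (v : Pt d) :
    bary t v x ≤ 1 := by
  by_cases hv : v ∈ t
  · rw [← h.sum_bary x]
    exact Finset.single_le_sum (f := fun v => bary t v x)
      (fun w _ => h.mem_hull_iff.1 hx w) hv
  · rw [bary_of_notMem hv]; exact zero_le_one

lemma bary_sum {s : Finset (Pt d)} (hs : s ⊆ t) {w : Pt d → ℝ} (hw : ∑ y ∈ s, w y = 1)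
    (v : Pt d) : bary t v (∑ y ∈ s, w y • y) = if v ∈ s then w v else 0 := by
  have key := s.map_affineCombination (fun v : Pt d => v) w hw (bary t v)
  rw [s.affineCombination_eq_linear_combination _ _ hw,
    s.affineCombination_eq_linear_combination _ _ hw] at key
  rw [key]
  simp only [Function.comp, smul_eq_mul]
  rw [← Finset.sum_ite_eq s v w]
  refine Finset.sum_congr rfl fun y hy => ?_
  split_ifs with hvy
  · subst hvy; rw [h.bary_self (hs hy), mul_one]
  · rw [h.bary_ne (hs hy) hvy, mul_zero]

lemma mem_face_iff {s : Finset (Pt d)} (hs : s ⊆ t) {x : Pt d} :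
    x ∈ convexHull ℝ (s : Set (Pt d)) ↔
      x ∈ convexHull ℝ (t : Set (Pt d)) ∧ ∀ v ∉ s, bary t v x = 0 := by
  constructor
  · intro hx
    refine ⟨convexHull_mono (by exact_mod_cast hs) hx, fun v hv => ?_⟩
    obtain ⟨w, -, hw, rfl⟩ := Finset.mem_convexHull'.1 hx
    rw [h.bary_sum hs hw, if_neg hv]
  · rintro ⟨hx, h0⟩
    refine Finset.mem_convexHull'.2 ⟨fun v => bary t v x, fun v _ => h.mem_hull_iff.1 hx v, ?_, ?_⟩
    · rw [← h.sum_bary x]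
      exact Finset.sum_subset hs fun v _ hv => h0 v hv
    · conv_rhs => rw [← h.sum_bary_smul x]
      exact Finset.sum_subset hs fun v _ hv => by simp only [h0 v hv, zero_smul]

omit h in
lemma mem_verts_of_bary_ne {v x : Pt d} (hx : bary t v x ≠ 0) : v ∈ t := by
  by_contra hv
  exact hx (bary_of_notMem hv x)

include h'

/-- Conformity of two simplices, in terms of barycentric coordinates. -/
lemma inter_eq_iff :
    convexHull ℝ (t : Set (Pt d)) ∩ convexHull ℝ (t' : Set (Pt d)) =
        convexHull ℝ ((t : Set (Pt d)) ∩ (t' : Set (Pt d))) ↔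
      ∀ x ∈ convexHull ℝ (t : Set (Pt d)), x ∈ convexHull ℝ (t' : Set (Pt d)) →
        ∀ v, bary t v x = bary t' v x := by
  rw [← Finset.coe_inter]
  constructor
  · intro heq x hx hx' v
    have hxs : x ∈ convexHull ℝ ((t ∩ t' : Finset (Pt d)) : Set (Pt d)) := heq ▸ ⟨hx, hx'⟩
    obtain ⟨w, -, hw, rfl⟩ := Finset.mem_convexHull'.1 hxs
    rw [h.bary_sum Finset.inter_subset_left hw, h'.bary_sum Finset.inter_subset_right hw]
  · intro hb
    apply Set.Subset.antisymm
    · rintro x ⟨hx, hx'⟩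
      refine (h.mem_face_iff Finset.inter_subset_left).2 ⟨hx, fun v hv => ?_⟩
      by_cases hvt : v ∈ t
      · rw [hb x hx hx', bary_of_notMem (fun h => hv (Finset.mem_inter.2 ⟨hvt, h⟩))]
      · exact bary_of_notMem hvt x
    · intro x hx
      exact ⟨((h.mem_face_iff Finset.inter_subset_left).1 hx).1,
        ((h'.mem_face_iff Finset.inter_subset_right).1 hx).1⟩

omit h h'

lemma hull_isCompact (t : Finset (Pt d)) : IsCompact (convexHull ℝ (t : Set (Pt d))) :=
  t.finite_toSet.isCompact_convexHull ℝ

end IsSimplex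

/-- The map contracting the simplex `t` with vertices `a` and `b` to the half that arises by
replacing `a` by the midpoint `m`. -/
noncomputable def halfMap (t : Finset (Pt d)) (a m : Pt d) : Pt d →ᵃ[ℝ] Pt d :=
  AffineMap.id ℝ (Pt d) +
    (((LinearMap.id (R := ℝ) (M := ℝ)).smulRight (m - a)).toAffineMap).comp (bary t a)

lemma halfMap_apply (t : Finset (Pt d)) (a m x : Pt d) :
    halfMap t a m x = x + bary t a x • (m - a) := by
  simp [halfMap]

/-- The vertices of the half of a simplex in which the vertex `a` is replaced by `m`. -/
noncomputable def halfVerts (t : Finset (Pt d)) (a m : Pt d) : Finset (Pt d) :=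
  insert m (t.erase a)

section half

variable {t : Finset (Pt d)} (h : IsSimplex t) {a b m : Pt d} (ha : a ∈ t) (hb : b ∈ t)
  (hab : a ≠ b) (hm : m = (2 : ℝ)⁻¹ • (a + b))
include h ha hb hab hm

lemma bary_midpoint (v : Pt d) :
    bary t v m = (2 : ℝ)⁻¹ * bary t v a + (2 : ℝ)⁻¹ * bary t v b := by
  have hm' : m = AffineMap.lineMap a b (2 : ℝ)⁻¹ := by
    rw [hm, AffineMap.lineMap_apply_module, show (1 : ℝ) - 2⁻¹ = 2⁻¹ by norm_num, smul_add]
  rw [hm', AffineMap.apply_lineMap, AffineMap.lineMap_apply_module]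
  norm_num

lemma midpoint_notMem : m ∉ t := by
  intro hmt
  have h1 := bary_midpoint h ha hb hab hm a
  rw [h.bary_self ha, h.bary_ne hb hab] at h1
  by_cases ham : a = m
  · rw [← ham, h.bary_self ha] at h1; norm_num at h1
  · rw [h.bary_ne hmt ham] at h1; norm_num at h1

lemma bary_midpoint_left : bary t a m = 2⁻¹ := by
  rw [bary_midpoint h ha hb hab hm, h.bary_self ha, h.bary_ne hb hab]; norm_num

lemma bary_midpoint_right : bary t b m = 2⁻¹ := by
  rw [bary_midpoint h ha hb hab hm, h.bary_self hb, h.bary_ne ha hab.symm]; norm_num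

lemma bary_midpoint_of_ne {v : Pt d} (hva : v ≠ a) (hvb : v ≠ b) : bary t v m = 0 := by
  rw [bary_midpoint h ha hb hab hm, h.bary_ne ha hva, h.bary_ne hb hvb]; norm_num

lemma midpoint_mem_hull : m ∈ convexHull ℝ (t : Set (Pt d)) := by
  rw [h.mem_hull_iff]
  intro v
  have := fun x (hx : x ∈ t) => h.mem_hull_iff.1 (subset_convexHull ℝ _ hx) v
  rw [bary_midpoint h ha hb hab hm]
  have h1 := this a ha
  have h2 := this b hb
  positivity

lemma halfMap_left : halfMap t a m a = m := by
  rw [halfMap_apply, h.bary_self ha]; simp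

lemma halfMap_of_ne {v : Pt d} (hv : v ∈ t) (hva : v ≠ a) : halfMap t a m v = v := by
  rw [halfMap_apply, h.bary_ne hv hva.symm]; simp

lemma image_halfMap : halfMap t a m '' (t : Set (Pt d)) = (halfVerts t a m : Set (Pt d)) := by
  ext x
  simp only [Set.mem_image, Finset.mem_coe, halfVerts, Finset.mem_insert, Finset.mem_erase]
  constructor
  · rintro ⟨y, hy, rfl⟩
    by_cases hya : y = a
    · left; rw [hya, halfMap_left h ha hb hab hm]
    · right; rw [halfMap_of_ne h ha hb hab hm hy hya]; exact ⟨hya, hy⟩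
  · rintro (rfl | ⟨hxa, hx⟩)
    · exact ⟨a, ha, halfMap_left h ha hb hab hm⟩
    · exact ⟨x, hx, halfMap_of_ne h ha hb hab hm hx hxa⟩

lemma hull_halfVerts : convexHull ℝ (halfVerts t a m : Set (Pt d)) =
    halfMap t a m '' convexHull ℝ (t : Set (Pt d)) := by
  rw [← image_halfMap h ha hb hab hm, AffineMap.image_convexHull]

lemma bary_linear_half : (bary t a).linear (m - a) = -2⁻¹ := by
  have := (bary t a).linearMap_vsub m a
  rw [vsub_eq_sub, vsub_eq_sub, h.bary_self ha, bary_midpoint_left h ha hb hab hm] at this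
  rw [this]; norm_num

/-- The determinant of this transvection is 1 + λ_a(m - a) = 1/2, with λ_a the linear part of the
coordinate of `a`. This yields both the injectivity of the map and the halving of volumes. -/
lemma halfMap_linear : (halfMap t a m).linear =
    LinearMap.transvection (bary t a).linear (m - a) := by
  ext x
  simp [halfMap, LinearMap.transvection]

lemma volume_hull_halfVerts :
    MeasureTheory.volume (convexHull ℝ (halfVerts t a m : Set (Pt d))) =
      2⁻¹ * MeasureTheory.volume (convexHull ℝ (t : Set (Pt d))) := by
  rw [hull_halfVerts h ha hb hab hm]
  have : halfMap t a m '' convexHull ℝ (t : Set (Pt d)) =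
      (fun x => halfMap t a m 0 + x) '' ((halfMap t a m).linear '' convexHull ℝ (t : Set (Pt d))) := by
    rw [Set.image_image]
    refine Set.image_congr' fun x => ?_
    rw [AffineMap.decomp' (halfMap t a m)]
    simp
  rw [this, Set.image_add_left, MeasureTheory.measure_preimage_add,
    MeasureTheory.Measure.addHaar_image_linearMap, halfMap_linear h ha hb hab hm,
    LinearMap.transvection.det, bary_linear_half h ha hb hab hm]
  congr 1
  rw [show |(1 : ℝ) + -2⁻¹| = 2⁻¹ by rw [abs_of_pos] <;> norm_num, ENNReal.ofReal_inv_of_pos (by norm_num)]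
  simp

lemma halfMap_injective : Function.Injective (halfMap t a m) := by
  rw [← AffineMap.linear_injective_iff, halfMap_linear h ha hb hab hm]
  have hd : IsUnit (LinearMap.transvection (bary t a).linear (m - a)).det := by
    rw [LinearMap.transvection.det, bary_linear_half h ha hb hab hm]; norm_num
  exact ((LinearMap.isUnit_iff_isUnit_det _).2 hd |> (Module.End.isUnit_iff _).1).1

lemma isSimplex_halfVerts : IsSimplex (halfVerts t a m) := by
  constructor
  · rw [halfVerts, Finset.card_insert_of_notMem, Finset.card_erase_of_mem ha, h.card_eq]
    · omega
    · exact fun hmt => midpoint_notMem h ha hb hab hm (Finset.mem_of_mem_erase hmt)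
  · have h1 := (h.affineIndependent.map' (halfMap t a m)
      (halfMap_injective h ha hb hab hm)).range
    have h2 : Set.range ((halfMap t a m) ∘ fun x : t => (x : Pt d)) =
        (halfVerts t a m : Set (Pt d)) := by
      rw [Set.range_comp, ← image_halfMap h ha hb hab hm]
      simp
    rw [h2] at h1
    exact h1

lemma bary_half_of_ne {v : Pt d} (hva : v ≠ a) (hvb : v ≠ b) (hvm : v ≠ m) :
    bary (halfVerts t a m) v = bary t v := by
  have h' := isSimplex_halfVerts h ha hb hab hm
  refine h'.affine_ext fun w hw => ?_
  by_cases hvw : v = w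
  · subst hvw
    rw [h'.bary_self hw]
    rcases Finset.mem_insert.1 hw with rfl | hw
    · exact absurd rfl hvm
    · rw [h.bary_self (Finset.mem_of_mem_erase hw)]
  · rw [h'.bary_ne hw hvw]
    rcases Finset.mem_insert.1 hw with rfl | hw
    · rw [bary_midpoint_of_ne h ha hb hab hm hva hvb]
    · rw [h.bary_ne (Finset.mem_of_mem_erase hw) hvw]

lemma bary_half_right : bary (halfVerts t a m) b = bary t b - bary t a := by
  have h' := isSimplex_halfVerts h ha hb hab hm
  refine h'.affine_ext fun w hw => ?_
  have hbm : b ≠ m := fun e => midpoint_notMem h ha hb hab hm (e ▸ hb)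
  rw [AffineMap.coe_sub, Pi.sub_apply]
  rcases Finset.mem_insert.1 hw with rfl | hw'
  · rw [bary_midpoint_left h ha hb hab hm, bary_midpoint_right h ha hb hab hm, h'.bary_ne hw hbm,
      sub_self]
  · obtain ⟨hwa, hwt⟩ := Finset.mem_erase.1 hw'
    rw [h.bary_ne hwt hwa.symm, sub_zero]
    by_cases hbw : b = w
    · subst hbw; rw [h'.bary_self hw, h.bary_self hb]
    · rw [h'.bary_ne hw hbw, h.bary_ne hwt hbw]

lemma bary_half_mid (x : Pt d) : bary (halfVerts t a m) m x = 2 * bary t a x := by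
  have h' := isSimplex_halfVerts h ha hb hab hm
  have : bary (halfVerts t a m) m = (2 : ℝ) • bary t a := by
    refine h'.affine_ext fun w hw => ?_
    rw [AffineMap.coe_smul, Pi.smul_apply, smul_eq_mul]
    rcases Finset.mem_insert.1 hw with rfl | hw'
    · rw [bary_midpoint_left h ha hb hab hm, h'.bary_self hw]; norm_num
    · obtain ⟨hwa, hwt⟩ := Finset.mem_erase.1 hw'
      rw [h.bary_ne hwt hwa.symm, h'.bary_ne hw, mul_zero]
      exact fun e => midpoint_notMem h ha hb hab hm (e ▸ hwt)
  rw [this]; simp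

lemma bary_half_left (x : Pt d) : bary (halfVerts t a m) a x = 0 := by
  refine bary_of_notMem (fun hmem => ?_) x
  rcases Finset.mem_insert.1 hmem with e | e
  · exact midpoint_notMem h ha hb hab hm (e ▸ ha)
  · simp at e

/-- A formula valid for every point `v`, vertex or not. Since only coordinates of the father occur
in it, conformity of children reduces to conformity of their fathers. -/
lemma bary_half (v x : Pt d) : bary (halfVerts t a m) v x =
    if v = a then 0 else if v = b then bary t b x - bary t a x
      else if v = m then 2 * bary t a x else bary t v x := by
  split_ifs with h1 h2 h3
  · rw [h1, bary_half_left h ha hb hab hm]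
  · rw [h2, bary_half_right h ha hb hab hm]; rfl
  · rw [h3, bary_half_mid h ha hb hab hm]
  · rw [bary_half_of_ne h ha hb hab hm h1 h2 h3]

lemma mem_hull_halfVerts_iff {x : Pt d} : x ∈ convexHull ℝ (halfVerts t a m : Set (Pt d)) ↔
    x ∈ convexHull ℝ (t : Set (Pt d)) ∧ bary t a x ≤ bary t b x := by
  rw [(isSimplex_halfVerts h ha hb hab hm).mem_hull_iff, h.mem_hull_iff]
  have hmt := midpoint_notMem h ha hb hab hm
  constructor
  · intro hx
    have hxa : 0 ≤ bary t a x := by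
      have := hx m; rw [bary_half_mid h ha hb hab hm] at this; linarith
    have hxb : bary t a x ≤ bary t b x := by
      have := hx b; rw [bary_half_right h ha hb hab hm] at this
      simpa using this
    refine ⟨fun v => ?_, hxb⟩
    by_cases h1 : v = a
    · rwa [h1]
    by_cases h2 : v = b
    · rw [h2]; linarith
    by_cases h3 : v = m
    · rw [h3, bary_of_notMem hmt]
    · rw [← bary_half_of_ne h ha hb hab hm h1 h2 h3]; exact hx v
  · rintro ⟨hx, hxab⟩ v
    rw [bary_half h ha hb hab hm]
    have := hx a
    split_ifs
    · exact le_rfl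
    · linarith
    · linarith
    · exact hx v

end half

end

/-! ### Elements created by the method, their generations and those of vertices. -/

section
open scoped Classical

variable {d : ℕ}

lemma edgeMidpoint_pair {a b : Pt d} (hab : a ≠ b) :
    edgeMidpoint {a, b} = (2 : ℝ)⁻¹ • (a + b) := by
  rw [edgeMidpoint, Finset.sum_pair hab]

lemma Mesh.mem_vertices {T : Mesh d} {q : Pt d} : q ∈ T.vertices ↔ ∃ τ ∈ T, q ∈ τ.verts := by
  simp [Mesh.vertices]

lemma Mesh.mem_ring {T : Mesh d} {q : Pt d} {τ : Elem d} :
    τ ∈ T.ring q ↔ τ ∈ T ∧ q ∈ τ.verts := by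
  simp [Mesh.ring]

lemma Mesh.mem_edgeRing {T : Mesh d} {e : Finset (Pt d)} {τ : Elem d} :
    τ ∈ T.edgeRing e ↔ τ ∈ T ∧ e ⊆ τ.verts := by
  simp [Mesh.edgeRing]

namespace BisectionMethod

variable {M : BisectionMethod d} {Ω : Set (Pt d)}

/-- The elements that the method can create. -/
def IsNode (M : BisectionMethod d) (τ : Elem d) : Prop := τ ∈ M.uniformMesh τ.gen

lemma gen_of_mem_children {τ τ' : Elem d} (h : τ' ∈ M.children τ) : τ'.gen = τ.gen + 1 := by
  obtain ⟨a, -, rfl⟩ := Finset.mem_image.1 h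
  rfl

lemma gen_of_mem_initialMesh {τ : Elem d} (h : τ ∈ M.initialMesh) : τ.gen = 0 := by
  obtain ⟨t, -, rfl⟩ := Finset.mem_image.1 h
  rfl

lemma gen_of_mem_uniformMesh {k : ℕ} {τ : Elem d} (h : τ ∈ M.uniformMesh k) : τ.gen = k := by
  induction k generalizing τ with
  | zero => exact gen_of_mem_initialMesh h
  | succ k ih =>
    obtain ⟨σ, hσ, hτ⟩ := Finset.mem_biUnion.1 h
    rw [gen_of_mem_children hτ, ih hσ]

lemma isNode_of_mem_uniformMesh {k : ℕ} {τ : Elem d} (h : τ ∈ M.uniformMesh k) : M.IsNode τ := by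
  rw [IsNode, gen_of_mem_uniformMesh h]; exact h

lemma IsNode.child {τ τ' : Elem d} (h : M.IsNode τ) (h' : τ' ∈ M.children τ) : M.IsNode τ' := by
  rw [IsNode, gen_of_mem_children h']
  exact Finset.mem_biUnion.2 ⟨τ, h, h'⟩

/-- The child of `τ` that arises by replacing `a`. -/
noncomputable def child (M : BisectionMethod d) (τ : Elem d) (a : Pt d) : Elem d :=
  ⟨halfVerts τ.verts a (edgeMidpoint (M.refEdge τ)), τ.gen + 1⟩

lemma mem_children_iff {τ τ' : Elem d} :
    τ' ∈ M.children τ ↔ ∃ a ∈ M.refEdge τ, τ' = M.child τ a := by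
  simp only [children, Finset.mem_image, child, halfVerts, eq_comm]

/-- `a` and `b` are the two end points of the refinement edge of the simplex `τ`. -/
structure IsRefPair (M : BisectionMethod d) (τ : Elem d) (a b : Pt d) : Prop where
  isSimplex : IsSimplex τ.verts
  left_mem : a ∈ τ.verts
  right_mem : b ∈ τ.verts
  ne : a ≠ b
  refEdge_eq : M.refEdge τ = {a, b}

namespace IsRefPair

variable {τ τ' : Elem d} {a b : Pt d} (h : M.IsRefPair τ a b)
include h

lemma symm : M.IsRefPair τ b a :=
  ⟨h.isSimplex, h.right_mem, h.left_mem, h.ne.symm, by rw [h.refEdge_eq, Finset.pair_comm]⟩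

lemma midpoint_eq : edgeMidpoint (M.refEdge τ) = (2 : ℝ)⁻¹ • (a + b) := by
  rw [h.refEdge_eq, edgeMidpoint_pair h.ne]

lemma isSimplex_child : IsSimplex (M.child τ a).verts :=
  isSimplex_halfVerts h.isSimplex h.left_mem h.right_mem h.ne h.midpoint_eq

lemma child_mem : M.child τ a ∈ M.children τ :=
  mem_children_iff.2 ⟨a, by rw [h.refEdge_eq]; simp, rfl⟩

lemma mem_child_hull {x : Pt d} :
    x ∈ (M.child τ a).hull ↔ x ∈ τ.hull ∧ bary τ.verts a x ≤ bary τ.verts b x :=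
  mem_hull_halfVerts_iff h.isSimplex h.left_mem h.right_mem h.ne h.midpoint_eq

lemma midpoint_notMem : edgeMidpoint (M.refEdge τ) ∉ τ.verts :=
  _root_.midpoint_notMem h.isSimplex h.left_mem h.right_mem h.ne h.midpoint_eq

lemma midpoint_mem_hull : edgeMidpoint (M.refEdge τ) ∈ τ.hull :=
  _root_.midpoint_mem_hull h.isSimplex h.left_mem h.right_mem h.ne h.midpoint_eq

lemma bary_child (v x : Pt d) : bary (M.child τ a).verts v x =
    if v = a then 0 else if v = b then bary τ.verts b x - bary τ.verts a x
      else if v = edgeMidpoint (M.refEdge τ) then 2 * bary τ.verts a x else bary τ.verts v x :=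
  bary_half h.isSimplex h.left_mem h.right_mem h.ne h.midpoint_eq v x

lemma volume_child : MeasureTheory.volume (M.child τ a).hull =
    2⁻¹ * MeasureTheory.volume τ.hull :=
  volume_hull_halfVerts h.isSimplex h.left_mem h.right_mem h.ne h.midpoint_eq

lemma mem_child_verts {v : Pt d} : v ∈ (M.child τ a).verts ↔
    v = edgeMidpoint (M.refEdge τ) ∨ v ≠ a ∧ v ∈ τ.verts := by
  simp [child, halfVerts]

lemma right_mem_child : b ∈ (M.child τ a).verts :=
  h.mem_child_verts.2 (Or.inr ⟨h.ne.symm, h.right_mem⟩)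

lemma left_notMem_child : a ∉ (M.child τ a).verts := by
  intro ha
  rcases h.mem_child_verts.1 ha with e | e
  · exact h.midpoint_notMem (e ▸ h.left_mem)
  · exact e.1 rfl

end IsRefPair

section nodes

variable (hM : M.IsOn Ω)
include hM

lemma isSimplex_of_mem_initialMesh {τ : Elem d} (h : τ ∈ M.initialMesh) : IsSimplex τ.verts := by
  obtain ⟨t, ht, rfl⟩ := Finset.mem_image.1 h
  exact ⟨hM.triangulation.card_eq t ht, hM.triangulation.affineIndependent t ht⟩

lemma isRefPair_of_isSimplex {τ : Elem d} (h : M.IsNode τ) (hs : IsSimplex τ.verts)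
    {a : Pt d} (ha : a ∈ M.refEdge τ) : ∃ b, M.IsRefPair τ a b := by
  obtain ⟨x, y, hxy, hE⟩ := Finset.card_eq_two.1 (hM.refEdge_card _ τ h)
  have hsub := hM.refEdge_subset _ τ h
  have key : M.IsRefPair τ x y := ⟨hs, hsub (by rw [hE]; simp), hsub (by rw [hE]; simp), hxy, hE⟩
  rw [hE, Finset.mem_insert, Finset.mem_singleton] at ha
  rcases ha with rfl | rfl
  · exact ⟨y, key⟩
  · exact ⟨x, key.symm⟩

lemma IsNode.isSimplex {τ : Elem d} (h : M.IsNode τ) : IsSimplex τ.verts := by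
  obtain ⟨k, hk⟩ : ∃ k, τ.gen = k := ⟨_, rfl⟩
  rw [IsNode, hk] at h
  induction k generalizing τ with
  | zero => exact isSimplex_of_mem_initialMesh hM h
  | succ k ih =>
    obtain ⟨σ, hσ, hτ⟩ := Finset.mem_biUnion.1 h
    obtain ⟨a, ha, rfl⟩ := mem_children_iff.1 hτ
    obtain ⟨b, hb⟩ := isRefPair_of_isSimplex hM (isNode_of_mem_uniformMesh hσ)
      (ih hσ (gen_of_mem_uniformMesh hσ)) ha
    exact hb.isSimplex_child

lemma IsNode.isRefPair {τ : Elem d} (h : M.IsNode τ) {a : Pt d} (ha : a ∈ M.refEdge τ) :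
    ∃ b, M.IsRefPair τ a b := isRefPair_of_isSimplex hM h (h.isSimplex hM) ha

lemma IsNode.exists_isRefPair {τ : Elem d} (h : M.IsNode τ) : ∃ a b, M.IsRefPair τ a b := by
  obtain ⟨x, y, hxy, hE⟩ := Finset.card_eq_two.1 (hM.refEdge_card _ τ h)
  exact ⟨x, h.isRefPair hM (by rw [hE]; simp)⟩

lemma IsNode.exists_of_mem_children {τ τ' : Elem d} (h : M.IsNode τ) (h' : τ' ∈ M.children τ) :
    ∃ a b, M.IsRefPair τ a b ∧ τ' = M.child τ a := by
  obtain ⟨a, ha, rfl⟩ := mem_children_iff.1 h'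
  obtain ⟨b, hb⟩ := h.isRefPair hM ha
  exact ⟨a, b, hb, rfl⟩

lemma IsNode.hull_subset_of_mem_children {τ τ' : Elem d} (h : M.IsNode τ)
    (h' : τ' ∈ M.children τ) : τ'.hull ⊆ τ.hull := by
  obtain ⟨a, b, hab, rfl⟩ := h.exists_of_mem_children hM h'
  exact fun x hx => (hab.mem_child_hull.1 hx).1

lemma IsNode.exists_child_hull {τ : Elem d} (h : M.IsNode τ) {x : Pt d} (hx : x ∈ τ.hull) :
    ∃ τ' ∈ M.children τ, x ∈ τ'.hull := by
  obtain ⟨a, b, hab⟩ := h.exists_isRefPair hM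
  rcases le_total (bary τ.verts a x) (bary τ.verts b x) with hle | hle
  · exact ⟨_, hab.child_mem, hab.mem_child_hull.2 ⟨hx, hle⟩⟩
  · exact ⟨_, hab.symm.child_mem, hab.symm.mem_child_hull.2 ⟨hx, hle⟩⟩

lemma IsNode.exists_child_verts {τ : Elem d} (h : M.IsNode τ) {v : Pt d} (hv : v ∈ τ.verts) :
    ∃ τ' ∈ M.children τ, v ∈ τ'.verts := by
  obtain ⟨a, b, hab⟩ := h.exists_isRefPair hM
  by_cases hva : v = a
  · exact ⟨_, hab.symm.child_mem, hab.symm.mem_child_verts.2 (Or.inr ⟨hva ▸ hab.ne, hv⟩)⟩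
  · exact ⟨_, hab.child_mem, hab.mem_child_verts.2 (Or.inr ⟨hva, hv⟩)⟩

lemma IsNode.exists_volume_eq {τ : Elem d} (h : M.IsNode τ) : ∃ τ₀ ∈ M.initialMesh,
    MeasureTheory.volume τ.hull = 2⁻¹ ^ τ.gen * MeasureTheory.volume τ₀.hull := by
  obtain ⟨k, hk⟩ : ∃ k, τ.gen = k := ⟨_, rfl⟩
  rw [IsNode, hk] at h
  rw [hk]
  induction k generalizing τ with
  | zero => exact ⟨τ, h, by simp⟩
  | succ k ih =>
    obtain ⟨σ, hσ, hτ⟩ := Finset.mem_biUnion.1 h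
    obtain ⟨a, b, hab, rfl⟩ := (isNode_of_mem_uniformMesh hσ).exists_of_mem_children hM hτ
    obtain ⟨τ₀, h₀, hv⟩ := ih hσ (gen_of_mem_uniformMesh hσ)
    exact ⟨τ₀, h₀, by rw [hab.volume_child, hv, pow_succ']; ring⟩

lemma vertices_uniformMesh_mono : Monotone fun k => (M.uniformMesh k).vertices := by
  refine monotone_nat_of_le_succ fun k v hv => ?_
  obtain ⟨τ, hτ, hvτ⟩ := Mesh.mem_vertices.1 hv
  obtain ⟨τ', hτ', hv'⟩ := (isNode_of_mem_uniformMesh hτ).exists_child_verts hM hvτ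
  exact Mesh.mem_vertices.2 ⟨τ', Finset.mem_biUnion.2 ⟨τ, hτ, hτ'⟩, hv'⟩

omit hM in
lemma IsNode.vertexGen_le {τ : Elem d} (h : M.IsNode τ) {v : Pt d} (hv : v ∈ τ.verts) :
    M.vertexGen v ≤ τ.gen :=
  Nat.sInf_le (Mesh.mem_vertices.2 ⟨τ, h, hv⟩)

variable (hU : M.UniformConformity)
include hU

/-- Elements of equal generation belong to one uniform refinement, which is conforming. -/
lemma IsNode.bary_eq {τ τ' : Elem d} (h : M.IsNode τ) (h' : M.IsNode τ') (hg : τ.gen = τ'.gen)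
    {x : Pt d} (hx : x ∈ τ.hull) (hx' : x ∈ τ'.hull) (v : Pt d) :
    bary τ.verts v x = bary τ'.verts v x := by
  rw [IsNode, ← hg] at h'
  exact ((h.isSimplex hM).inter_eq_iff ((isNode_of_mem_uniformMesh h').isSimplex hM)).1
    ((hU τ.gen).2 τ h τ' h') x hx hx' v

/-- Vertices of uniform refinements persist, so `v` is a vertex of the refinement that contains `τ`,
and conformity forbids hanging nodes. The contrapositive dates a point of `τ` that is not a vertex
of `τ`: it is born later than `τ`. -/
lemma mem_verts_of_vertexGen_le {τ : Elem d} (h : M.IsNode τ) {k : ℕ} {v : Pt d}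
    (hv : v ∈ (M.uniformMesh k).vertices) (hvτ : v ∈ τ.hull) (hg : M.vertexGen v ≤ τ.gen) :
    v ∈ τ.verts := by
  have hmem : v ∈ (M.uniformMesh (M.vertexGen v)).vertices :=
    Nat.sInf_mem (s := {k | v ∈ (M.uniformMesh k).vertices}) ⟨k, hv⟩
  obtain ⟨σ, hσ, hvσ⟩ := Mesh.mem_vertices.1 (vertices_uniformMesh_mono hM hg hmem)
  have hσ' := isNode_of_mem_uniformMesh hσ
  have := h.bary_eq hM hU hσ' (gen_of_mem_uniformMesh hσ).symm hvτ
    (subset_convexHull ℝ _ hvσ) v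
  rw [(hσ'.isSimplex hM).bary_self hvσ] at this
  exact IsSimplex.mem_verts_of_bary_ne (by rw [this]; norm_num)

/-- The link between the generation of a bisection and that of its elements: an older midpoint would
already be a vertex of `τ`. -/
lemma vertexGen_midpoint {τ : Elem d} (h : M.IsNode τ) :
    M.vertexGen (edgeMidpoint (M.refEdge τ)) = τ.gen + 1 := by
  obtain ⟨a, b, hab⟩ := h.exists_isRefPair hM
  have hc := h.child hab.child_mem
  have hmem : edgeMidpoint (M.refEdge τ) ∈ (M.child τ a).verts :=
    hab.mem_child_verts.2 (Or.inl rfl)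
  refine le_antisymm (hc.vertexGen_le hmem) ?_
  by_contra hlt
  exact hab.midpoint_notMem (mem_verts_of_vertexGen_le hM hU h
    (Mesh.mem_vertices.2 ⟨_, hc, hmem⟩) hab.midpoint_mem_hull (by omega))

end nodes

/-- The properties of the meshes obtained by compatible bisections: the elements can be created by
the method, they form a conforming mesh of `Ω`, and they are determined by their vertices. -/
structure IsAdmissible (M : BisectionMethod d) (Ω : Set (Pt d)) (T : Mesh d) : Prop where
  isNode : ∀ τ ∈ T, M.IsNode τ
  bary_eq : ∀ τ ∈ T, ∀ τ' ∈ T, ∀ x ∈ τ.hull, x ∈ τ'.hull →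
    ∀ v, bary τ.verts v x = bary τ'.verts v x
  eq_of_verts : ∀ τ ∈ T, ∀ τ' ∈ T, τ.verts = τ'.verts → τ = τ'
  cover : (⋃ τ ∈ T, τ.hull) = closure Ω

/-! ### Compatible bisections preserve admissibility. -/

section bisection

variable (hM : M.IsOn Ω)
include hM

lemma isAdmissible_initialMesh : M.IsAdmissible Ω M.initialMesh where
  isNode τ hτ := isNode_of_mem_uniformMesh (k := 0) hτ
  bary_eq τ hτ τ' hτ' := by
    refine ((isSimplex_of_mem_initialMesh hM hτ).inter_eq_iff
      (isSimplex_of_mem_initialMesh hM hτ')).1 ?_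
    obtain ⟨t, ht, rfl⟩ := Finset.mem_image.1 hτ
    obtain ⟨t', ht', rfl⟩ := Finset.mem_image.1 hτ'
    exact hM.triangulation.conforming t ht t' ht'
  eq_of_verts τ hτ τ' hτ' h := by
    obtain ⟨t, ht, rfl⟩ := Finset.mem_image.1 hτ
    obtain ⟨t', ht', rfl⟩ := Finset.mem_image.1 hτ'
    exact congrArg (fun t => (⟨t, 0⟩ : Elem d)) h
  cover := by
    rw [← hM.triangulation.cover, initialMesh]
    simp [Elem.hull]

namespace IsAdmissible

variable {T : Mesh d} (hT : M.IsAdmissible Ω T)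
include hT

lemma isSimplex {τ : Elem d} (hτ : τ ∈ T) : IsSimplex τ.verts := (hT.isNode τ hτ).isSimplex hM

lemma mem_verts {τ : Elem d} (hτ : τ ∈ T) {v : Pt d} (hv : v ∈ T.vertices) (hvτ : v ∈ τ.hull) :
    v ∈ τ.verts := by
  obtain ⟨σ, hσ, hvσ⟩ := Mesh.mem_vertices.1 hv
  have := hT.bary_eq τ hτ σ hσ v hvτ (subset_convexHull ℝ _ hvσ) v
  rw [(hT.isSimplex hM hσ).bary_self hvσ] at this
  exact IsSimplex.mem_verts_of_bary_ne (by rw [this]; norm_num)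

lemma eq_of_mem_interior {τ τ' : Elem d} (hτ : τ ∈ T) (hτ' : τ' ∈ T) {x : Pt d}
    (hx : x ∈ interior τ.hull) (hx' : x ∈ τ'.hull) : τ = τ' := by
  refine hT.eq_of_verts τ hτ τ' hτ' (Finset.eq_of_subset_of_card_le (fun v hv => ?_) ?_)
  · have h1 := (hT.isSimplex hM hτ).mem_interior_iff.1 hx v hv
    rw [hT.bary_eq τ hτ τ' hτ' x (interior_subset hx) hx' v] at h1
    exact IsSimplex.mem_verts_of_bary_ne h1.ne'
  · rw [(hT.isSimplex hM hτ).card_eq, (hT.isSimplex hM hτ').card_eq]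

variable {e : Finset (Pt d)} (he : M.IsCompatibleEdge T e)
include he

omit hM hT he in
lemma mem_addBisection {τ' : Elem d} : τ' ∈ M.addBisection T e ↔
    (τ' ∈ T ∧ ¬ e ⊆ τ'.verts) ∨ ∃ τ ∈ T, e ⊆ τ.verts ∧ τ' ∈ M.children τ := by
  simp only [addBisection, Finset.mem_union, Finset.mem_sdiff, Finset.mem_biUnion,
    Mesh.mem_edgeRing]
  tauto

lemma exists_pair : ∃ a b, ∀ τ ∈ T, e ⊆ τ.verts →
    M.IsRefPair τ a b ∧ e = {a, b} ∧ M.refEdge τ = e := by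
  obtain ⟨τ, hτ⟩ := he.1
  obtain ⟨hτT, heτ⟩ := Mesh.mem_edgeRing.1 hτ
  obtain ⟨a, b, hab⟩ := (hT.isNode τ hτT).exists_isRefPair hM
  have hee : e = {a, b} := by rw [← he.2 τ hτ, hab.refEdge_eq]
  refine ⟨a, b, fun σ hσ heσ => ?_⟩
  have hr := he.2 σ (Mesh.mem_edgeRing.2 ⟨hσ, heσ⟩)
  refine ⟨⟨hT.isSimplex hM hσ, heσ (by rw [hee]; simp), heσ (by rw [hee]; simp), hab.ne, ?_⟩, hee, hr⟩
  rw [hr, hee]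

lemma midpoint_notMem_vertices : edgeMidpoint e ∉ T.vertices := by
  intro hm
  obtain ⟨τ, hτ⟩ := he.1
  obtain ⟨hτT, heτ⟩ := Mesh.mem_edgeRing.1 hτ
  obtain ⟨a, b, hab⟩ := (hT.isNode τ hτT).exists_isRefPair hM
  have hr := he.2 τ hτ
  exact hab.midpoint_notMem (hr ▸ hT.mem_verts hM hτT hm (hr ▸ hab.midpoint_mem_hull))

/-- The elements of the bisected mesh, with the end points of the edge in a common order. -/
lemma exists_pair_addBisection : ∃ a b, e = {a, b} ∧ (∀ τ ∈ T, e ⊆ τ.verts →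
      M.IsRefPair τ a b ∧ M.refEdge τ = e) ∧
    ∀ τ' ∈ M.addBisection T e, (τ' ∈ T ∧ ¬ (a ∈ τ'.verts ∧ b ∈ τ'.verts)) ∨
      ∃ τ ∈ T, e ⊆ τ.verts ∧ (τ' = M.child τ a ∨ τ' = M.child τ b) := by
  obtain ⟨a, b, hab⟩ := hT.exists_pair hM he
  have hee : e = {a, b} := by
    obtain ⟨τ, hτ⟩ := he.1
    obtain ⟨hτT, heτ⟩ := Mesh.mem_edgeRing.1 hτ
    exact (hab τ hτT heτ).2.1
  refine ⟨a, b, hee, fun τ hτ h => ⟨(hab τ hτ h).1, (hab τ hτ h).2.2⟩, fun τ' hτ' => ?_⟩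
  rcases mem_addBisection.1 hτ' with ⟨h1, h2⟩ | ⟨τ, hτ, heτ, h⟩
  · refine Or.inl ⟨h1, fun h => h2 ?_⟩
    rw [hee]
    intro x hx
    rcases Finset.mem_insert.1 hx with rfl | hx
    · exact h.1
    · rw [Finset.mem_singleton.1 hx]; exact h.2
  · refine Or.inr ⟨τ, hτ, heτ, ?_⟩
    obtain ⟨c, hc, rfl⟩ := mem_children_iff.1 h
    rw [(hab τ hτ heτ).2.2, hee] at hc
    rcases Finset.mem_insert.1 hc with rfl | hc
    · exact Or.inl rfl
    · rw [Finset.mem_singleton.1 hc]; exact Or.inr rfl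

/-- The kept element misses an end point of the edge. If it misses `a`, conformity gives λ_a(x) = 0;
if it misses `b`, then λ_b(x) = 0 and λ_a ≤ λ_b on the child gives the same. Where λ_a = 0, child
and father have the same coordinates. -/
lemma bary_child_eq_of_mem {τ σ : Elem d} (hτ : τ ∈ T) (hσ : σ ∈ T) {a b : Pt d}
    (hab : M.IsRefPair τ a b) (hr : M.refEdge τ = e) (hσab : ¬ (a ∈ σ.verts ∧ b ∈ σ.verts))
    {x : Pt d} (hx : x ∈ (M.child τ a).hull) (hx' : x ∈ σ.hull) (v : Pt d) :
    bary (M.child τ a).verts v x = bary σ.verts v x := by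
  obtain ⟨hxτ, hle⟩ := hab.mem_child_hull.1 hx
  have hb := hT.bary_eq τ hτ σ hσ x hxτ hx'
  have ha0 : bary τ.verts a x = 0 := by
    by_cases ha : a ∈ σ.verts
    · have hb0 : bary τ.verts b x = 0 := by
        rw [hb, bary_of_notMem (fun h => hσab ⟨ha, h⟩)]
      exact le_antisymm (hb0 ▸ hle) ((hab.isSimplex.mem_hull_iff).1 hxτ a)
    · rw [hb, bary_of_notMem ha]
  have hmid : edgeMidpoint (M.refEdge τ) ∉ σ.verts := fun h =>
    hT.midpoint_notMem_vertices hM he (hr ▸ Mesh.mem_vertices.2 ⟨σ, hσ, h⟩)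
  rw [hab.bary_child, ha0, ← hb]
  split_ifs with h1 h2 h3
  · rw [h1, ha0]
  · rw [h2, sub_zero]
  · rw [h3, hb, bary_of_notMem hmid, mul_zero]
  · rfl

omit hM he in
lemma bary_child_eq_child {τ σ : Elem d} (hτ : τ ∈ T) (hσ : σ ∈ T) {a b : Pt d}
    (hab : M.IsRefPair τ a b) (hab' : M.IsRefPair σ a b)
    {x : Pt d} (hx : x ∈ (M.child τ a).hull) (hx' : x ∈ (M.child σ a).hull) (v : Pt d) :
    bary (M.child τ a).verts v x = bary (M.child σ a).verts v x := by
  have hb := hT.bary_eq τ hτ σ hσ x (hab.mem_child_hull.1 hx).1 (hab'.mem_child_hull.1 hx').1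
  rw [hab.bary_child, hab'.bary_child, hb, hb, hb, hab.refEdge_eq, hab'.refEdge_eq]

omit hM he in
-- Opposite halves can meet only where λ_a = λ_b, and there the formulas for both halves coincide.
lemma bary_child_eq_child_symm {τ σ : Elem d} (hτ : τ ∈ T) (hσ : σ ∈ T) {a b : Pt d}
    (hab : M.IsRefPair τ a b) (hab' : M.IsRefPair σ a b)
    {x : Pt d} (hx : x ∈ (M.child τ a).hull) (hx' : x ∈ (M.child σ b).hull) (v : Pt d) :
    bary (M.child τ a).verts v x = bary (M.child σ b).verts v x := by
  obtain ⟨h1, h2⟩ := hab.mem_child_hull.1 hx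
  obtain ⟨h1', h2'⟩ := hab'.symm.mem_child_hull.1 hx'
  have hb := hT.bary_eq τ hτ σ hσ x h1 h1'
  rw [← hb, ← hb] at h2'
  have heq := le_antisymm h2 h2'
  rw [hab.bary_child, hab'.symm.bary_child, ← hb, ← hb, ← hb, hab.refEdge_eq, hab'.refEdge_eq, heq]
  have := hab.ne
  split_ifs <;> simp_all

lemma addBisection_bary_eq : ∀ τ ∈ M.addBisection T e, ∀ τ' ∈ M.addBisection T e,
    ∀ x ∈ τ.hull, x ∈ τ'.hull → ∀ v, bary τ.verts v x = bary τ'.verts v x := by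
  obtain ⟨a, b, hee, hpair, hmem⟩ := hT.exists_pair_addBisection hM he
  intro τ hτ τ' hτ' x hx hx' v
  rcases hmem τ hτ with ⟨h1, h2⟩ | ⟨σ, hσ, heσ, rfl | rfl⟩
  · rcases hmem τ' hτ' with ⟨h1', h2'⟩ | ⟨σ', hσ', heσ', rfl | rfl⟩
    · exact hT.bary_eq τ h1 τ' h1' x hx hx' v
    · exact (hT.bary_child_eq_of_mem hM he hσ' h1 (hpair _ hσ' heσ').1 (hpair _ hσ' heσ').2 h2
        hx' hx v).symm
    · exact (hT.bary_child_eq_of_mem hM he hσ' h1 (hpair _ hσ' heσ').1.symm (hpair _ hσ' heσ').2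
        (fun h => h2 h.symm) hx' hx v).symm
  · rcases hmem τ' hτ' with ⟨h1', h2'⟩ | ⟨σ', hσ', heσ', rfl | rfl⟩
    · exact hT.bary_child_eq_of_mem hM he hσ h1' (hpair _ hσ heσ).1 (hpair _ hσ heσ).2 h2' hx hx' v
    · exact hT.bary_child_eq_child hσ hσ' (hpair _ hσ heσ).1 (hpair _ hσ' heσ').1 hx hx' v
    · exact hT.bary_child_eq_child_symm hσ hσ' (hpair _ hσ heσ).1 (hpair _ hσ' heσ').1 hx hx' v
  · rcases hmem τ' hτ' with ⟨h1', h2'⟩ | ⟨σ', hσ', heσ', rfl | rfl⟩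
    · exact hT.bary_child_eq_of_mem hM he hσ h1' (hpair _ hσ heσ).1.symm (hpair _ hσ heσ).2
        (fun h => h2' h.symm) hx hx' v
    · exact (hT.bary_child_eq_child_symm hσ' hσ (hpair _ hσ' heσ').1 (hpair _ hσ heσ).1 hx' hx v).symm
    · exact hT.bary_child_eq_child hσ hσ' (hpair _ hσ heσ).1.symm (hpair _ hσ' heσ').1.symm hx hx' v

/-- The father is recovered by exchanging the midpoint for `a`; the midpoint is no vertex of the old
mesh, so nothing is lost. -/
lemma child_injective {τ σ : Elem d} (hτ : τ ∈ T) (hσ : σ ∈ T) {a b : Pt d}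
    (hab : M.IsRefPair τ a b) (hab' : M.IsRefPair σ a b) (hr : M.refEdge τ = e)
    (hv : (M.child τ a).verts = (M.child σ a).verts) : τ = σ := by
  have hr' : M.refEdge σ = e := by rw [← hr, hab.refEdge_eq, hab'.refEdge_eq]
  refine hT.eq_of_verts τ hτ σ hσ (Finset.ext fun v => ?_)
  by_cases hva : v = a
  · simp [hva, hab.left_mem, hab'.left_mem]
  by_cases hvm : v = edgeMidpoint e
  · have h1 := hT.midpoint_notMem_vertices hM he
    have h2 : v ∉ τ.verts := fun h => h1 (hvm ▸ Mesh.mem_vertices.2 ⟨τ, hτ, h⟩)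
    have h3 : v ∉ σ.verts := fun h => h1 (hvm ▸ Mesh.mem_vertices.2 ⟨σ, hσ, h⟩)
    simp [h2, h3]
  · have h1 : v ∈ (M.child τ a).verts ↔ v ∈ (M.child σ a).verts := by rw [hv]
    rw [hab.mem_child_verts, hab'.mem_child_verts, hr, hr'] at h1
    tauto

omit hM hT he in
lemma child_ne_child {τ σ : Elem d} {a b : Pt d}
    (hab : M.IsRefPair τ a b) (hab' : M.IsRefPair σ a b) :
    (M.child τ a).verts ≠ (M.child σ b).verts := fun h =>
  hab'.symm.left_notMem_child (h ▸ hab.right_mem_child)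

lemma child_notMem {τ σ : Elem d} (hσ : σ ∈ T) {a b : Pt d}
    (hab : M.IsRefPair τ a b) (hr : M.refEdge τ = e) : (M.child τ a).verts ≠ σ.verts := fun h =>
  hT.midpoint_notMem_vertices hM he (Mesh.mem_vertices.2 ⟨σ, hσ, h ▸
    hab.mem_child_verts.2 (Or.inl (by rw [hr]))⟩)

lemma addBisection_eq_of_verts : ∀ τ ∈ M.addBisection T e, ∀ τ' ∈ M.addBisection T e,
    τ.verts = τ'.verts → τ = τ' := by
  obtain ⟨a, b, hee, hpair, hmem⟩ := hT.exists_pair_addBisection hM he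
  intro τ hτ τ' hτ' hv
  rcases hmem τ hτ with ⟨h1, h2⟩ | ⟨σ, hσ, heσ, rfl | rfl⟩
  · rcases hmem τ' hτ' with ⟨h1', h2'⟩ | ⟨σ', hσ', heσ', rfl | rfl⟩
    · exact hT.eq_of_verts τ h1 τ' h1' hv
    · exact absurd hv.symm (hT.child_notMem hM he h1 (hpair _ hσ' heσ').1 (hpair _ hσ' heσ').2)
    · exact absurd hv.symm (hT.child_notMem hM he h1 (hpair _ hσ' heσ').1.symm (hpair _ hσ' heσ').2)
  · rcases hmem τ' hτ' with ⟨h1', h2'⟩ | ⟨σ', hσ', heσ', rfl | rfl⟩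
    · exact absurd hv (hT.child_notMem hM he h1' (hpair _ hσ heσ).1 (hpair _ hσ heσ).2)
    · rw [hT.child_injective hM he hσ hσ' (hpair _ hσ heσ).1 (hpair _ hσ' heσ').1
        (hpair _ hσ heσ).2 hv]
    · exact absurd hv (child_ne_child (hpair _ hσ heσ).1 (hpair _ hσ' heσ').1)
  · rcases hmem τ' hτ' with ⟨h1', h2'⟩ | ⟨σ', hσ', heσ', rfl | rfl⟩
    · exact absurd hv (hT.child_notMem hM he h1' (hpair _ hσ heσ).1.symm (hpair _ hσ heσ).2)
    · exact absurd hv.symm (child_ne_child (hpair _ hσ' heσ').1 (hpair _ hσ heσ).1)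
    · rw [hT.child_injective hM he hσ hσ' (hpair _ hσ heσ).1.symm (hpair _ hσ' heσ').1.symm
        (hpair _ hσ heσ).2 hv]

omit he in
/-- An element of the old mesh is kept or covered by its children. -/
lemma mem_addBisection_or {τ : Elem d} (hτ : τ ∈ T) : τ ∈ M.addBisection T e ∨
    ∀ x ∈ τ.hull, ∃ τ' ∈ M.addBisection T e, x ∈ τ'.hull ∧ τ'.gen = τ.gen + 1 := by
  by_cases heτ : e ⊆ τ.verts
  · refine Or.inr fun x hx => ?_
    obtain ⟨τ', h', hx'⟩ := (hT.isNode τ hτ).exists_child_hull hM hx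
    exact ⟨τ', mem_addBisection.2 (Or.inr ⟨τ, hτ, heτ, h'⟩), hx', gen_of_mem_children h'⟩
  · exact Or.inl (mem_addBisection.2 (Or.inl ⟨hτ, heτ⟩))

omit he in
/-- An element of the new mesh is old or contained in its father. -/
lemma exists_father {τ' : Elem d} (hτ' : τ' ∈ M.addBisection T e) : τ' ∈ T ∨
    ∃ τ ∈ T, τ'.hull ⊆ τ.hull ∧ τ'.gen = τ.gen + 1 := by
  rcases mem_addBisection.1 hτ' with ⟨h1, h2⟩ | ⟨τ, hτ, heτ, h⟩
  · exact Or.inl h1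
  · exact Or.inr ⟨τ, hτ, (hT.isNode τ hτ).hull_subset_of_mem_children hM h, gen_of_mem_children h⟩

lemma addBisection : M.IsAdmissible Ω (M.addBisection T e) where
  isNode τ hτ := by
    rcases mem_addBisection.1 hτ with ⟨h1, h2⟩ | ⟨σ, hσ, heσ, h⟩
    · exact hT.isNode τ h1
    · exact (hT.isNode σ hσ).child h
  bary_eq := hT.addBisection_bary_eq hM he
  eq_of_verts := hT.addBisection_eq_of_verts hM he
  cover := by
    rw [← hT.cover]
    apply Set.Subset.antisymm
    · refine Set.iUnion₂_subset fun τ hτ => ?_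
      rcases hT.exists_father hM hτ with h | ⟨σ, hσ, hsub, -⟩
      · exact Set.subset_biUnion_of_mem (u := fun τ : Elem d => τ.hull) h
      · exact hsub.trans (Set.subset_biUnion_of_mem (u := fun τ : Elem d => τ.hull) hσ)
    · refine Set.iUnion₂_subset fun τ hτ x hx => ?_
      rcases hT.mem_addBisection_or hM (e := e) hτ with h | h
      · exact Set.mem_biUnion (t := fun τ : Elem d => τ.hull) h hx
      · obtain ⟨τ', h', hx', -⟩ := h x hx
        exact Set.mem_biUnion (t := fun τ : Elem d => τ.hull) h' hx'

omit he in
lemma vertices_subset_addBisection : T.vertices ⊆ (M.addBisection T e).vertices := by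
  intro v hv
  obtain ⟨τ, hτ, hvτ⟩ := Mesh.mem_vertices.1 hv
  by_cases heτ : e ⊆ τ.verts
  · obtain ⟨τ', h', hx'⟩ := (hT.isNode τ hτ).exists_child_verts hM hvτ
    exact Mesh.mem_vertices.2 ⟨τ', mem_addBisection.2 (Or.inr ⟨τ, hτ, heτ, h'⟩), hx'⟩
  · exact Mesh.mem_vertices.2 ⟨τ, mem_addBisection.2 (Or.inl ⟨hτ, heτ⟩), hvτ⟩

/-- The elements around an old vertex of the bisected mesh are old or children of such elements. -/
lemma mem_ring_addBisection {q : Pt d} (hq : q ≠ edgeMidpoint e) {τ' : Elem d}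
    (h : τ' ∈ (M.addBisection T e).ring q) : τ' ∈ T.ring q ∨
      ∃ τ ∈ T.ring q, e ⊆ τ.verts ∧ τ' ∈ M.children τ := by
  obtain ⟨h1, h2⟩ := Mesh.mem_ring.1 h
  rcases mem_addBisection.1 h1 with ⟨h3, h4⟩ | ⟨σ, hσ, heσ, h5⟩
  · exact Or.inl (Mesh.mem_ring.2 ⟨h3, h2⟩)
  · refine Or.inr ⟨σ, Mesh.mem_ring.2 ⟨hσ, ?_⟩, heσ, h5⟩
    obtain ⟨a, b, hab, rfl⟩ := (hT.isNode σ hσ).exists_of_mem_children hM h5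
    have hr := he.2 σ (Mesh.mem_edgeRing.2 ⟨hσ, heσ⟩)
    rcases hab.mem_child_verts.1 h2 with h6 | h6
    · exact absurd (h6.trans (by rw [hr])) hq
    · exact h6.2

variable (hU : M.UniformConformity)
include hU

lemma gen_of_subset {τ : Elem d} (hτ : τ ∈ T) (heτ : e ⊆ τ.verts) :
    M.vertexGen (edgeMidpoint e) = τ.gen + 1 := by
  rw [← vertexGen_midpoint hM hU (hT.isNode τ hτ), he.2 τ (Mesh.mem_edgeRing.2 ⟨hτ, heτ⟩)]

end IsAdmissible

end bisection

end BisectionMethod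

end

/-! ### Nodal basis functions and rings under a compatible bisection. -/

section
open scoped Classical

variable {d : ℕ}

lemma IsSimplex.eq_bary {t : Finset (Pt d)} (h : IsSimplex t) {p : Pt d} {f : Pt d →ᵃ[ℝ] ℝ}
    (hp : p ∈ t → f p = 1) (hne : ∀ q ∈ t, q ≠ p → f q = 0) : f = bary t p := by
  refine h.affine_ext fun q hq => ?_
  by_cases hqp : q = p
  · subst hqp; rw [hp hq, h.bary_self hq]
  · rw [hne q hq hqp, h.bary_ne hq (Ne.symm hqp)]

namespace BisectionMethod

variable {M : BisectionMethod d} {Ω : Set (Pt d)} (hM : M.IsOn Ω)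
include hM

section nodal

variable {T : Mesh d} (hT : M.IsAdmissible Ω T)
include hT

/-- Nodal basis functions are given by barycentric coordinates. -/
lemma IsAdmissible.nodal_eq_bary {p : Pt d} {φ : Pt d → ℝ} (hφ : T.IsNodalBasisFunction Ω p φ)
    {τ : Elem d} (hτ : τ ∈ T) {x : Pt d} (hx : x ∈ τ.hull) : φ x = bary τ.verts p x := by
  obtain ⟨⟨-, haff, -⟩, h1, h0⟩ := hφ
  obtain ⟨f, hf⟩ := haff τ hτ
  have hmem : ∀ q ∈ τ.verts, q ∈ τ.hull := fun q hq => subset_convexHull ℝ _ hq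
  rw [hf x hx, (hT.isSimplex hM hτ).eq_bary (p := p) (f := f)]
  · intro hp
    rw [← hf p (hmem p hp), h1]
  · intro q hq hqp
    rw [← hf q (hmem q hq), h0 q (Mesh.mem_vertices.2 ⟨τ, hτ, hq⟩) hqp]

variable {e : Finset (Pt d)} (he : M.IsCompatibleEdge T e)
include he

omit hM hT he in
lemma mem_triplet_of_mem {q : Pt d} (hq : q ∈ e) : q ∈ triplet e := Or.inl hq

/-- A nodal basis function survives the bisections of edges that do not contain its node. -/
lemma IsAdmissible.nodal_addBisection {q : Pt d} (hq : q ∉ triplet e) {φ : Pt d → ℝ}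
    (hφ : T.IsNodalBasisFunction Ω q φ) : (M.addBisection T e).IsNodalBasisFunction Ω q φ := by
  obtain ⟨⟨hcont, haff, hout⟩, h1, h0⟩ := hφ
  refine ⟨⟨hcont, fun τ' hτ' => ?_, hout⟩, h1, fun v hv hvq => ?_⟩
  · rcases hT.exists_father hM hτ' with h | ⟨τ, hτ, hsub, -⟩
    · exact haff τ' h
    · obtain ⟨f, hf⟩ := haff τ hτ
      exact ⟨f, fun x hx => hf x (hsub hx)⟩
  · obtain ⟨τ', hτ', hvτ'⟩ := Mesh.mem_vertices.1 hv
    rcases IsAdmissible.mem_addBisection.1 hτ' with ⟨h2, -⟩ | ⟨τ, hτ, heτ, h2⟩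
    · exact h0 v (Mesh.mem_vertices.2 ⟨τ', h2, hvτ'⟩) hvq
    · obtain ⟨a, b, hab, rfl⟩ := (hT.isNode τ hτ).exists_of_mem_children hM h2
      have hr := he.2 τ (Mesh.mem_edgeRing.2 ⟨hτ, heτ⟩)
      rcases hab.mem_child_verts.1 hvτ' with h3 | h3
      -- The only new vertex is the midpoint; `φ` is affine on `τ` and vanishes at both end points
      -- of the edge, as `q` is neither.
      · rw [hT.nodal_eq_bary hM ⟨⟨hcont, haff, hout⟩, h1, h0⟩ hτ (h3 ▸ hab.midpoint_mem_hull), h3]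
        refine bary_midpoint_of_ne hab.isSimplex hab.left_mem hab.right_mem hab.ne
          hab.midpoint_eq ?_ ?_ <;> rintro rfl <;> refine hq (mem_triplet_of_mem ?_) <;>
          rw [← hr, hab.refEdge_eq] <;> simp
      · exact h0 v (Mesh.mem_vertices.2 ⟨τ, hτ, h3.2⟩) hvq

/-- Each bisected element around `q` enlarges the first ring of `q`, if `q` is not on the edge. -/
lemma IsAdmissible.card_ring_addBisection {q : Pt d} (hq : q ∉ triplet e) :
    (T.ring q).card ≤ ((M.addBisection T e).ring q).card ∧
      ∀ τ ∈ T.ring q, e ⊆ τ.verts →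
        (T.ring q).card + 1 ≤ ((M.addBisection T e).ring q).card := by
  obtain ⟨a, b, hee, hpair, -⟩ := hT.exists_pair_addBisection hM he
  have hqa : q ≠ a := by rintro rfl; exact hq (mem_triplet_of_mem (by rw [hee]; simp))
  have hqb : q ≠ b := by rintro rfl; exact hq (mem_triplet_of_mem (by rw [hee]; simp))
  -- This embeds the old ring into the new one. As `q` is not on the edge, the child replacing `b`
  -- contains `q` too and lies outside the image, which gives the extra element.
  set f : Elem d → Elem d := fun τ => if e ⊆ τ.verts then M.child τ a else τ with hf
  have hmaps : ∀ τ ∈ T.ring q, f τ ∈ (M.addBisection T e).ring q := by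
    intro τ hτ
    obtain ⟨hτT, hqτ⟩ := Mesh.mem_ring.1 hτ
    simp only [hf]
    split_ifs with heτ
    · have hab := (hpair τ hτT heτ).1
      exact Mesh.mem_ring.2 ⟨IsAdmissible.mem_addBisection.2 (Or.inr ⟨τ, hτT, heτ, hab.child_mem⟩),
        hab.mem_child_verts.2 (Or.inr ⟨hqa, hqτ⟩)⟩
    · exact Mesh.mem_ring.2 ⟨IsAdmissible.mem_addBisection.2 (Or.inl ⟨hτT, heτ⟩), hqτ⟩
  have hinj : Set.InjOn f (T.ring q) := by
    intro τ hτ σ hσ h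
    obtain ⟨hτT, hqτ⟩ := Mesh.mem_ring.1 hτ
    obtain ⟨hσT, hqσ⟩ := Mesh.mem_ring.1 hσ
    simp only [hf] at h
    split_ifs at h with h1 h2 h2
    · exact hT.child_injective hM he hτT hσT (hpair τ hτT h1).1 (hpair σ hσT h2).1
        (hpair τ hτT h1).2 (congrArg _ h)
    · exact absurd (congrArg Elem.verts h)
        (hT.child_notMem hM he hσT (hpair τ hτT h1).1 (hpair τ hτT h1).2)
    · exact absurd (congrArg Elem.verts h.symm)
        (hT.child_notMem hM he hτT (hpair σ hσT h2).1 (hpair σ hσT h2).2)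
    · exact h
  have himg : (T.ring q).image f ⊆ (M.addBisection T e).ring q := Finset.image_subset_iff.2 hmaps
  have hcard : ((T.ring q).image f).card = (T.ring q).card := Finset.card_image_of_injOn hinj
  refine ⟨hcard ▸ Finset.card_le_card himg, fun τ hτ heτ => ?_⟩
  obtain ⟨hτT, hqτ⟩ := Mesh.mem_ring.1 hτ
  have hab := (hpair τ hτT heτ).1
  have hnew : M.child τ b ∈ (M.addBisection T e).ring q :=
    Mesh.mem_ring.2 ⟨IsAdmissible.mem_addBisection.2 (Or.inr ⟨τ, hτT, heτ, hab.symm.child_mem⟩),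
      hab.symm.mem_child_verts.2 (Or.inr ⟨hqb, hqτ⟩)⟩
  have hnot : M.child τ b ∉ (T.ring q).image f := by
    intro h
    obtain ⟨σ, hσ, hs⟩ := Finset.mem_image.1 h
    obtain ⟨hσT, hqσ⟩ := Mesh.mem_ring.1 hσ
    simp only [hf] at hs
    split_ifs at hs with h1
    · exact IsAdmissible.child_ne_child (hpair σ hσT h1).1 hab (congrArg _ hs)
    · exact hT.child_notMem hM he hσT hab.symm (hpair τ hτT heτ).2 (congrArg Elem.verts hs.symm)
  rw [← hcard, ← Finset.card_insert_of_notMem hnot]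
  exact Finset.card_le_card (Finset.insert_subset hnew himg)

end nodal

/-! ### The history of elements and of vertex rings along the sequence. -/

section sequence

variable {e : ℕ → Finset (Pt d)} {J : ℕ} (hc : M.IsCompatibleSequence e J)
include hc

lemma isAdmissible_mesh {j : ℕ} (hj : j ≤ J) : M.IsAdmissible Ω (M.mesh e j) := by
  induction j with
  | zero => exact isAdmissible_initialMesh hM
  | succ j ih => exact (ih (by omega)).addBisection hM (hc j (by omega))

lemma vertices_mesh_mono {i j : ℕ} (hij : i ≤ j) (hj : j ≤ J) :
    (M.mesh e i).vertices ⊆ (M.mesh e j).vertices := by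
  induction j, hij using Nat.le_induction with
  | base => exact subset_rfl
  | succ j hij ih =>
    exact (ih (by omega)).trans
      ((isAdmissible_mesh hM hc (show j ≤ J by omega)).vertices_subset_addBisection hM)

lemma exists_ancestor {i j : ℕ} (hij : i ≤ j) (hj : j ≤ J) {τ : Elem d} (hτ : τ ∈ M.mesh e j) :
    ∃ σ ∈ M.mesh e i, τ.hull ⊆ σ.hull ∧ σ.gen ≤ τ.gen := by
  induction j, hij using Nat.le_induction generalizing τ with
  | base => exact ⟨τ, hτ, subset_rfl, le_rfl⟩
  | succ j hij ih =>
    rcases (isAdmissible_mesh hM hc (show j ≤ J by omega)).exists_father hM hτ with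
      h | ⟨τ', h, hsub, hg⟩
    · exact ih (by omega) h
    · obtain ⟨σ, hσ, h1, h2⟩ := ih (by omega) h
      exact ⟨σ, hσ, hsub.trans h1, by omega⟩

lemma mem_mesh_or {i j : ℕ} (hij : i ≤ j) (hj : j ≤ J) {τ : Elem d} (hτ : τ ∈ M.mesh e i) :
    τ ∈ M.mesh e j ∨ ∀ x ∈ τ.hull, ∃ τ' ∈ M.mesh e j, x ∈ τ'.hull ∧ τ.gen < τ'.gen := by
  induction j, hij using Nat.le_induction with
  | base => exact Or.inl hτ
  | succ j hij ih =>
    have key := fun σ hσ => (isAdmissible_mesh hM hc (show j ≤ J by omega)).mem_addBisection_or hM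
      (e := e (j + 1)) (τ := σ) hσ
    rcases ih (by omega) with h | h
    · rcases key τ h with h1 | h1
      · exact Or.inl h1
      · refine Or.inr fun x hx => ?_
        obtain ⟨τ', h2, h3, h4⟩ := h1 x hx
        exact ⟨τ', h2, h3, by omega⟩
    · refine Or.inr fun x hx => ?_
      obtain ⟨σ, h1, h2, h3⟩ := h x hx
      rcases key σ h1 with h4 | h4
      · exact ⟨σ, h4, h2, h3⟩
      · obtain ⟨τ', h5, h6, h7⟩ := h4 x h2
        exact ⟨τ', h5, h6, by omega⟩

/-- Going back from child to father lowers the generation by one at a time down to zero, so no value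
is skipped. -/
lemma exists_ancestor_gen {j m : ℕ} (hj : j ≤ J) {τ : Elem d} (hτ : τ ∈ M.mesh e j)
    (hm : m ≤ τ.gen) : ∃ i ≤ j, ∃ σ ∈ M.mesh e i, σ.gen = m ∧ τ.hull ⊆ σ.hull := by
  induction j generalizing τ with
  | zero =>
    have := gen_of_mem_initialMesh (M := M) hτ
    exact ⟨0, le_rfl, τ, hτ, by omega, subset_rfl⟩
  | succ j ih =>
    by_cases hg : τ.gen = m
    · exact ⟨j + 1, le_rfl, τ, hτ, hg, subset_rfl⟩
    rcases (isAdmissible_mesh hM hc (show j ≤ J by omega)).exists_father hM hτ with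
      h | ⟨τ', h, hsub, hg'⟩
    · obtain ⟨i, hi, σ, h1, h2, h3⟩ := ih (by omega) h hm
      exact ⟨i, by omega, σ, h1, h2, h3⟩
    · obtain ⟨i, hi, σ, h1, h2, h3⟩ := ih (by omega) h (by omega)
      exact ⟨i, by omega, σ, h1, h2, hsub.trans h3⟩

lemma exists_uniformMesh_of_mem_vertices {j : ℕ} (hj : j ≤ J) {q : Pt d}
    (hq : q ∈ (M.mesh e j).vertices) : ∃ k, q ∈ (M.uniformMesh k).vertices := by
  obtain ⟨τ, hτ, hqτ⟩ := Mesh.mem_vertices.1 hq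
  exact ⟨τ.gen, Mesh.mem_vertices.2 ⟨τ, (isAdmissible_mesh hM hc hj).isNode τ hτ, hqτ⟩⟩

variable (hU : M.UniformConformity)
include hU

lemma bisectionGen_succ {j : ℕ} (hj : j < J) {τ : Elem d} (hτ : τ ∈ M.mesh e j)
    (heτ : e (j + 1) ⊆ τ.verts) : M.bisectionGen e (j + 1) = τ.gen + 1 := by
  rw [bisectionGen, if_neg (by omega)]
  exact (isAdmissible_mesh hM hc hj.le).gen_of_subset hM (hc j hj) hU hτ heτ

/-- Around each node of a bisection triplet there is a new element. -/
lemma exists_mem_ring_of_mem_triplet {j : ℕ} (hj : j < J) {q : Pt d}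
    (hq : q ∈ triplet (e (j + 1))) :
    ∃ τ ∈ (M.mesh e (j + 1)).ring q, τ.gen = M.bisectionGen e (j + 1) := by
  have hT := isAdmissible_mesh hM hc hj.le
  obtain ⟨τ, hτ⟩ := (hc j hj).1
  obtain ⟨hτT, heτ⟩ := Mesh.mem_edgeRing.1 hτ
  have hr := (hc j hj).2 τ hτ
  obtain ⟨a, b, hab⟩ := (hT.isNode τ hτT).exists_isRefPair hM
  have hee : e (j + 1) = {a, b} := by rw [← hr, hab.refEdge_eq]
  have hmem : ∀ τ' ∈ M.children τ, q ∈ τ'.verts →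
      ∃ τ ∈ (M.mesh e (j + 1)).ring q, τ.gen = M.bisectionGen e (j + 1) := by
    intro τ' h1 h2
    refine ⟨τ', Mesh.mem_ring.2 ⟨IsAdmissible.mem_addBisection.2 (Or.inr ⟨τ, hτT, heτ, h1⟩), h2⟩, ?_⟩
    rw [gen_of_mem_children h1, bisectionGen_succ hM hc hU hj hτT heτ]
  rcases hq with h | h
  · rw [hee, Finset.mem_insert, Finset.mem_singleton] at h
    rcases h with rfl | rfl
    · exact hmem _ hab.symm.child_mem hab.symm.right_mem_child
    · exact hmem _ hab.child_mem hab.right_mem_child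
  · exact hmem _ hab.child_mem (hab.mem_child_verts.2 (Or.inl (by rw [hr, h])))

/-- A node lies on an earlier bisection triplet whose generation is controlled from below by the
size of the ring, unless the generations in its ring are controlled by the size of the ring. -/
lemma exists_triplet_or {j : ℕ} (hj : j ≤ J) {q : Pt d} (hq : q ∈ (M.mesh e j).vertices) :
    (∀ τ ∈ (M.mesh e j).ring q, τ.gen + 1 ≤ ((M.mesh e j).ring q).card) ∨
      ∃ i, 1 ≤ i ∧ i ≤ j ∧ q ∈ triplet (e i) ∧ q ∈ (M.mesh e i).vertices ∧
        (∀ φ, (M.mesh e i).IsNodalBasisFunction Ω q φ → (M.mesh e j).IsNodalBasisFunction Ω q φ) ∧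
        (∃ τ ∈ (M.mesh e j).ring q,
          τ.gen + 1 ≤ M.bisectionGen e i + ((M.mesh e j).ring q).card) ∧
        ∃ τ ∈ (M.mesh e j).ring q, M.bisectionGen e i ≤ τ.gen := by
  induction j with
  | zero =>
    refine Or.inl fun τ hτ => ?_
    rw [gen_of_mem_initialMesh (Mesh.mem_ring.1 hτ).1]
    exact Finset.card_pos.2 ⟨τ, hτ⟩
  | succ j ih =>
    by_cases hqe : q ∈ triplet (e (j + 1))
    -- The present bisection touches `q`: it becomes the reference bisection and the count starts
    -- anew.
    · obtain ⟨τ, hτ, hg⟩ := exists_mem_ring_of_mem_triplet hM hc hU (by omega) hqe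
      refine Or.inr ⟨j + 1, by omega, le_rfl, hqe, hq, fun φ h => h, ⟨τ, hτ, ?_⟩, τ, hτ, hg.ge⟩
      have : 0 < ((M.mesh e (j + 1)).ring q).card := Finset.card_pos.2 ⟨τ, hτ⟩
      omega
    have hT := isAdmissible_mesh hM hc (show j ≤ J by omega)
    have he := hc j (by omega)
    obtain ⟨hcard, hcard'⟩ := hT.card_ring_addBisection hM he hqe
    have hqm : q ≠ edgeMidpoint (e (j + 1)) := fun h => hqe (Or.inr h)
    have hring := fun τ' => hT.mem_ring_addBisection hM he hqm (τ' := τ')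
    have hqj : q ∈ (M.mesh e j).vertices := by
      obtain ⟨τ', h1, h2⟩ := Mesh.mem_vertices.1 hq
      rcases hring τ' (Mesh.mem_ring.2 ⟨h1, h2⟩) with h | ⟨τ, h, -⟩ <;>
        exact Mesh.mem_vertices.2 ⟨_, Mesh.mem_ring.1 h⟩
    -- An increase of the generation by one is paid for by at least one more element in the ring.
    have hup : ∀ τ ∈ (M.mesh e j).ring q, ∃ τ' ∈ (M.mesh e (j + 1)).ring q, τ.gen ≤ τ'.gen ∧
        τ'.gen + ((M.mesh e j).ring q).card ≤ τ.gen + ((M.mesh e (j + 1)).ring q).card := by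
      intro τ hτ
      obtain ⟨h1, h2⟩ := Mesh.mem_ring.1 hτ
      by_cases heτ : e (j + 1) ⊆ τ.verts
      · obtain ⟨τ', h3, h4⟩ := (hT.isNode τ h1).exists_child_verts hM h2
        have := hcard' τ hτ heτ
        have hg := gen_of_mem_children h3
        refine ⟨τ', Mesh.mem_ring.2
          ⟨IsAdmissible.mem_addBisection.2 (Or.inr ⟨τ, h1, heτ, h3⟩), h4⟩, by omega, ?_⟩
        rw [hg, mesh]; omega
      · exact ⟨τ, Mesh.mem_ring.2 ⟨IsAdmissible.mem_addBisection.2 (Or.inl ⟨h1, heτ⟩), h2⟩, le_rfl,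
          by rw [mesh]; omega⟩
    rcases ih (by omega) hqj with h | ⟨i, h1, h2, h3, h4, h5, ⟨τ, h6, h7⟩, τ', h8, h9⟩
    · refine Or.inl fun τ' hτ' => ?_
      rcases hring τ' hτ' with h1 | ⟨τ, h1, h2, h3⟩
      · exact (h τ' h1).trans hcard
      · have := h τ h1
        have := hcard' τ h1 h2
        rw [gen_of_mem_children h3, mesh]; omega
    · refine Or.inr ⟨i, h1, by omega, h3, h4,
        fun φ hφ => hT.nodal_addBisection hM he hqe (h5 φ hφ), ?_, ?_⟩
      · obtain ⟨σ, hσ, h10, h11⟩ := hup τ h6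
        exact ⟨σ, hσ, by omega⟩
      · obtain ⟨σ, hσ, h10, h11⟩ := hup τ' h8
        exact ⟨σ, hσ, by omega⟩

/-- Before the level of a node exceeds `m`, its ring contains an element of generation `m`. -/
lemma exists_mesh_level_eq {j m : ℕ} (hj : j ≤ J) {q : Pt d} (hq : q ∈ (M.mesh e j).vertices)
    (hgen : M.vertexGen q ≤ m) (hlev : ∃ τ ∈ (M.mesh e j).ring q, m < τ.gen) :
    ∃ i ≤ j, q ∈ (M.mesh e i).vertices ∧ (∀ τ ∈ (M.mesh e i).ring q, τ.gen ≤ m) ∧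
      ∃ τ ∈ (M.mesh e i).ring q, τ.gen = m := by
  induction j with
  | zero =>
    obtain ⟨τ, h1, h2⟩ := hlev
    have := gen_of_mem_initialMesh (Mesh.mem_ring.1 h1).1
    omega
  | succ j ih =>
    have hT := isAdmissible_mesh hM hc (show j ≤ J by omega)
    have he := hc j (by omega)
    obtain ⟨τ', hτ', hg⟩ := hlev
    -- All elements around a newborn vertex have the generation of that vertex, which is at most
    -- `m`.
    have hqm : q ≠ edgeMidpoint (e (j + 1)) := by
      rintro rfl
      obtain ⟨h1, h2⟩ := Mesh.mem_ring.1 hτ'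
      rcases IsAdmissible.mem_addBisection.1 h1 with ⟨h3, -⟩ | ⟨τ, h3, h4, h5⟩
      · exact hT.midpoint_notMem_vertices hM he (Mesh.mem_vertices.2 ⟨τ', h3, h2⟩)
      · rw [hT.gen_of_subset hM he hU h3 h4, ← gen_of_mem_children h5] at hgen
        omega
    have hring := fun τ' => hT.mem_ring_addBisection hM he hqm (τ' := τ')
    have hqj : q ∈ (M.mesh e j).vertices := by
      rcases hring τ' hτ' with h | ⟨τ, h, -⟩ <;>
        exact Mesh.mem_vertices.2 ⟨_, Mesh.mem_ring.1 h⟩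
    by_cases hlev : ∃ τ ∈ (M.mesh e j).ring q, m < τ.gen
    · obtain ⟨i, h1, h2⟩ := ih (by omega) hqj hlev
      exact ⟨i, by omega, h2⟩
    -- This is the step at which the level passes `m`, so the father of `τ'` has generation exactly
    -- `m`.
    · push Not at hlev
      refine ⟨j, by omega, hqj, hlev, ?_⟩
      rcases hring τ' hτ' with h | ⟨τ, h, -, h'⟩
      · have := hlev τ' h; omega
      · have := hlev τ h
        have := gen_of_mem_children h'
        exact ⟨τ, h, by omega⟩

end sequence

end BisectionMethod

end

/-! ### Existence of nodal basis functions on a Lipschitz domain. -/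

section
open scoped Classical
open Filter Topology

variable {d : ℕ}

lemma Elem.isClosed_hull (τ : Elem d) : IsClosed τ.hull :=
  (IsSimplex.hull_isCompact τ.verts).isClosed

lemma Elem.subset_hull (τ : Elem d) {v : Pt d} (hv : v ∈ τ.verts) : v ∈ τ.hull :=
  subset_convexHull ℝ _ hv

lemma Mesh.mem_interiorVertices {Ω : Set (Pt d)} {T : Mesh d} {q : Pt d} :
    q ∈ T.interiorVertices Ω ↔ q ∈ T.vertices ∧ q ∈ Ω := by
  simp [Mesh.interiorVertices]

lemma Mesh.level_le_iff {T : Mesh d} {q : Pt d} {m : ℕ} :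
    T.level q ≤ m ↔ ∀ τ ∈ T.ring q, τ.gen ≤ m := Finset.sup_le_iff

/-- A Lipschitz domain has no slits: the points p - s n, s > 0 small, lie strictly below the graph,
in an open set disjoint from `Ω` and hence from its closure. This forces a nodal function of an
interior vertex to vanish on the boundary. -/
lemma IsBoundedLipschitzDomain.notMem_interior_closure {Ω : Set (Pt d)}
    (hΩ : IsBoundedLipschitzDomain Ω) {p : Pt d} (hp : p ∈ frontier Ω) :
    p ∉ interior (closure Ω) := by
  intro hint
  obtain ⟨n, r, K, g, hn, hr, hg, hchart⟩ := hΩ.lipschitz_boundary p hp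
  have hpΩ : p ∉ Ω := fun h => by
    rw [hΩ.isOpen.frontier_eq] at hp; exact hp.2 h
  have hpg : inner ℝ n p ≤ g (p - (inner ℝ n p) • n) :=
    not_lt.1 fun h => hpΩ ((hchart p (Metric.mem_ball_self hr)).2 h)
  have hnn : inner ℝ n n = (1 : ℝ) := by rw [real_inner_self_eq_norm_sq, hn]; norm_num
  set U : Set (Pt d) := {y | inner ℝ n y < g (y - (inner ℝ n y) • n)} ∩ Metric.ball p r with hU
  have hUo : IsOpen U := by
    refine IsOpen.inter (isOpen_lt (by fun_prop) ?_) Metric.isOpen_ball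
    exact hg.continuous.comp (by fun_prop)
  have hUΩ : Disjoint U Ω := by
    rw [Set.disjoint_left]
    rintro y ⟨h1, h2⟩ h3
    exact absurd ((hchart y h2).1 h3) (not_lt.2 (le_of_lt h1))
  have hU' : Disjoint U (closure Ω) := hUΩ.closure_right hUo
  have htend : Tendsto (fun s : ℝ => p - s • n) (𝓝[>] 0) (𝓝 p) := by
    have : Tendsto (fun s : ℝ => p - s • n) (𝓝 0) (𝓝 (p - (0 : ℝ) • n)) :=
      Continuous.tendsto (by fun_prop) 0
    rw [zero_smul, sub_zero] at this
    exact this.mono_left nhdsWithin_le_nhds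
  have h1 := htend.eventually (mem_interior_iff_mem_nhds.1 hint)
  have h2 := htend.eventually (Metric.ball_mem_nhds p hr)
  obtain ⟨s, ⟨hs1, hs2⟩, hs⟩ := ((h1.and h2).and self_mem_nhdsWithin).exists
  refine Set.disjoint_left.1 hU' ⟨?_, hs2⟩ hs1
  have hs : 0 < s := hs
  have hin : inner ℝ n (p - s • n) = inner ℝ n p - s := by
    rw [inner_sub_right, inner_smul_right, hnn, mul_one]
  have hproj : p - s • n - (inner ℝ n p - s) • n = p - (inner ℝ n p) • n := by
    rw [sub_smul]; abel
  change inner ℝ n (p - s • n) < g (p - s • n - (inner ℝ n (p - s • n)) • n)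
  rw [hin, hproj]
  linarith

namespace BisectionMethod

variable {M : BisectionMethod d} {Ω : Set (Pt d)} (hΩ : IsBoundedLipschitzDomain Ω) (hM : M.IsOn Ω)

section nodal

variable {T : Mesh d} (hT : M.IsAdmissible Ω T)
include hM hT

omit hM in
lemma IsAdmissible.hull_subset_closure {τ : Elem d} (hτ : τ ∈ T) : τ.hull ⊆ closure Ω := by
  rw [← hT.cover]
  exact Set.subset_biUnion_of_mem (u := fun τ : Elem d => τ.hull) hτ

omit hM in
lemma IsAdmissible.exists_mem_hull {x : Pt d} (hx : x ∈ closure Ω) : ∃ τ ∈ T, x ∈ τ.hull := by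
  rw [← hT.cover] at hx
  simpa using hx

/-- Near a vertex there are only the elements of its first ring. -/
lemma IsAdmissible.eventually_mem_ring {q : Pt d} (hq : q ∈ T.vertices) :
    ∀ᶠ y in 𝓝 q, ∀ τ ∈ T, y ∈ τ.hull → τ ∈ T.ring q := by
  rw [Filter.eventually_all_finset]
  intro τ hτ
  by_cases hqτ : q ∈ τ.verts
  · exact Eventually.of_forall fun y _ => Mesh.mem_ring.2 ⟨hτ, hqτ⟩
  · have : q ∈ τ.hullᶜ := fun h => hqτ (hT.mem_verts hM hτ hq h)
    filter_upwards [τ.isClosed_hull.isOpen_compl.mem_nhds this] with y hy h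
    exact absurd h hy

/-- The open star of an interior vertex consists of interior points. -/
lemma IsAdmissible.mem_interior_closure {q : Pt d} (hq : q ∈ T.vertices) (hqΩ : Ω ∈ 𝓝 q)
    {τ : Elem d} (hτ : τ ∈ T) {x : Pt d} (hx : x ∈ τ.hull) (hpos : 0 < bary τ.verts q x) :
    x ∈ interior (closure Ω) := by
  have hqτ : q ∈ τ.verts := IsSimplex.mem_verts_of_bary_ne hpos.ne'
  have hτs := hT.isSimplex hM hτ
  have hnear : ∀ᶠ y in 𝓝 q, y ∈ Ω ∧ ∀ τ ∈ T, y ∈ τ.hull → τ ∈ T.ring q :=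
    Filter.Eventually.and hqΩ (hT.eventually_mem_ring hM hq)
  have htend : Tendsto (fun t : ℝ => AffineMap.lineMap q x t) (𝓝[>] 0) (𝓝 q) := by
    have : Tendsto (fun t : ℝ => AffineMap.lineMap q x t) (𝓝 0) (𝓝 (AffineMap.lineMap q x (0 : ℝ))) :=
      Continuous.tendsto (by fun_prop) 0
    rw [AffineMap.lineMap_apply_zero] at this
    exact this.mono_left nhdsWithin_le_nhds
  have hle : ∀ᶠ t : ℝ in 𝓝[>] 0, t ≤ 1 :=
    nhdsWithin_le_nhds (eventually_le_nhds (by norm_num : (0 : ℝ) < 1))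
  obtain ⟨t, ⟨ht, ht1⟩, ht0⟩ :=
    (((htend.eventually (eventually_eventually_nhds.2 hnear)).and hle).and self_mem_nhdsWithin).exists
  have ht0 : 0 < t := ht0
  have hcont : Tendsto (fun y : Pt d => AffineMap.lineMap q y t) (𝓝 x)
      (𝓝 (AffineMap.lineMap q x t)) := by
    refine Continuous.tendsto (f := fun y : Pt d => AffineMap.lineMap q y t) ?_ x
    simp only [AffineMap.lineMap_apply_module]
    fun_prop
  have hxt : AffineMap.lineMap q x t ∈ τ.hull :=
    (convex_convexHull ℝ _).lineMap_mem (τ.subset_hull hqτ) hx ⟨ht0.le, ht1⟩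
  have hline : ∀ (t' : Finset (Pt d)) (v y : Pt d), bary t' v (AffineMap.lineMap q y t) =
      (1 - t) * bary t' v q + t * bary t' v y := by
    intro t' v y
    rw [AffineMap.apply_lineMap, AffineMap.lineMap_apply_module, smul_eq_mul, smul_eq_mul]
  -- Points `y` near `x` are contracted towards `q` into a neighbourhood covered by the ring, and
  -- then scaled back. Scaling by 1/t keeps the signs of the coordinates other than that of `q`; the
  -- latter stays positive because it is positive at `x`.
  have hall : ∀ᶠ y in 𝓝 x, ∀ σ ∈ T.ring q, AffineMap.lineMap q y t ∈ σ.hull → y ∈ σ.hull := by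
    rw [Filter.eventually_all_finset]
    intro σ hσ
    obtain ⟨hσT, hqσ⟩ := Mesh.mem_ring.1 hσ
    have hσs := hT.isSimplex hM hσT
    by_cases hxσ : AffineMap.lineMap q x t ∈ σ.hull
    · have hb := hT.bary_eq τ hτ σ hσT _ hxt hxσ q
      rw [hline, hline, hτs.bary_self hqτ, hσs.bary_self hqσ] at hb
      have hb' : bary τ.verts q x = bary σ.verts q x := by
        have := mul_left_cancel₀ ht0.ne' (add_left_cancel hb); exact this
      have hc : Continuous (bary σ.verts q) := AffineMap.continuous_of_finiteDimensional _
      filter_upwards [hc.continuousAt.eventually (lt_mem_nhds (hb' ▸ hpos))] with y hy hyσ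
      refine hσs.mem_hull_iff.2 fun v => ?_
      by_cases hvq : v = q
      · rw [hvq]; exact le_of_lt hy
      · have := hσs.mem_hull_iff.1 hyσ v
        rw [hline, hσs.bary_ne hqσ hvq, mul_zero, zero_add] at this
        exact nonneg_of_mul_nonneg_right this ht0
    · filter_upwards [hcont.eventually (σ.isClosed_hull.isOpen_compl.mem_nhds hxσ)] with y hy h
      exact absurd h hy
  rw [mem_interior_iff_mem_nhds]
  filter_upwards [hall, hcont.eventually ht] with y hy1 hy2
  obtain ⟨σ, hσ, hyσ⟩ := hT.exists_mem_hull (subset_closure hy2.1)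
  exact hT.hull_subset_closure hσ (hy1 σ (hy2.2 σ hσ hyσ) hyσ)

include hΩ

/-- Existence of the nodal basis functions. -/
lemma IsAdmissible.exists_nodal {q : Pt d} (hq : q ∈ T.interiorVertices Ω) :
    ∃ φ, T.IsNodalBasisFunction Ω q φ := by
  obtain ⟨hqT, hqΩ⟩ := Mesh.mem_interiorVertices.1 hq
  set φ : Pt d → ℝ := fun x => if h : ∃ τ ∈ T, x ∈ τ.hull then bary h.choose.verts q x else 0
    with hφ
  have hval : ∀ τ ∈ T, ∀ x ∈ τ.hull, φ x = bary τ.verts q x := by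
    intro τ hτ x hx
    have hex : ∃ τ ∈ T, x ∈ τ.hull := ⟨τ, hτ, hx⟩
    simp only [hφ, dif_pos hex]
    exact hT.bary_eq _ hex.choose_spec.1 τ hτ x hex.choose_spec.2 hx q
  have hout : ∀ x, x ∉ Ω → φ x = 0 := by
    intro x hx
    by_cases hex : ∃ τ ∈ T, x ∈ τ.hull
    · obtain ⟨τ, hτ, hxτ⟩ := hex
      rw [hval τ hτ x hxτ]
      by_contra hne
      have hpos : 0 < bary τ.verts q x :=
        lt_of_le_of_ne ((hT.isSimplex hM hτ).mem_hull_iff.1 hxτ q) (Ne.symm hne)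
      -- A boundary point with a positive value would lie in the open star of `q`, hence in the
      -- interior of the closure of `Ω`.
      refine hΩ.notMem_interior_closure (p := x) ?_
        (hT.mem_interior_closure hM hqT (hΩ.isOpen.mem_nhds hqΩ) hτ hxτ hpos)
      rw [hΩ.isOpen.frontier_eq]
      exact ⟨hT.hull_subset_closure hτ hxτ, hx⟩
    · simp only [hφ, dif_neg hex]
  refine ⟨φ, ⟨?_, fun τ hτ => ⟨bary τ.verts q, hval τ hτ⟩, hout⟩, ?_, ?_⟩
  -- Continuity by pasting over a finite closed cover: the elements, and the complement of `Ω` as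
  -- `none`.
  · let F : Option T → Set (Pt d) := fun o => o.elim Ωᶜ fun τ => τ.1.hull
    refine LocallyFinite.continuous (f := F) (locallyFinite_of_finite F) ?_ ?_ ?_
    · rw [Set.eq_univ_iff_forall]
      intro x
      by_cases hx : x ∈ Ω
      · obtain ⟨τ, hτ, hxτ⟩ := hT.exists_mem_hull (subset_closure hx)
        exact Set.mem_iUnion.2 ⟨some ⟨τ, hτ⟩, hxτ⟩
      · exact Set.mem_iUnion.2 ⟨none, hx⟩
    · rintro (_ | τ)
      · exact hΩ.isOpen.isClosed_compl
      · exact τ.1.isClosed_hull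
    · rintro (_ | τ)
      · exact continuousOn_const.congr fun x hx => hout x hx
      · exact (AffineMap.continuous_of_finiteDimensional (bary τ.1.verts q)).continuousOn.congr
          fun x hx => hval τ.1 τ.2 x hx
  · obtain ⟨τ, hτ, hqτ⟩ := Mesh.mem_vertices.1 hqT
    rw [hval τ hτ q (τ.subset_hull hqτ), (hT.isSimplex hM hτ).bary_self hqτ]
  · intro v hv hvq
    obtain ⟨τ, hτ, hvτ⟩ := Mesh.mem_vertices.1 hv
    rw [hval τ hτ v (τ.subset_hull hvτ), (hT.isSimplex hM hτ).bary_ne hvτ hvq.symm]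

end nodal

/-- The coarsest common refinement, up to generation `m`: the elements of the final mesh of
generation at most `m` and the elements of generation `m` that appear in the sequence. -/
noncomputable def coarseMesh (M : BisectionMethod d) (e : ℕ → Finset (Pt d)) (J m : ℕ) : Mesh d :=
  (M.mesh e J).filter (fun τ => τ.gen ≤ m) ∪
    (Finset.range (J + 1)).biUnion (fun j => (M.mesh e j).filter (fun τ => τ.gen = m))

lemma mem_coarseMesh {e : ℕ → Finset (Pt d)} {J m : ℕ} {τ : Elem d} :
    τ ∈ M.coarseMesh e J m ↔
      (τ ∈ M.mesh e J ∧ τ.gen ≤ m) ∨ ∃ j ≤ J, τ ∈ M.mesh e j ∧ τ.gen = m := by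
  simp [coarseMesh]

/-- `ψ` is a function of one of the local spaces, nodal for the `i`-th mesh at the node `q`, where
the `i`-th mesh is the final one, or the generations in it around `q` are between `k` and
`k + κ`. -/
structure IsBasisAt (M : BisectionMethod d) (Ω : Set (Pt d)) (e : ℕ → Finset (Pt d)) (J k κ : ℕ)
    (q : Pt d) (i : ℕ) (ψ : Pt d → ℝ) : Prop where
  le : i ≤ J
  mem_vertices : q ∈ (M.mesh e i).vertices
  nodal : (M.mesh e i).IsNodalBasisFunction Ω q ψ
  gen_le : ∀ τ ∈ (M.mesh e i).ring q, τ.gen ≤ k + κ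
  mem_or : (i = J ∧ q ∈ M.levelVertices Ω e J (k + κ)) ∨
    (q ∉ M.levelVertices Ω e J (k + κ) ∧ (∀ τ ∈ (M.mesh e i).ring q, k ≤ τ.gen) ∧
      ∃ j ∈ M.nearBisections e J k κ, ψ ∈ M.localSpace Ω e j)

/-! ### The mesh cut at generation m, and a basis function for each of its interior vertices. -/

section coarse

variable {e : ℕ → Finset (Pt d)} {J m : ℕ} (hc : M.IsCompatibleSequence e J)
include hM hc

omit hM hc in
lemma gen_le_of_mem_coarseMesh {τ : Elem d} (hτ : τ ∈ M.coarseMesh e J m) : τ.gen ≤ m := by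
  rcases mem_coarseMesh.1 hτ with h | ⟨j, -, -, h⟩
  · exact h.2
  · exact h.le

lemma exists_mesh_of_mem_coarseMesh {τ : Elem d} (hτ : τ ∈ M.coarseMesh e J m) :
    ∃ j ≤ J, τ ∈ M.mesh e j := by
  rcases mem_coarseMesh.1 hτ with h | ⟨j, h1, h2, -⟩
  · exact ⟨J, le_rfl, h.1⟩
  · exact ⟨j, h1, h2⟩

lemma isNode_of_mem_coarseMesh {τ : Elem d} (hτ : τ ∈ M.coarseMesh e J m) : M.IsNode τ := by
  obtain ⟨j, hj, h⟩ := exists_mesh_of_mem_coarseMesh hM hc hτ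
  exact (isAdmissible_mesh hM hc hj).isNode τ h

lemma exists_coarseMesh_hull {x : Pt d} (hx : x ∈ closure Ω) :
    ∃ τ ∈ M.coarseMesh e J m, x ∈ τ.hull := by
  obtain ⟨τ, hτ, hxτ⟩ := (isAdmissible_mesh hM hc le_rfl).exists_mem_hull hx
  by_cases hg : τ.gen ≤ m
  · exact ⟨τ, mem_coarseMesh.2 (Or.inl ⟨hτ, hg⟩), hxτ⟩
  · obtain ⟨i, hi, σ, h1, h2, h3⟩ := exists_ancestor_gen hM hc le_rfl hτ (not_le.1 hg).le
    exact ⟨σ, mem_coarseMesh.2 (Or.inr ⟨i, hi, h1, h2⟩), h3 hxτ⟩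

/-- Finite element functions that vanish on the elements of generation larger than `m` are
finite element functions over the coarse mesh. -/
lemma mem_feSpace_coarseMesh {j : ℕ} (hj : j ≤ J) {v : Pt d → ℝ}
    (hv : v ∈ (M.mesh e j).feSpace Ω)
    (h0 : ∀ τ ∈ M.mesh e j, m < τ.gen → ∀ x ∈ τ.hull, v x = 0) :
    v ∈ (M.coarseMesh e J m).feSpace Ω := by
  obtain ⟨hcont, haff, hout⟩ := hv
  have hanc : ∀ τ i, j ≤ i → i ≤ J → τ ∈ M.mesh e i →
      ∃ f : Pt d →ᵃ[ℝ] ℝ, ∀ x ∈ τ.hull, v x = f x := by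
    intro τ i hi hiJ hτ
    obtain ⟨σ, hσ, hsub, -⟩ := exists_ancestor hM hc hi hiJ hτ
    obtain ⟨f, hf⟩ := haff σ hσ
    exact ⟨f, fun x hx => hf x (hsub hx)⟩
  refine ⟨hcont, fun τ hτ => ?_, hout⟩
  rcases mem_coarseMesh.1 hτ with ⟨h1, -⟩ | ⟨i, hi, hτi, hg⟩
  · exact hanc τ J hj le_rfl h1
  · rcases le_total j i with hji | hij
    · exact hanc τ i hji hi hτi
    · rcases mem_mesh_or hM hc hij hj hτi with h | h
      · exact hanc τ j le_rfl hj h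
      -- Here `τ`, of generation `m`, has been refined before the `j`-th mesh, so it is covered by
      -- elements of generation larger than `m`, where `v` vanishes.
      · refine ⟨0, fun x hx => ?_⟩
        obtain ⟨τ', h1, h2, h3⟩ := h x hx
        exact h0 τ' h1 (by omega) x h2

lemma nodal_mem_feSpace_coarseMesh {j : ℕ} (hj : j ≤ J) {q : Pt d} {φ : Pt d → ℝ}
    (hφ : (M.mesh e j).IsNodalBasisFunction Ω q φ) (hg : ∀ τ ∈ (M.mesh e j).ring q, τ.gen ≤ m) :
    φ ∈ (M.coarseMesh e J m).feSpace Ω := by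
  refine mem_feSpace_coarseMesh hM hc hj hφ.1 fun τ hτ hgτ x hx => ?_
  rw [(isAdmissible_mesh hM hc hj).nodal_eq_bary hM hφ hτ hx]
  refine bary_of_notMem (fun hq => ?_) x
  have := hg τ (Mesh.mem_ring.2 ⟨hτ, hq⟩)
  omega

lemma mem_vertices_of_mem_coarseMesh {q : Pt d} (hq : q ∈ (M.coarseMesh e J m).vertices) :
    q ∈ (M.mesh e J).vertices ∧ M.vertexGen q ≤ m := by
  obtain ⟨τ, hτ, hqτ⟩ := Mesh.mem_vertices.1 hq
  obtain ⟨j, hj, h⟩ := exists_mesh_of_mem_coarseMesh hM hc hτ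
  exact ⟨vertices_mesh_mono hM hc hj le_rfl (Mesh.mem_vertices.2 ⟨τ, h, hqτ⟩),
    ((isNode_of_mem_coarseMesh hM hc hτ).vertexGen_le hqτ).trans (gen_le_of_mem_coarseMesh hτ)⟩

/-- A finite element function is determined by its values at the interior vertices. -/
lemma eq_zero_of_mem_feSpace_coarseMesh {v : Pt d → ℝ} (hv : v ∈ (M.coarseMesh e J m).feSpace Ω)
    (h0 : ∀ q ∈ (M.coarseMesh e J m).interiorVertices Ω, v q = 0) : v = 0 := by
  obtain ⟨-, haff, hout⟩ := hv
  funext x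
  by_cases hx : x ∈ Ω
  · obtain ⟨τ, hτ, hxτ⟩ := exists_coarseMesh_hull hM hc (m := m) (subset_closure hx)
    obtain ⟨f, hf⟩ := haff τ hτ
    have hf0 : f = 0 := by
      refine ((isNode_of_mem_coarseMesh hM hc hτ).isSimplex hM).affine_ext fun q hq => ?_
      rw [← hf q (τ.subset_hull hq)]
      by_cases hqΩ : q ∈ Ω
      · exact h0 q (Mesh.mem_interiorVertices.2 ⟨Mesh.mem_vertices.2 ⟨τ, hτ, hq⟩, hqΩ⟩)
      · exact hout q hqΩ
    rw [hf x hxτ, hf0]; rfl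
  · exact hout x hx

variable (hU : M.UniformConformity) {κ : ℕ} (hR : M.RingBound e J κ)
include hU hR

/-- The functions of `W_k` are finite element functions over the coarse mesh. -/
lemma W_le_feSpace_coarseMesh (k : ℕ) :
    M.W Ω e J k ≤ (M.coarseMesh e J (k + κ)).feSpace Ω := by
  refine sup_le (iSup₂_le fun j hj => ?_) (iSup₂_le fun p hp => ?_)
  · obtain ⟨hjJ, hg⟩ := hj
    rcases j with _ | j
    · intro v hv
      refine mem_feSpace_coarseMesh hM hc (Nat.zero_le J) hv fun τ hτ hgτ => ?_
      rw [gen_of_mem_initialMesh (M := M) hτ] at hgτ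
      omega
    · rw [localSpace, if_neg (by omega), Mesh.nodalSpan, Submodule.span_le]
      rintro φ ⟨p, hp, hpt, hφ⟩
      obtain ⟨τ, hτ, hgτ⟩ := exists_mem_ring_of_mem_triplet hM hc hU (by omega) hpt
      refine nodal_mem_feSpace_coarseMesh hM hc hjJ hφ fun σ hσ => ?_
      -- One element around `p` has the generation of the bisection, at most `k`; the ring bound
      -- carries this to the whole support.
      have := (hR (j + 1) hjJ p (Mesh.mem_interiorVertices.1 hp).1).1 σ hσ τ hτ
      omega
  · rw [nodalSpace, Mesh.nodalSpan, Submodule.span_le]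
    rintro φ ⟨q, hq, rfl, hφ⟩
    refine nodal_mem_feSpace_coarseMesh hM hc le_rfl hφ fun σ hσ => ?_
    have := Mesh.level_le_iff.1 (Finset.mem_filter.1 hp).2 σ hσ
    omega

omit hU hR in
lemma levelVertices_subset :
    M.levelVertices Ω e J m ⊆ (M.coarseMesh e J m).interiorVertices Ω := by
  intro q hq
  obtain ⟨h1, h2⟩ := Finset.mem_filter.1 hq
  obtain ⟨h3, h4⟩ := Mesh.mem_interiorVertices.1 h1
  obtain ⟨τ, hτ, hqτ⟩ := Mesh.mem_vertices.1 h3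
  exact Mesh.mem_interiorVertices.2 ⟨Mesh.mem_vertices.2 ⟨τ, mem_coarseMesh.2
    (Or.inl ⟨hτ, Mesh.level_le_iff.1 h2 τ (Mesh.mem_ring.2 ⟨hτ, hqτ⟩)⟩), hqτ⟩, h4⟩

include hΩ

/-- Each interior vertex of the coarse mesh is the node of such a basis function. -/
lemma exists_isBasisAt (k : ℕ) {q : Pt d}
    (hq : q ∈ (M.coarseMesh e J (k + κ)).interiorVertices Ω) :
    ∃ i ψ, M.IsBasisAt Ω e J k κ q i ψ := by
  obtain ⟨hqc, hqΩ⟩ := Mesh.mem_interiorVertices.1 hq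
  obtain ⟨hqJ, hqg⟩ := mem_vertices_of_mem_coarseMesh hM hc hqc
  have hqi : q ∈ (M.mesh e J).interiorVertices Ω := Mesh.mem_interiorVertices.2 ⟨hqJ, hqΩ⟩
  by_cases hlev : q ∈ M.levelVertices Ω e J (k + κ)
  · obtain ⟨ψ, hψ⟩ := (isAdmissible_mesh hM hc le_rfl).exists_nodal hΩ hM hqi
    exact ⟨J, ψ, le_rfl, hqJ, hψ, Mesh.level_le_iff.1 (Finset.mem_filter.1 hlev).2, Or.inl ⟨rfl, hlev⟩⟩
  · have hex : ∃ τ ∈ (M.mesh e J).ring q, k + κ < τ.gen := by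
      by_contra hno
      push Not at hno
      exact hlev (Finset.mem_filter.2 ⟨hqi, Mesh.level_le_iff.2 hno⟩)
    obtain ⟨i, hi, hqv, hle, τ, hτ, hgτ⟩ := exists_mesh_level_eq hM hc hU le_rfl hqJ hqg hex
    obtain ⟨hR1, hR2⟩ := hR i hi q hqv
    have hge : ∀ σ ∈ (M.mesh e i).ring q, k ≤ σ.gen := fun σ hσ => by
      have := hR1 τ hτ σ hσ; omega
    rcases exists_triplet_or hM hc hU hi hqv with h | ⟨j, h1, h2, h3, h4, h5, ⟨σ, h6, h7⟩, σ', h8, h9⟩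
    -- No triplet ever contained `q`: then k + κ + 1 is at most the size of the ring, hence at most
    -- κ, which is absurd.
    · have := h τ hτ; omega
    · obtain ⟨ψ, hψ⟩ := (isAdmissible_mesh hM hc (h2.trans hi)).exists_nodal hΩ hM
        (Mesh.mem_interiorVertices.2 ⟨h4, hqΩ⟩)
      -- From k ≤ σ.gen and σ.gen + 1 ≤ g_j + κ follows the lower bound for the generation g_j of
      -- the bisection; the upper one is g_j ≤ σ'.gen ≤ k + κ.
      have := hge σ h6
      have := hle σ' h8
      refine ⟨i, ψ, hi, hqv, h5 ψ hψ, hle, Or.inr ⟨hlev, hge, j, ?_, ?_⟩⟩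
      · exact Finset.mem_filter.2 ⟨Finset.mem_Icc.2 ⟨h1, h2.trans hi⟩, by omega, by omega⟩
      · rw [localSpace, if_neg (by omega)]
        exact Submodule.subset_span ⟨q, Mesh.mem_interiorVertices.2 ⟨h4, hqΩ⟩, h3, hψ⟩

end coarse

end BisectionMethod

end

/-! ### Triangular elimination and elementary L² estimates. -/

section
open scoped Classical
open MeasureTheory

/-- Block elimination ordered by `g`. By `hoff`, nodes with g ≤ k see only their own basis function,
so one sweep settles them all; the sweep for g = k + i settles these nodes and leaves smaller `g`
untouched. With coefficients bounded by K, the residual is bounded by 2 + 2 C₂ K through `h₂`, its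
nodal values by C₁ times that through `h₁`, so the updated coefficients are bounded by 2K + 2 C₁ (2
+ 2 C₂ K). The number of sweeps, not the number of nodes, determines the constant. -/
lemma exists_triangular_decomposition {α : Type*} {X : Finset α} {A : Submodule ℝ (α → ℝ)}
    {N : (α → ℝ) → ℝ} {ψ : α → α → ℝ} {g : α → ℕ} {k : ℕ} {C₁ C₂ : ℝ} (hC₁ : 0 ≤ C₁) (hC₂ : 0 ≤ C₂)
    (hψ : ∀ q ∈ X, ψ q ∈ A) (hN : ∀ u, 0 ≤ N u)
    (hsub : ∀ u ∈ A, ∀ v ∈ A, N (u - v) ≤ 2 * N u + 2 * N v)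
    (h₁ : ∀ u ∈ A, ∑ q ∈ X, u q ^ 2 * N (ψ q) ≤ C₁ * N u)
    (h₂ : ∀ a : α → ℝ, N (∑ q ∈ X, a q • ψ q) ≤ C₂ * ∑ q ∈ X, a q ^ 2 * N (ψ q))
    (hdiag : ∀ q ∈ X, ψ q q = 1)
    (hoff : ∀ q ∈ X, ∀ q' ∈ X, q' ≠ q → ψ q q' ≠ 0 → k < g q' ∧ g q < g q')
    {w : α → ℝ} (hw : w ∈ A) (i : ℕ) :
    ∃ c : α → ℝ, (∀ q ∈ X, g q ≤ k + i → (w - ∑ q ∈ X, c q • ψ q) q = 0) ∧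
      ∑ q ∈ X, c q ^ 2 * N (ψ q) ≤
        (fun K => 2 * K + 2 * (C₁ * (2 + 2 * (C₂ * K))))^[i + 1] 0 * N w := by
  -- One sweep: the residual values at the nodes satisfying `P` are added to the coefficients.
  have step : ∀ (c : α → ℝ) (K : ℝ) (P : α → Prop),
      ∑ q ∈ X, c q ^ 2 * N (ψ q) ≤ K * N w →
      ∃ c' : α → ℝ, c' = c + (fun q => if P q then (w - ∑ q ∈ X, c q • ψ q) q else 0) ∧
        (w - ∑ q ∈ X, c' q • ψ q) = (w - ∑ q ∈ X, c q • ψ q) -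
          ∑ q ∈ X, (if P q then (w - ∑ q ∈ X, c q • ψ q) q else 0) • ψ q ∧
        ∑ q ∈ X, c' q ^ 2 * N (ψ q) ≤ (2 * K + 2 * (C₁ * (2 + 2 * (C₂ * K)))) * N w := by
    intro c K P hc
    set r := w - ∑ q ∈ X, c q • ψ q with hr
    have hsA : ∑ q ∈ X, c q • ψ q ∈ A := A.sum_mem fun q hq => A.smul_mem _ (hψ q hq)
    have hrA : r ∈ A := A.sub_mem hw hsA
    refine ⟨_, rfl, ?_, ?_⟩
    · simp only [Pi.add_apply, add_smul, Finset.sum_add_distrib, hr]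
      abel
    · have hNr : N r ≤ (2 + 2 * (C₂ * K)) * N w := by
        have e1 := hsub w hw _ hsA
        have e2 := (h₂ c).trans (mul_le_mul_of_nonneg_left hc hC₂)
        rw [hr]; linarith
      calc ∑ q ∈ X, (c + fun q => if P q then r q else 0) q ^ 2 * N (ψ q)
          ≤ ∑ q ∈ X, (2 * (c q ^ 2 * N (ψ q)) + 2 * (r q ^ 2 * N (ψ q))) := by
            refine Finset.sum_le_sum fun q _ => ?_
            have hle : (c + fun q => if P q then r q else 0) q ^ 2 ≤ 2 * c q ^ 2 + 2 * r q ^ 2 := by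
              rw [Pi.add_apply]
              split_ifs
              · nlinarith [sq_nonneg (c q - r q)]
              · nlinarith [sq_nonneg (c q), sq_nonneg (r q)]
            have := mul_le_mul_of_nonneg_right hle (hN (ψ q))
            linarith
        _ = 2 * ∑ q ∈ X, c q ^ 2 * N (ψ q) + 2 * ∑ q ∈ X, r q ^ 2 * N (ψ q) := by
            rw [Finset.sum_add_distrib, Finset.mul_sum, Finset.mul_sum]
        _ ≤ 2 * (K * N w) + 2 * (C₁ * ((2 + 2 * (C₂ * K)) * N w)) := by
            have := (h₁ r hrA).trans (mul_le_mul_of_nonneg_left hNr hC₁)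
            linarith
        _ = _ := by ring
  have vanish : ∀ (r : α → ℝ) (P : α → Prop) (q' : α), q' ∈ X →
      (∀ q ∈ X, P q → q' ≠ q → ψ q q' = 0) → (¬ P q' → r q' = 0) →
      (r - ∑ q ∈ X, (if P q then r q else 0) • ψ q) q' = 0 := by
    intro r P q' hq' h3 h4
    rw [Pi.sub_apply, Finset.sum_apply, Finset.sum_eq_single q']
    · rw [Pi.smul_apply, hdiag q' hq', smul_eq_mul, mul_one]
      split_ifs with h
      · exact sub_self _
      · rw [h4 h, sub_self]
    · intro q hq hqq
      rw [Pi.smul_apply]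
      split_ifs with h
      · rw [h3 q hq h hqq.symm, smul_zero]
      · exact zero_smul _ _
    · exact fun h => absurd hq' h
  induction i with
  | zero =>
    obtain ⟨c, -, h3, h4⟩ := step 0 0 (fun q => g q ≤ k) (by simp)
    refine ⟨c, fun q' hq' hg => ?_, h4⟩
    rw [h3]
    refine vanish _ _ q' hq' (fun q hq _ hne => ?_) (fun h => absurd hg h)
    by_contra h0
    have := (hoff q hq q' hq' hne h0).1
    omega
  | succ i ih =>
    obtain ⟨c₀, h5, h6⟩ := ih
    obtain ⟨c, -, h3, h4⟩ := step c₀ _ (fun q => g q = k + (i + 1)) h6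
    refine ⟨c, fun q' hq' hg => ?_, ?_⟩
    · rw [h3]
      refine vanish _ _ q' hq' (fun q hq hgq hne => ?_) (fun h => h5 q' hq' (by omega))
      by_contra h0
      have := (hoff q hq q' hq' hne h0).2
      omega
    · rw [Function.iterate_succ_apply']
      exact h4

lemma sq_sum_le_of_card_le {ι : Type*} (S : Finset ι) (f : ι → ℝ) {n : ℕ}
    (h : (S.filter (fun i => f i ≠ 0)).card ≤ n) : (∑ i ∈ S, f i) ^ 2 ≤ n * ∑ i ∈ S, f i ^ 2 := by
  have h1 : ∑ i ∈ S, f i = ∑ i ∈ S.filter (fun i => f i ≠ 0), f i :=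
    (Finset.sum_filter_ne_zero S).symm
  rw [h1]
  refine (sq_sum_le_card_mul_sum_sq).trans ?_
  refine mul_le_mul (by exact_mod_cast h)
    (Finset.sum_le_sum_of_subset_of_nonneg (Finset.filter_subset _ _) fun i _ _ => sq_nonneg _)
    (Finset.sum_nonneg fun i _ => sq_nonneg _) (Nat.cast_nonneg n)

variable {d : ℕ}

/-- The value of an affine function at a point of a convex body is bounded by its `L²` norm. -/
lemma sq_mul_volume_le {S : Set (Pt d)} (hS : IsCompact S) (hconv : Convex ℝ S) {q : Pt d}
    (hq : q ∈ S) (f : Pt d →ᵃ[ℝ] ℝ) :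
    f q ^ 2 * volume.real S ≤ (8 * 2 ^ d + 2) * ∫ x in S, f x ^ 2 := by
  have hf : Continuous f := AffineMap.continuous_of_finiteDimensional _
  have hSm : MeasurableSet S := hS.isClosed.measurableSet
  set c : Pt d := (2 : ℝ)⁻¹ • q with hc
  set G : Pt d → ℝ := S.indicator fun x => f x ^ 2 with hG
  have hGi : Integrable G := by
    rw [hG, integrable_indicator_iff hSm]
    exact (hf.pow 2).continuousOn.integrableOn_compact hS
  have hG' : Integrable (fun x => G ((2 : ℝ)⁻¹ • x + c)) :=
    (integrable_comp_smul_iff volume (fun y => G (y + c)) (by norm_num : (2 : ℝ)⁻¹ ≠ 0)).2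
      (hGi.comp_add_right c)
  have hint : ∫ x, G ((2 : ℝ)⁻¹ • x + c) = 2 ^ d * ∫ x, G x := by
    rw [Measure.integral_comp_smul volume (fun y => G (y + c)) (2 : ℝ)⁻¹,
      integral_add_right_eq_self G c]
    simp
  -- This is f(q) = 2 f((q + x)/2) - f(x), squared. The midpoint stays in the convex set, and the
  -- substitution x ↦ (q + x)/2 contributes the factor 2^d.
  have hpt : ∀ x, S.indicator (fun _ => f q ^ 2) x ≤ 8 * G ((2 : ℝ)⁻¹ • x + c) + 2 * G x := by
    intro x
    have hG0 : ∀ y, 0 ≤ G y := fun y => Set.indicator_nonneg (fun _ _ => sq_nonneg _) y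
    by_cases hx : x ∈ S
    · have hmid : (2 : ℝ)⁻¹ • x + c = AffineMap.lineMap q x (2 : ℝ)⁻¹ := by
        rw [AffineMap.lineMap_apply_module, hc, show (1 : ℝ) - 2⁻¹ = 2⁻¹ by norm_num, add_comm]
      have hmS : (2 : ℝ)⁻¹ • x + c ∈ S := by
        rw [hmid]; exact hconv.lineMap_mem hq hx (by norm_num)
      rw [Set.indicator_of_mem hx, hG, Set.indicator_of_mem hmS, Set.indicator_of_mem hx, hmid,
        AffineMap.apply_lineMap, AffineMap.lineMap_apply_module, smul_eq_mul, smul_eq_mul]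
      nlinarith [sq_nonneg (f q + 2 * f x), sq_nonneg (f q), sq_nonneg (f x)]
    · rw [Set.indicator_of_notMem hx]
      have := hG0 x
      have := hG0 ((2 : ℝ)⁻¹ • x + c)
      positivity
  have hl : ∫ x, S.indicator (fun _ => f q ^ 2) x = f q ^ 2 * volume.real S := by
    rw [integral_indicator hSm, setIntegral_const, smul_eq_mul, mul_comm]
  have hr : ∫ x, G x = ∫ x in S, f x ^ 2 := by rw [hG, integral_indicator hSm]
  have hli : Integrable (S.indicator (fun _ => f q ^ 2) : Pt d → ℝ) := by
    rw [integrable_indicator_iff hSm]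
    exact integrableOn_const hS.measure_lt_top.ne
  have := integral_mono hli ((hG'.const_mul 8).add (hGi.const_mul 2)) hpt
  rw [hl, integral_add' (hG'.const_mul 8) (hGi.const_mul 2), integral_const_mul,
    integral_const_mul, hint, hr] at this
  linarith

section normSq

variable {Ω : Set (Pt d)} (hΩ : Bornology.IsBounded Ω)

lemma normSqL2_eq_integral {v : Pt d → ℝ} (h0 : ∀ x, x ∉ Ω → v x = 0) :
    normSqL2 Ω v = ∫ x, v x ^ 2 :=
  setIntegral_eq_integral_of_forall_compl_eq_zero fun x hx => by rw [h0 x hx]; norm_num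

lemma normSqL2_nonneg (v : Pt d → ℝ) : 0 ≤ normSqL2 Ω v :=
  integral_nonneg fun x => sq_nonneg (v x)

lemma normSqL2_smul (c : ℝ) (v : Pt d → ℝ) : normSqL2 Ω (c • v) = c ^ 2 * normSqL2 Ω v := by
  simp only [normSqL2, Pi.smul_apply, smul_eq_mul, mul_pow]
  exact integral_const_mul _ _

include hΩ

lemma integrable_sq {v : Pt d → ℝ} (hv : Continuous v) (h0 : ∀ x, x ∉ Ω → v x = 0) :
    Integrable fun x => v x ^ 2 := by
  refine (hv.pow 2).integrable_of_hasCompactSupport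
    (HasCompactSupport.intro hΩ.isCompact_closure fun x hx => ?_)
  rw [Pi.pow_apply, h0 x fun h => hx (subset_closure h)]; norm_num

lemma Mesh.integrable_sq {T : Mesh d} {v : Pt d → ℝ} (hv : v ∈ T.feSpace Ω) :
    Integrable fun x => v x ^ 2 := _root_.integrable_sq hΩ hv.1 hv.2.2

lemma normSqL2_sub_le {T : Mesh d} {u v : Pt d → ℝ} (hu : u ∈ T.feSpace Ω) (hv : v ∈ T.feSpace Ω) :
    normSqL2 Ω (u - v) ≤ 2 * normSqL2 Ω u + 2 * normSqL2 Ω v := by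
  rw [normSqL2_eq_integral hu.2.2, normSqL2_eq_integral hv.2.2,
    normSqL2_eq_integral ((T.feSpace Ω).sub_mem hu hv).2.2, ← integral_const_mul,
    ← integral_const_mul, ← integral_add ((T.integrable_sq hΩ hu).const_mul 2)
      ((T.integrable_sq hΩ hv).const_mul 2)]
  refine integral_mono (T.integrable_sq hΩ ((T.feSpace Ω).sub_mem hu hv))
    (((T.integrable_sq hΩ hu).const_mul 2).add ((T.integrable_sq hΩ hv).const_mul 2)) fun x => ?_
  simp only [Pi.sub_apply]
  nlinarith [sq_nonneg (u x + v x)]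

/-- Sums of functions with bounded overlap. -/
lemma normSqL2_sum_le {T : Mesh d} {ι : Type*} {S : Finset ι} {f : ι → Pt d → ℝ} {n : ℕ}
    (hf : ∀ i ∈ S, f i ∈ T.feSpace Ω)
    (hn : ∀ᵐ x, (S.filter (fun i => f i x ≠ 0)).card ≤ n) :
    normSqL2 Ω (∑ i ∈ S, f i) ≤ n * ∑ i ∈ S, normSqL2 Ω (f i) := by
  have hsum := (T.feSpace Ω).sum_mem hf
  rw [normSqL2_eq_integral hsum.2.2,
    Finset.sum_congr rfl fun i hi => normSqL2_eq_integral (hf i hi).2.2,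
    ← integral_finsetSum _ fun i hi => T.integrable_sq hΩ (hf i hi), ← integral_const_mul]
  refine integral_mono_ae (T.integrable_sq hΩ hsum)
    ((integrable_finsetSum _ fun i hi => T.integrable_sq hΩ (hf i hi)).const_mul _) ?_
  filter_upwards [hn] with x hx
  rw [Finset.sum_apply]
  exact sq_sum_le_of_card_le S _ hx

end normSq

end

/-! ### Volumes and generations, overlap, and the two stability estimates. -/

section
open scoped Classical
open MeasureTheory

variable {d : ℕ}

lemma Elem.measurableSet_hull (τ : Elem d) : MeasurableSet τ.hull := τ.isClosed_hull.measurableSet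

lemma Elem.volume_hull_ne_top (τ : Elem d) : volume τ.hull ≠ ⊤ :=
  (IsSimplex.hull_isCompact τ.verts).measure_lt_top.ne

lemma volume_real_closedBall (x : Pt d) {r : ℝ} (hr : 0 ≤ r) :
    volume.real (Metric.closedBall x r) = r ^ d * volume.real (Metric.ball (0 : Pt d) 1) := by
  rw [Measure.addHaar_real_closedBall _ _ hr]
  simp

lemma Elem.volume_hull_le (τ : Elem d) {q : Pt d} (hq : q ∈ τ.hull) :
    volume.real τ.hull ≤ Metric.diam τ.hull ^ d * volume.real (Metric.ball (0 : Pt d) 1) := by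
  rw [← volume_real_closedBall q Metric.diam_nonneg]
  refine measureReal_mono (fun x hx => ?_) measure_closedBall_lt_top.ne
  exact Metric.mem_closedBall.2 (Metric.dist_le_diam_of_mem
    (IsSimplex.hull_isCompact τ.verts).isBounded hx hq)

namespace BisectionMethod

variable {M : BisectionMethod d} {Ω : Set (Pt d)}

section volume

variable (hM : M.IsOn Ω) (hU : M.UniformConformity) {σ ρ : ℝ} (hS : M.IsShapeRegular σ)
  (hQ : M.IsQuasiUniform ρ)
include hM hU hS

omit hM in
lemma IsNode.exists_ball {τ : Elem d} (h : M.IsNode τ) : ∃ (x : Pt d) (r : ℝ),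
    0 < r ∧ Metric.closedBall x r ⊆ τ.hull ∧ Metric.diam τ.hull ≤ σ * r :=
  hS _ (hU τ.gen) τ h

include hQ

omit hM in
-- The volume of τ is at most that of a ball of radius diam τ ≤ |ρ| |σ| r, where `τ'` contains a
-- ball of radius r.
lemma volume_initialMesh_le {τ τ' : Elem d} (hτ : τ ∈ M.initialMesh) (hτ' : τ' ∈ M.initialMesh) :
    volume.real τ.hull ≤ (|ρ| * |σ|) ^ d * volume.real τ'.hull := by
  obtain ⟨x, r, hr, hsub, hdiam⟩ :=
    IsNode.exists_ball hU hS (isNode_of_mem_uniformMesh (k := 0) (M := M) hτ')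
  obtain ⟨y, s, hs, hsub', -⟩ :=
    IsNode.exists_ball hU hS (isNode_of_mem_uniformMesh (k := 0) (M := M) hτ)
  have hball := measureReal_mono (μ := volume) hsub τ'.volume_hull_ne_top
  rw [volume_real_closedBall x hr.le] at hball
  have hle : Metric.diam τ.hull ≤ |ρ| * |σ| * r := by
    calc Metric.diam τ.hull ≤ ρ * Metric.diam τ'.hull := hQ τ hτ τ' hτ'
      _ ≤ |ρ| * Metric.diam τ'.hull := mul_le_mul_of_nonneg_right (le_abs_self ρ) Metric.diam_nonneg
      _ ≤ |ρ| * (|σ| * r) := by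
        refine mul_le_mul_of_nonneg_left (hdiam.trans ?_) (abs_nonneg ρ)
        exact mul_le_mul_of_nonneg_right (le_abs_self σ) hr.le
      _ = _ := by ring
  calc volume.real τ.hull
      ≤ Metric.diam τ.hull ^ d * volume.real (Metric.ball (0 : Pt d) 1) :=
        τ.volume_hull_le (hsub' (Metric.mem_closedBall_self hs.le))
    _ ≤ (|ρ| * |σ| * r) ^ d * volume.real (Metric.ball (0 : Pt d) 1) := by gcongr
    _ = (|ρ| * |σ|) ^ d * (r ^ d * volume.real (Metric.ball (0 : Pt d) 1)) := by
        rw [mul_pow _ r]; ring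
    _ ≤ _ := by gcongr

omit hU hS hQ in
lemma IsNode.exists_volume_real_eq {τ : Elem d} (h : M.IsNode τ) : ∃ τ₀ ∈ M.initialMesh,
    2 ^ τ.gen * volume.real τ.hull = volume.real τ₀.hull := by
  obtain ⟨τ₀, h₀, hv⟩ := h.exists_volume_eq hM
  refine ⟨τ₀, h₀, ?_⟩
  rw [measureReal_def, measureReal_def, hv, ENNReal.toReal_mul, ENNReal.toReal_pow,
    ENNReal.toReal_inv, ← mul_assoc, ← mul_pow]
  norm_num

/-- The volumes of the elements are determined, up to constants, by their generations. -/
lemma IsNode.volume_le {τ τ' : Elem d} (h : M.IsNode τ) (h' : M.IsNode τ') {s : ℕ}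
    (hg : τ'.gen ≤ τ.gen + s) :
    volume.real τ.hull ≤ (|ρ| * |σ|) ^ d * 2 ^ s * volume.real τ'.hull := by
  obtain ⟨τ₀, h₀, hv⟩ := h.exists_volume_real_eq hM
  obtain ⟨τ₀', h₀', hv'⟩ := h'.exists_volume_real_eq hM
  have h1 := volume_initialMesh_le hU hS hQ h₀ h₀'
  rw [← hv, ← hv'] at h1
  have h2 : (2 : ℝ) ^ τ'.gen ≤ 2 ^ τ.gen * 2 ^ s := by
    rw [← pow_add]; exact pow_le_pow_right₀ (by norm_num) hg
  have h3 : (2 : ℝ) ^ τ.gen * volume.real τ.hull ≤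
      2 ^ τ.gen * ((|ρ| * |σ|) ^ d * 2 ^ s * volume.real τ'.hull) := by
    calc _ ≤ _ := h1
      _ ≤ (|ρ| * |σ|) ^ d * ((2 ^ τ.gen * 2 ^ s) * volume.real τ'.hull) := by gcongr
      _ = _ := by ring
  exact le_of_mul_le_mul_left h3 (by positivity)

end volume

section overlap

variable (hM : M.IsOn Ω)
include hM

/-- Outside the boundaries of the elements, which are null sets by convexity, a point is interior to
each element containing it. -/
lemma IsAdmissible.ae_eq_of_mem_hull {T : Mesh d} (hT : M.IsAdmissible Ω T) :
    ∀ᵐ x, ∀ τ ∈ T, ∀ τ' ∈ T, x ∈ τ.hull → x ∈ τ'.hull → τ = τ' := by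
  have : ∀ᵐ x, ∀ τ ∈ T, x ∉ frontier τ.hull := by
    rw [Filter.eventually_all_finset]
    exact fun τ _ => measure_eq_zero_iff_ae_notMem.1 ((convex_convexHull ℝ _).addHaar_frontier volume)
  filter_upwards [this] with x hx τ hτ τ' hτ' h h'
  refine hT.eq_of_mem_interior hM hτ hτ' ?_ h'
  by_contra hn
  exact hx τ hτ ⟨subset_closure h, hn⟩

lemma isAdmissible_uniformMesh (hU : M.UniformConformity) (k : ℕ) :
    M.IsAdmissible Ω (M.uniformMesh k) where
  isNode τ hτ := isNode_of_mem_uniformMesh hτ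
  bary_eq τ hτ τ' hτ' x hx hx' v :=
    (isNode_of_mem_uniformMesh hτ).bary_eq hM hU (isNode_of_mem_uniformMesh hτ')
      (by rw [gen_of_mem_uniformMesh hτ, gen_of_mem_uniformMesh hτ']) hx hx' v
  eq_of_verts τ hτ τ' hτ' h := by
    have h1 := gen_of_mem_uniformMesh hτ
    have h2 := gen_of_mem_uniformMesh hτ'
    cases τ; cases τ'
    simp_all
  cover := by
    induction k with
    | zero => exact (isAdmissible_initialMesh hM).cover
    | succ k ih =>
      rw [← ih]
      apply Set.Subset.antisymm
      · refine Set.iUnion₂_subset fun τ hτ => ?_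
        obtain ⟨σ, hσ, h⟩ := Finset.mem_biUnion.1 hτ
        exact ((isNode_of_mem_uniformMesh hσ).hull_subset_of_mem_children hM h).trans
          (Set.subset_biUnion_of_mem (u := fun τ : Elem d => τ.hull) hσ)
      · refine Set.iUnion₂_subset fun τ hτ x hx => ?_
        obtain ⟨τ', h, hx'⟩ := (isNode_of_mem_uniformMesh hτ).exists_child_hull hM hx
        exact Set.mem_biUnion (t := fun τ : Elem d => τ.hull) (Finset.mem_biUnion.2 ⟨τ, hτ, h⟩) hx'

/-- Almost every point belongs to few elements of the final mesh or of generation between `k` and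
`k + κ`, so these elements have few vertices. -/
lemma ae_card_le {e : ℕ → Finset (Pt d)} {J : ℕ} (hc : M.IsCompatibleSequence e J)
    (hU : M.UniformConformity) (k κ : ℕ) : ∀ᵐ x : Pt d, ∀ S : Finset (Pt d),
      (∀ q ∈ S, ∃ τ : Elem d, x ∈ τ.hull ∧ q ∈ τ.verts ∧
        (τ ∈ M.mesh e J ∨ (M.IsNode τ ∧ k ≤ τ.gen ∧ τ.gen ≤ k + κ))) →
      S.card ≤ (κ + 2) * (d + 1) := by
  have h1 := (isAdmissible_mesh hM hc le_rfl).ae_eq_of_mem_hull hM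
  have h2 : ∀ᵐ x : Pt d, ∀ g ∈ Finset.Icc k (k + κ), ∀ τ ∈ M.uniformMesh g,
      ∀ τ' ∈ M.uniformMesh g, x ∈ τ.hull → x ∈ τ'.hull → τ = τ' := by
    rw [Filter.eventually_all_finset]
    exact fun g _ => (isAdmissible_uniformMesh hM hU g).ae_eq_of_mem_hull hM
  filter_upwards [h1, h2] with x hx1 hx2 S hSx
  -- At almost every `x` there is at most one final element and one element for each of the κ + 1
  -- generations, that is κ + 2 elements with d + 1 vertices each.
  set A : Finset (Elem d) := (M.mesh e J).filter (fun τ => x ∈ τ.hull) with hA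
  set B : Finset (Elem d) := (Finset.Icc k (k + κ)).biUnion
    (fun g => (M.uniformMesh g).filter (fun τ => x ∈ τ.hull)) with hB
  have hAc : A.card ≤ 1 := Finset.card_le_one.2 fun τ hτ τ' hτ' => by
    obtain ⟨h3, h4⟩ := Finset.mem_filter.1 hτ
    obtain ⟨h5, h6⟩ := Finset.mem_filter.1 hτ'
    exact hx1 τ h3 τ' h5 h4 h6
  have hBc : B.card ≤ (κ + 1) * 1 := by
    have hI : (Finset.Icc k (k + κ)).card = κ + 1 := by rw [Nat.card_Icc]; omega
    rw [← hI]
    refine Finset.card_biUnion_le_card_mul _ _ _ fun g hg => Finset.card_le_one.2 ?_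
    intro τ hτ τ' hτ'
    obtain ⟨h3, h4⟩ := Finset.mem_filter.1 hτ
    obtain ⟨h5, h6⟩ := Finset.mem_filter.1 hτ'
    exact hx2 g hg τ h3 τ' h5 h4 h6
  have hsub : S ⊆ (A ∪ B).biUnion Elem.verts := by
    intro q hq
    obtain ⟨τ, hxτ, hqτ, h⟩ := hSx q hq
    refine Finset.mem_biUnion.2 ⟨τ, ?_, hqτ⟩
    rcases h with h | ⟨h, hk, hk'⟩
    · exact Finset.mem_union_left _ (Finset.mem_filter.2 ⟨h, hxτ⟩)
    · exact Finset.mem_union_right _ (Finset.mem_biUnion.2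
        ⟨τ.gen, Finset.mem_Icc.2 ⟨hk, hk'⟩, Finset.mem_filter.2 ⟨h, hxτ⟩⟩)
  have hcard : ∀ τ ∈ A ∪ B, τ.verts.card ≤ d + 1 := by
    intro τ hτ
    rcases Finset.mem_union.1 hτ with h | h
    · exact ((isAdmissible_mesh hM hc le_rfl).isSimplex hM (Finset.mem_filter.1 h).1).card_eq.le
    · obtain ⟨g, -, h⟩ := Finset.mem_biUnion.1 h
      exact ((isNode_of_mem_uniformMesh (Finset.mem_filter.1 h).1).isSimplex hM).card_eq.le
  calc S.card ≤ ((A ∪ B).biUnion Elem.verts).card := Finset.card_le_card hsub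
    _ ≤ (A ∪ B).card * (d + 1) := Finset.card_biUnion_le_card_mul _ _ _ hcard
    _ ≤ (κ + 2) * (d + 1) := by
      refine Nat.mul_le_mul_right _ ((Finset.card_union_le _ _).trans ?_)
      omega

end overlap

section estimates

variable (hΩ : IsBoundedLipschitzDomain Ω) (hM : M.IsOn Ω)
include hΩ hM

/-- The norm of a nodal basis function is bounded by the volume of the first ring. -/
lemma IsAdmissible.normSqL2_nodal_le {T : Mesh d} (hT : M.IsAdmissible Ω T) {q : Pt d}
    {ψ : Pt d → ℝ} (hψ : T.IsNodalBasisFunction Ω q ψ) :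
    normSqL2 Ω ψ ≤ ∑ τ ∈ T.ring q, volume.real τ.hull := by
  have hint : ∀ τ : Elem d, Integrable (τ.hull.indicator (fun _ => (1 : ℝ))) := fun τ => by
    rw [integrable_indicator_iff τ.measurableSet_hull]
    exact integrableOn_const τ.volume_hull_ne_top
  have hi : ∀ τ : Elem d, volume.real τ.hull = ∫ x, τ.hull.indicator (fun _ => (1 : ℝ)) x := by
    intro τ
    rw [integral_indicator τ.measurableSet_hull, setIntegral_const, smul_eq_mul, mul_one]
  rw [normSqL2_eq_integral hψ.1.2.2, Finset.sum_congr rfl fun τ _ => hi τ,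
    ← integral_finsetSum _ fun τ _ => hint τ]
  refine integral_mono (T.integrable_sq hΩ.isBounded hψ.1) (integrable_finsetSum _ fun τ _ => hint τ)
    fun x => ?_
  have hnn : ∀ τ : Elem d, 0 ≤ τ.hull.indicator (fun _ => (1 : ℝ)) x := fun τ =>
    Set.indicator_nonneg (fun _ _ => zero_le_one) x
  by_cases hx : ∃ τ ∈ T.ring q, x ∈ τ.hull
  · obtain ⟨τ, hτ, hxτ⟩ := hx
    obtain ⟨hτT, -⟩ := Mesh.mem_ring.1 hτ
    have hτs := hT.isSimplex hM hτT
    have h0 := hτs.mem_hull_iff.1 hxτ q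
    have h1 := hτs.bary_le_one hxτ q
    refine le_trans ?_ (Finset.single_le_sum (fun τ _ => hnn τ) hτ)
    rw [hT.nodal_eq_bary hM hψ hτT hxτ, Set.indicator_of_mem hxτ]
    nlinarith
  · have hx0 : ψ x = 0 := by
      by_cases hxΩ : x ∈ Ω
      · obtain ⟨τ, hτ, hxτ⟩ := hT.exists_mem_hull (subset_closure hxΩ)
        rw [hT.nodal_eq_bary hM hψ hτ hxτ]
        exact bary_of_notMem (fun h => hx ⟨τ, Mesh.mem_ring.2 ⟨hτ, h⟩, hxτ⟩) x
      · exact hψ.1.2.2 x hxΩ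
    simp only [hx0]
    norm_num
    exact Finset.sum_nonneg fun τ _ => hnn τ

variable {e : ℕ → Finset (Pt d)} {J k κ : ℕ} (hc : M.IsCompatibleSequence e J)
  (hU : M.UniformConformity)
include hc hU

omit hΩ hU in
lemma IsBasisAt.mem_feSpace {q : Pt d} {i : ℕ} {ψ : Pt d → ℝ} (h : M.IsBasisAt Ω e J k κ q i ψ) :
    ψ ∈ (M.coarseMesh e J (k + κ)).feSpace Ω :=
  nodal_mem_feSpace_coarseMesh hM hc h.le h.nodal h.gen_le

omit hΩ hU in
/-- Where the basis function does not vanish there is an element that contains the node. -/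
lemma IsBasisAt.exists_of_ne_zero {q : Pt d} {i : ℕ} {ψ : Pt d → ℝ}
    (h : M.IsBasisAt Ω e J k κ q i ψ) {x : Pt d} (hx : ψ x ≠ 0) :
    ∃ τ : Elem d, τ ∈ M.mesh e i ∧ x ∈ τ.hull ∧ q ∈ τ.verts ∧
      (τ ∈ M.mesh e J ∨ (M.IsNode τ ∧ k ≤ τ.gen ∧ τ.gen ≤ k + κ)) := by
  have hT := isAdmissible_mesh hM hc h.le
  have hxΩ : x ∈ Ω := by
    by_contra hn
    exact hx (h.nodal.1.2.2 x hn)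
  obtain ⟨τ, hτ, hxτ⟩ := hT.exists_mem_hull (subset_closure hxΩ)
  rw [hT.nodal_eq_bary hM h.nodal hτ hxτ] at hx
  have hq := IsSimplex.mem_verts_of_bary_ne hx
  have hr := Mesh.mem_ring.2 ⟨hτ, hq⟩
  refine ⟨τ, hτ, hxτ, hq, ?_⟩
  rcases h.mem_or with ⟨rfl, -⟩ | ⟨-, h1, -⟩
  · exact Or.inl hτ
  · exact Or.inr ⟨hT.isNode τ hτ, h1 τ hr, h.gen_le τ hr⟩

omit hΩ in
/-- The basis functions are triangular with respect to the generation of the nodes. -/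
lemma IsBasisAt.vertexGen_lt {q q' : Pt d} {i : ℕ} {ψ : Pt d → ℝ}
    (h : M.IsBasisAt Ω e J k κ q i ψ)
    (hq' : q' ∈ (M.coarseMesh e J (k + κ)).interiorVertices Ω) (hne : q' ≠ q) (h0 : ψ q' ≠ 0) :
    k < M.vertexGen q' ∧ M.vertexGen q < M.vertexGen q' := by
  have hT := isAdmissible_mesh hM hc h.le
  have hqJ := (mem_vertices_of_mem_coarseMesh hM hc (Mesh.mem_interiorVertices.1 hq').1).1
  obtain ⟨τ, hτ, hxτ, hqτ, -⟩ := h.exists_of_ne_zero hM hc h0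
  rcases h.mem_or with ⟨rfl, -⟩ | ⟨-, h1, -⟩
  · exact absurd (h.nodal.2.2 q' hqJ hne) h0
  -- If `q'` were not younger than `τ`, it would be a vertex of `τ`, where the nodal function of
  -- another vertex vanishes.
  · have hlt : τ.gen < M.vertexGen q' := by
      by_contra hle
      obtain ⟨k', hk'⟩ := exists_uniformMesh_of_mem_vertices hM hc le_rfl hqJ
      have := mem_verts_of_vertexGen_le hM hU (hT.isNode τ hτ) hk' hxτ (not_lt.1 hle)
      exact h0 (h.nodal.2.2 q' (Mesh.mem_vertices.2 ⟨τ, hτ, this⟩) hne)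
    have := h1 τ (Mesh.mem_ring.2 ⟨hτ, hqτ⟩)
    have := (hT.isNode τ hτ).vertexGen_le hqτ
    omega

variable {ψ : Pt d → Pt d → ℝ} {ι : Pt d → ℕ}
  (hψ : ∀ q ∈ (M.coarseMesh e J (k + κ)).interiorVertices Ω, M.IsBasisAt Ω e J k κ q (ι q) (ψ q))
include hψ

/-- Bounded overlap of the basis functions. -/
lemma ae_card_basis_le : ∀ᵐ x : Pt d,
    (((M.coarseMesh e J (k + κ)).interiorVertices Ω).filter (fun q => ψ q x ≠ 0)).card ≤
      (κ + 2) * (d + 1) := by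
  filter_upwards [ae_card_le hM hc hU k κ] with x hx
  refine hx _ fun q hq => ?_
  obtain ⟨h1, h2⟩ := Finset.mem_filter.1 hq
  obtain ⟨τ, -, h3⟩ := (hψ q h1).exists_of_ne_zero hM hc h2
  exact ⟨τ, h3⟩

lemma normSqL2_sum_basis_le {S : Finset (Pt d)}
    (hS : S ⊆ (M.coarseMesh e J (k + κ)).interiorVertices Ω) (a : Pt d → ℝ) :
    normSqL2 Ω (∑ q ∈ S, a q • ψ q) ≤
      ((κ + 2) * (d + 1) : ℕ) * ∑ q ∈ S, a q ^ 2 * normSqL2 Ω (ψ q) := by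
  rw [Finset.sum_congr rfl fun q _ => (normSqL2_smul (a q) (ψ q)).symm]
  refine normSqL2_sum_le hΩ.isBounded (T := M.coarseMesh e J (k + κ)) (fun q hq =>
    Submodule.smul_mem _ _ ((hψ q (hS hq)).mem_feSpace hM hc)) ?_
  filter_upwards [ae_card_basis_le hΩ hM hc hU hψ] with x hx
  refine (Finset.card_le_card fun q hq => ?_).trans hx
  obtain ⟨h1, h2⟩ := Finset.mem_filter.1 hq
  refine Finset.mem_filter.2 ⟨hS h1, fun h => h2 ?_⟩
  rw [Pi.smul_apply, h, smul_zero]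

variable {σ ρ : ℝ} (hSh : M.IsShapeRegular σ) (hQ : M.IsQuasiUniform ρ) (hR : M.RingBound e J κ)
include hSh hQ hR

omit hψ in
/-- The norm of a basis function is bounded by the volume of an element at its node. -/
lemma IsBasisAt.exists_normSqL2_le {q : Pt d} {i : ℕ} {φ : Pt d → ℝ}
    (h : M.IsBasisAt Ω e J k κ q i φ)
    (hq : q ∈ (M.coarseMesh e J (k + κ)).interiorVertices Ω) :
    ∃ τ ∈ M.coarseMesh e J (k + κ), q ∈ τ.verts ∧
      (τ ∈ M.mesh e J ∨ (M.IsNode τ ∧ k ≤ τ.gen ∧ τ.gen ≤ k + κ)) ∧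
      normSqL2 Ω φ ≤ κ * ((|ρ| * |σ|) ^ d * 2 ^ κ) * volume.real τ.hull := by
  have hT := isAdmissible_mesh hM hc h.le
  -- The element must belong to the cut mesh, so that finite element functions are affine on it, and
  -- must be no smaller, up to constants, than the elements supporting `φ`. The latter holds by the
  -- ring bound in the final mesh, and otherwise since generations lie between k and k + κ.
  obtain ⟨τ, hτ, hqτ, hτg, hle⟩ : ∃ τ ∈ M.coarseMesh e J (k + κ), q ∈ τ.verts ∧
      (τ ∈ M.mesh e J ∨ (M.IsNode τ ∧ k ≤ τ.gen ∧ τ.gen ≤ k + κ)) ∧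
      ∀ σ ∈ (M.mesh e i).ring q, τ.gen ≤ σ.gen + κ := by
    rcases h.mem_or with ⟨rfl, -⟩ | ⟨-, h1, -⟩
    · obtain ⟨τ, hτ, hqτ⟩ := Mesh.mem_vertices.1 h.mem_vertices
      have hr := Mesh.mem_ring.2 ⟨hτ, hqτ⟩
      exact ⟨τ, mem_coarseMesh.2 (Or.inl ⟨hτ, h.gen_le τ hr⟩), hqτ, Or.inl hτ,
        fun σ hσ => (hR i le_rfl q h.mem_vertices).1 τ hr σ hσ⟩
    · obtain ⟨τ, hτ, hqτ⟩ := Mesh.mem_vertices.1 (Mesh.mem_interiorVertices.1 hq).1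
      have hgle := gen_le_of_mem_coarseMesh hτ
      refine ⟨τ, hτ, hqτ, ?_, fun σ hσ => by have := h1 σ hσ; omega⟩
      rcases mem_coarseMesh.1 hτ with h2 | ⟨j, -, -, h2⟩
      · exact Or.inl h2.1
      · exact Or.inr ⟨isNode_of_mem_coarseMesh hM hc hτ, by omega, hgle⟩
  refine ⟨τ, hτ, hqτ, hτg, (hT.normSqL2_nodal_le hΩ hM h.nodal).trans ?_⟩
  have hcard : (((M.mesh e i).ring q).card : ℝ) ≤ κ := by
    exact_mod_cast (hR i h.le q h.mem_vertices).2
  calc ∑ σ ∈ (M.mesh e i).ring q, volume.real σ.hull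
      ≤ ((M.mesh e i).ring q).card • ((|ρ| * |σ|) ^ d * 2 ^ κ * volume.real τ.hull) :=
        Finset.sum_le_card_nsmul _ _ _ fun σ' hσ' =>
          (hT.isNode σ' (Mesh.mem_ring.1 hσ').1).volume_le hM hU hSh hQ
            (isNode_of_mem_coarseMesh hM hc hτ) (hle σ' hσ')
    _ ≤ κ * ((|ρ| * |σ|) ^ d * 2 ^ κ * volume.real τ.hull) := by
        rw [nsmul_eq_mul]
        exact mul_le_mul_of_nonneg_right hcard (by positivity)
    _ = _ := by ring

/-- The nodal values are bounded by the `L²` norm. -/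
lemma sum_sq_mul_normSqL2_le {u : Pt d → ℝ} (hu : u ∈ (M.coarseMesh e J (k + κ)).feSpace Ω) :
    ∑ q ∈ (M.coarseMesh e J (k + κ)).interiorVertices Ω, u q ^ 2 * normSqL2 Ω (ψ q) ≤
      (κ * ((|ρ| * |σ|) ^ d * 2 ^ κ) * (8 * 2 ^ d + 2) * ((κ + 2) * (d + 1) : ℕ)) *
        normSqL2 Ω u := by
  set X := (M.coarseMesh e J (k + κ)).interiorVertices Ω with hX
  have hex : ∀ q ∈ X, _ := fun q hq =>
    (hψ q hq).exists_normSqL2_le hΩ hM hc hU hSh hQ hR hq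
  have : Nonempty (Elem d) := ⟨⟨∅, 0⟩⟩
  choose! τ h1 h2 h3 h4 using hex
  have hui := (M.coarseMesh e J (k + κ)).integrable_sq hΩ.isBounded hu
  set D : ℝ := κ * ((|ρ| * |σ|) ^ d * 2 ^ κ) with hD
  have hD0 : 0 ≤ D := by positivity
  -- Since `u` is affine on `τ q`, its value at the vertex `q` is controlled by its L² norm on that
  -- single element.
  have hterm : ∀ q ∈ X, u q ^ 2 * normSqL2 Ω (ψ q) ≤
      D * (8 * 2 ^ d + 2) * ∫ x in (τ q).hull, u x ^ 2 := by
    intro q hq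
    obtain ⟨f, hf⟩ := hu.2.1 (τ q) (h1 q hq)
    have hqh := (τ q).subset_hull (h2 q hq)
    have hb := sq_mul_volume_le (IsSimplex.hull_isCompact (τ q).verts) (convex_convexHull ℝ _) hqh f
    have hcongr : ∫ x in (τ q).hull, u x ^ 2 = ∫ x in (τ q).hull, f x ^ 2 :=
      setIntegral_congr_fun (τ q).measurableSet_hull fun x hx => by simp only [hf x hx]
    rw [hcongr, hf q hqh]
    calc f q ^ 2 * normSqL2 Ω (ψ q) ≤ f q ^ 2 * (D * volume.real (τ q).hull) :=
          mul_le_mul_of_nonneg_left (h4 q hq) (sq_nonneg _)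
      _ = D * (f q ^ 2 * volume.real (τ q).hull) := by ring
      _ ≤ D * ((8 * 2 ^ d + 2) * ∫ x in (τ q).hull, f x ^ 2) := mul_le_mul_of_nonneg_left hb hD0
      _ = _ := by ring
  -- The elements `τ q` may coincide or overlap, but almost every point is counted boundedly often.
  have hsum : ∑ q ∈ X, ∫ x in (τ q).hull, u x ^ 2 ≤
      ((κ + 2) * (d + 1) : ℕ) * normSqL2 Ω u := by
    have hind : ∀ q, Integrable ((τ q).hull.indicator fun x => u x ^ 2) := fun q =>
      hui.indicator (τ q).measurableSet_hull
    rw [normSqL2_eq_integral hu.2.2, ← integral_const_mul,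
      Finset.sum_congr rfl fun q _ => (integral_indicator (τ q).measurableSet_hull).symm,
      ← integral_finsetSum _ fun q _ => hind q]
    refine integral_mono_ae (integrable_finsetSum _ fun q _ => hind q) (hui.const_mul _) ?_
    filter_upwards [ae_card_le hM hc hU k κ] with x hx
    have hcard := hx (X.filter fun q => x ∈ (τ q).hull) fun q hq => by
      obtain ⟨h5, h6⟩ := Finset.mem_filter.1 hq
      exact ⟨τ q, h6, h2 q h5, h3 q h5⟩
    have heq : ∑ q ∈ X, (τ q).hull.indicator (fun x => u x ^ 2) x =
        (X.filter fun q => x ∈ (τ q).hull).card * u x ^ 2 := by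
      simp only [Set.indicator_apply]
      rw [← Finset.sum_filter, Finset.sum_const, nsmul_eq_mul]
    rw [heq]
    exact mul_le_mul_of_nonneg_right (by exact_mod_cast hcard) (sq_nonneg _)
  calc ∑ q ∈ X, u q ^ 2 * normSqL2 Ω (ψ q)
      ≤ ∑ q ∈ X, D * (8 * 2 ^ d + 2) * ∫ x in (τ q).hull, u x ^ 2 := Finset.sum_le_sum hterm
    _ = D * (8 * 2 ^ d + 2) * ∑ q ∈ X, ∫ x in (τ q).hull, u x ^ 2 := by rw [Finset.mul_sum]
    _ ≤ D * (8 * 2 ^ d + 2) * (((κ + 2) * (d + 1) : ℕ) * normSqL2 Ω u) :=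
        mul_le_mul_of_nonneg_left hsum (by positivity)
    _ = _ := by ring

end estimates

end BisectionMethod

end

/-! ### Assembly of the stable decomposition. -/

section
open scoped Classical
open MeasureTheory

variable {d : ℕ}

namespace BisectionMethod

variable {M : BisectionMethod d} {Ω : Set (Pt d)}

/-- The overlap of the basis functions. -/
def overlapConst (d κ : ℕ) : ℕ := (κ + 2) * (d + 1)

/-- The constant in the bound of the nodal values. -/
noncomputable def nodalConst (d κ : ℕ) (σ ρ : ℝ) : ℝ :=
  κ * ((|ρ| * |σ|) ^ d * 2 ^ κ) * (8 * 2 ^ d + 2) * ((κ + 2) * (d + 1) : ℕ)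

/-- The stability constant of the triangular decomposition. -/
noncomputable def triangularConst (d κ : ℕ) (σ ρ : ℝ) : ℝ :=
  (fun K => 2 * K + 2 * (nodalConst d κ σ ρ * (2 + 2 * (overlapConst d κ * K))))^[κ + 1] 0

lemma nodalConst_nonneg (d κ : ℕ) (σ ρ : ℝ) : 0 ≤ nodalConst d κ σ ρ := by
  rw [nodalConst]; positivity

lemma triangularConst_nonneg (d κ : ℕ) (σ ρ : ℝ) : 0 ≤ triangularConst d κ σ ρ := by
  rw [triangularConst]
  generalize κ + 1 = n
  induction n with
  | zero => exact le_rfl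
  | succ n ih =>
    rw [Function.iterate_succ_apply']
    have := nodalConst_nonneg d κ σ ρ
    positivity

variable (hΩ : IsBoundedLipschitzDomain Ω) (hM : M.IsOn Ω) (hU : M.UniformConformity)
  {σ ρ : ℝ} (hSh : M.IsShapeRegular σ) (hQ : M.IsQuasiUniform ρ)
  {e : ℕ → Finset (Pt d)} {J k κ : ℕ} (hc : M.IsCompatibleSequence e J) (hR : M.RingBound e J κ)
include hΩ hM hU hSh hQ hc hR

/-- The vertices of the cut mesh have vertex generation at most k + κ, so after the last sweep the
residual vanishes at all interior vertices and hence everywhere. -/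
lemma exists_basis_decomposition {ψ : Pt d → Pt d → ℝ} {ι : Pt d → ℕ}
    (hψ : ∀ q ∈ (M.coarseMesh e J (k + κ)).interiorVertices Ω,
      M.IsBasisAt Ω e J k κ q (ι q) (ψ q))
    {w : Pt d → ℝ} (hw : w ∈ (M.coarseMesh e J (k + κ)).feSpace Ω) :
    ∃ c : Pt d → ℝ, w = ∑ q ∈ (M.coarseMesh e J (k + κ)).interiorVertices Ω, c q • ψ q ∧
      ∑ q ∈ (M.coarseMesh e J (k + κ)).interiorVertices Ω, c q ^ 2 * normSqL2 Ω (ψ q) ≤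
        triangularConst d κ σ ρ * normSqL2 Ω w := by
  have hψA := fun q hq => (hψ q hq).mem_feSpace hM hc
  obtain ⟨c, h1, h2⟩ := exists_triangular_decomposition
    (X := (M.coarseMesh e J (k + κ)).interiorVertices Ω)
    (A := (M.coarseMesh e J (k + κ)).feSpace Ω) (N := normSqL2 Ω) (ψ := ψ) (g := M.vertexGen)
    (k := k) (nodalConst_nonneg d κ σ ρ) (Nat.cast_nonneg (overlapConst d κ)) hψA normSqL2_nonneg
    (fun u hu v hv => normSqL2_sub_le hΩ.isBounded hu hv)
    (fun u hu => sum_sq_mul_normSqL2_le hΩ hM hc hU hψ hSh hQ hR hu)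
    (fun a => normSqL2_sum_basis_le hΩ hM hc hU hψ subset_rfl a)
    (fun q hq => (hψ q hq).nodal.2.1)
    (fun q hq q' hq' hne h0 => (hψ q hq).vertexGen_lt hM hc hU hq' hne h0) hw κ
  refine ⟨c, sub_eq_zero.1 (eq_zero_of_mem_feSpace_coarseMesh hM hc
    (Submodule.sub_mem _ hw (Submodule.sum_mem _ fun q hq => Submodule.smul_mem _ _ (hψA q hq)))
    fun q hq => h1 q hq ?_), h2⟩
  exact (mem_vertices_of_mem_coarseMesh hM hc (Mesh.mem_interiorVertices.1 hq).1).2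

theorem exists_stable_decomposition {w : Pt d → ℝ} (hw : w ∈ M.W Ω e J k) :
    ∃ (wn : Pt d → Pt d → ℝ) (wl : ℕ → Pt d → ℝ),
      (∀ q ∈ M.levelVertices Ω e J (k + κ), wn q ∈ M.nodalSpace Ω e J q) ∧
      (∀ j ∈ M.nearBisections e J k κ, wl j ∈ M.localSpace Ω e j) ∧
      w = ∑ q ∈ M.levelVertices Ω e J (k + κ), wn q + ∑ j ∈ M.nearBisections e J k κ, wl j ∧
      normSqL2 Ω w ≤ 2 * overlapConst d κ *
        (∑ q ∈ M.levelVertices Ω e J (k + κ), normSqL2 Ω (wn q) +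
          ∑ j ∈ M.nearBisections e J k κ, normSqL2 Ω (wl j)) ∧
      ∑ q ∈ M.levelVertices Ω e J (k + κ), normSqL2 Ω (wn q) +
          ∑ j ∈ M.nearBisections e J k κ, normSqL2 Ω (wl j) ≤
        (1 + overlapConst d κ) * triangularConst d κ σ ρ * normSqL2 Ω w := by
  set T := M.coarseMesh e J (k + κ) with hT
  set X := T.interiorVertices Ω with hX
  set L := M.levelVertices Ω e J (k + κ) with hL
  have hLX : L ⊆ X := levelVertices_subset hM hc
  choose! ι ψ hψ using fun q (hq : q ∈ X) => exists_isBasisAt hΩ hM hc hU hR k hq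
  have hbad : ∀ q ∈ X \ L, ∃ j ∈ M.nearBisections e J k κ, ψ q ∈ M.localSpace Ω e j := by
    intro q hq
    obtain ⟨h1, h2⟩ := Finset.mem_sdiff.1 hq
    rcases (hψ q h1).mem_or with ⟨-, h3⟩ | ⟨-, -, h3⟩
    · exact absurd h3 h2
    · exact h3
  choose! γ hγ hγψ using hbad
  obtain ⟨c, hwc, hcN⟩ := exists_basis_decomposition hΩ hM hU hSh hQ hc hR hψ
    (W_le_feSpace_coarseMesh hM hc hU hR k hw)
  -- Several nodes may use the same bisection `γ q = j`; their contributions are collected into one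
  -- function of that local space.
  set F : ℕ → Finset (Pt d) := fun j => (X \ L).filter (fun q => γ q = j) with hF
  have hFX : ∀ j, F j ⊆ X := fun j => (Finset.filter_subset _ _).trans Finset.sdiff_subset
  have hmem : ∀ q ∈ X, c q • ψ q ∈ T.feSpace Ω := fun q hq =>
    Submodule.smul_mem _ _ ((hψ q hq).mem_feSpace hM hc)
  have hwl : ∀ j, ∑ q ∈ F j, c q • ψ q ∈ T.feSpace Ω := fun j =>
    Submodule.sum_mem _ fun q hq => hmem q (hFX j hq)
  have hfib : ∑ j ∈ M.nearBisections e J k κ, ∑ q ∈ F j, c q • ψ q = ∑ q ∈ X \ L, c q • ψ q :=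
    Finset.sum_fiberwise_of_maps_to hγ _
  have hsum : w = ∑ q ∈ L, c q • ψ q + ∑ j ∈ M.nearBisections e J k κ, ∑ q ∈ F j, c q • ψ q := by
    rw [hfib, add_comm, Finset.sum_sdiff hLX]
    exact hwc
  refine ⟨fun q => c q • ψ q, fun j => ∑ q ∈ F j, c q • ψ q, fun q hq => ?_, fun j hj => ?_, hsum,
    ?_, ?_⟩
  · refine Submodule.smul_mem _ _ (Submodule.subset_span ⟨q, (Finset.mem_filter.1 hq).1, rfl, ?_⟩)
    have hq' := hψ q (hLX hq)
    rcases hq'.mem_or with ⟨h1, -⟩ | ⟨h1, -⟩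
    · rw [← h1]; exact hq'.nodal
    · exact absurd hq h1
  · refine Submodule.sum_mem _ fun q hq => Submodule.smul_mem _ _ ?_
    obtain ⟨h1, h2⟩ := Finset.mem_filter.1 hq
    rw [← h2]
    exact hγψ q h1
  · have hov := ae_card_basis_le hΩ hM hc hU hψ
    have h1 : normSqL2 Ω (∑ q ∈ L, c q • ψ q) ≤
        overlapConst d κ * ∑ q ∈ L, normSqL2 Ω (c q • ψ q) := by
      refine normSqL2_sum_le hΩ.isBounded (T := T) (fun q hq => hmem q (hLX hq)) ?_
      filter_upwards [hov] with x hx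
      refine (Finset.card_le_card fun q hq => ?_).trans hx
      obtain ⟨h1, h2⟩ := Finset.mem_filter.1 hq
      refine Finset.mem_filter.2 ⟨hLX h1, fun h => h2 ?_⟩
      rw [Pi.smul_apply, h, smul_zero]
    have h2 : normSqL2 Ω (∑ j ∈ M.nearBisections e J k κ, ∑ q ∈ F j, c q • ψ q) ≤
        overlapConst d κ * ∑ j ∈ M.nearBisections e J k κ, normSqL2 Ω (∑ q ∈ F j, c q • ψ q) := by
      refine normSqL2_sum_le hΩ.isBounded (T := T) (fun j _ => hwl j) ?_
      filter_upwards [hov] with x hx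
      -- Each bisection active at `x` is the image under `γ` of a node active at `x`, so grouping
      -- does not increase the overlap.
      refine (Finset.card_le_card (t := (X.filter (fun q => ψ q x ≠ 0)).image γ)
        fun j hj => ?_).trans (Finset.card_image_le.trans hx)
      obtain ⟨-, h2⟩ := Finset.mem_filter.1 hj
      rw [Finset.sum_apply] at h2
      obtain ⟨q, hq, hne⟩ := Finset.exists_ne_zero_of_sum_ne_zero h2
      refine Finset.mem_image.2 ⟨q, Finset.mem_filter.2 ⟨hFX j hq, fun h => hne ?_⟩,
        (Finset.mem_filter.1 hq).2⟩
      rw [Pi.smul_apply, h, smul_zero]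
    have hneg : ∀ v : Pt d → ℝ, normSqL2 Ω (-v) = normSqL2 Ω v := fun v => by
      rw [← neg_one_smul ℝ v, normSqL2_smul]; norm_num
    have h3 := normSqL2_sub_le hΩ.isBounded
      (Submodule.sum_mem _ fun q hq => hmem q (hLX hq))
      (Submodule.neg_mem _ (Submodule.sum_mem _ fun j (_ : j ∈ M.nearBisections e J k κ) => hwl j))
    rw [sub_neg_eq_add, ← hsum, hneg] at h3
    linarith
  · have h1 : ∀ j, normSqL2 Ω (∑ q ∈ F j, c q • ψ q) ≤
        overlapConst d κ * ∑ q ∈ F j, c q ^ 2 * normSqL2 Ω (ψ q) := fun j =>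
      normSqL2_sum_basis_le hΩ hM hc hU hψ (hFX j) c
    have h0 : ∀ q, 0 ≤ c q ^ 2 * normSqL2 Ω (ψ q) := fun q =>
      mul_nonneg (sq_nonneg _) (normSqL2_nonneg _)
    have h2 : ∑ j ∈ M.nearBisections e J k κ, normSqL2 Ω (∑ q ∈ F j, c q • ψ q) ≤
        overlapConst d κ * ∑ q ∈ X \ L, c q ^ 2 * normSqL2 Ω (ψ q) := by
      refine (Finset.sum_le_sum fun j _ => h1 j).trans_eq ?_
      rw [← Finset.mul_sum, Finset.sum_fiberwise_of_maps_to hγ]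
    have h3 : ∑ q ∈ X \ L, c q ^ 2 * normSqL2 Ω (ψ q) ≤ ∑ q ∈ X, c q ^ 2 * normSqL2 Ω (ψ q) :=
      Finset.sum_le_sum_of_subset_of_nonneg Finset.sdiff_subset fun q _ _ => h0 q
    have h4 : ∑ q ∈ L, c q ^ 2 * normSqL2 Ω (ψ q) ≤ ∑ q ∈ X, c q ^ 2 * normSqL2 Ω (ψ q) :=
      Finset.sum_le_sum_of_subset_of_nonneg hLX fun q _ _ => h0 q
    rw [Finset.sum_congr rfl fun q _ => normSqL2_smul (c q) (ψ q)]
    have hN : (0 : ℝ) ≤ overlapConst d κ := Nat.cast_nonneg _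
    calc _ ≤ ∑ q ∈ X, c q ^ 2 * normSqL2 Ω (ψ q) +
          overlapConst d κ * ∑ q ∈ X, c q ^ 2 * normSqL2 Ω (ψ q) :=
          add_le_add h4 (h2.trans (mul_le_mul_of_nonneg_left h3 hN))
      _ = (1 + overlapConst d κ) * ∑ q ∈ X, c q ^ 2 * normSqL2 Ω (ψ q) := by ring
      _ ≤ (1 + overlapConst d κ) * (triangularConst d κ σ ρ * normSqL2 Ω w) :=
          mul_le_mul_of_nonneg_left hcN (by positivity)
      _ = _ := by ring

end BisectionMethod

end

/-! ### Existence of k_* in dimension at least two. -/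

section
open scoped Classical
open MeasureTheory

variable {d : ℕ}

/-- Near a boundary point, points of a Lipschitz domain can be joined within the domain. -/
lemma IsBoundedLipschitzDomain.exists_joinedIn {Ω : Set (Pt d)} (hΩ : IsBoundedLipschitzDomain Ω)
    {p : Pt d} (hp : p ∈ frontier Ω) {ε : ℝ} (hε : 0 < ε) :
    ∃ δ > 0, ∀ x ∈ Ω ∩ Metric.ball p δ, ∀ y ∈ Ω ∩ Metric.ball p δ,
      JoinedIn (Ω ∩ Metric.ball p ε) x y := by
  obtain ⟨n, r, K, g, hn, hr, hg, hchart⟩ := hΩ.lipschitz_boundary p hp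
  have hnn : inner ℝ n n = (1 : ℝ) := by rw [real_inner_self_eq_norm_sq, hn]; norm_num
  have hK : (0 : ℝ) ≤ K := K.2
  set r' := min r ε with hr'
  have hr'0 : 0 < r' := lt_min hr hε
  -- Two points are joined by climbing (2 + 4K)δ along `n`, crossing, and descending. With the
  -- initial distance δ this adds up to (3 + 4K)δ = r'.
  set δ := r' / (3 + 4 * K) with hδ
  have hδ0 : 0 < δ := by positivity
  have hδr : δ + (2 + 4 * K) * δ = r' := by rw [hδ]; field_simp; ring
  have hδle : δ ≤ r' := by nlinarith
  -- A shift by `v` lowers the height by at most ‖v‖ and raises the graph by at most 2K‖v‖, the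
  -- projection moving by at most 2‖v‖; a climb of (1 + 2K)‖v‖ compensates both.
  have key : ∀ x ∈ Ω ∩ Metric.ball p δ, ∀ v : Pt d, x + v ∈ Metric.ball p δ → ∀ s : ℝ,
      (1 + 2 * K) * ‖v‖ ≤ s → s ≤ (2 + 4 * K) * δ → x + v + s • n ∈ Ω ∩ Metric.ball p ε := by
    rintro x ⟨hxΩ, hxδ⟩ v hv s hs hs'
    have hs0 : 0 ≤ s := le_trans (by positivity) hs
    have hz : x + v + s • n ∈ Metric.ball p r' := by
      rw [Metric.mem_ball, dist_eq_norm] at hv ⊢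
      calc ‖x + v + s • n - p‖ = ‖(x + v - p) + s • n‖ := by congr 1; abel
        _ ≤ ‖x + v - p‖ + ‖s • n‖ := norm_add_le _ _
        _ = ‖x + v - p‖ + s := by rw [norm_smul, hn, mul_one, Real.norm_of_nonneg hs0]
        _ < δ + (2 + 4 * K) * δ := by linarith
        _ = r' := hδr
    refine ⟨(hchart _ (Metric.ball_subset_ball (min_le_left _ _) hz)).2 ?_,
      Metric.ball_subset_ball (min_le_right _ _) hz⟩
    have hx := (hchart x (Metric.ball_subset_ball (hδle.trans (min_le_left _ _)) hxδ)).1 hxΩ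
    have hin : inner ℝ n (x + v + s • n) = inner ℝ n x + inner ℝ n v + s := by
      rw [inner_add_right, inner_add_right, inner_smul_right, hnn, mul_one]
    have hinv : |inner ℝ n v| ≤ ‖v‖ := by
      have := abs_real_inner_le_norm n v
      rwa [hn, one_mul] at this
    have hlip := hg.dist_le_mul (x + v + s • n - (inner ℝ n x + inner ℝ n v + s) • n)
      (x - (inner ℝ n x) • n)
    have hdist : dist (x + v + s • n - (inner ℝ n x + inner ℝ n v + s) • n)
        (x - (inner ℝ n x) • n) ≤ 2 * ‖v‖ := by
      rw [dist_eq_norm]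
      calc _ = ‖v - (inner ℝ n v) • n‖ := by
            congr 1; rw [add_smul, add_smul]; abel
        _ ≤ ‖v‖ + ‖(inner ℝ n v) • n‖ := norm_sub_le _ _
        _ = ‖v‖ + |inner ℝ n v| := by rw [norm_smul, hn, mul_one, Real.norm_eq_abs]
        _ ≤ _ := by linarith
    rw [hin]
    rw [Real.dist_eq] at hlip
    have h1 := (abs_le.1 (hlip.trans (mul_le_mul_of_nonneg_left hdist hK))).2
    have h2 := (abs_le.1 hinv).1
    linarith
  refine ⟨δ, hδ0, fun x hx y hy => ?_⟩
  have hvert : ∀ x ∈ Ω ∩ Metric.ball p δ,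
      JoinedIn (Ω ∩ Metric.ball p ε) x (x + ((2 + 4 * K) * δ) • n) := by
    intro x hx
    refine JoinedIn.of_segment_subset ?_
    rw [segment_eq_image']
    rintro z ⟨θ, ⟨hθ0, hθ1⟩, rfl⟩
    have := key x hx 0 (by simpa using hx.2) (θ * ((2 + 4 * K) * δ))
      (by rw [norm_zero, mul_zero]; positivity) (mul_le_of_le_one_left (by positivity) hθ1)
    simpa [mul_smul] using this
  refine ((hvert x hx).trans ?_).trans (hvert y hy).symm
  refine JoinedIn.of_segment_subset ?_
  rw [segment_eq_image']
  rintro z ⟨θ, ⟨hθ0, hθ1⟩, rfl⟩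
  have hball : x + θ • (y - x) ∈ Metric.ball p δ := by
    have := (convex_ball p δ).lineMap_mem hx.2 hy.2 ⟨hθ0, hθ1⟩
    rwa [AffineMap.lineMap_apply_module', add_comm] at this
  have hnorm : ‖θ • (y - x)‖ ≤ 2 * δ := by
    have hxy : ‖y - x‖ ≤ 2 * δ := by
      rw [← dist_eq_norm]
      have h1 := Metric.mem_ball.1 hx.2
      have h2 := Metric.mem_ball.1 hy.2
      have := dist_triangle_right y x p
      linarith
    rw [norm_smul, Real.norm_of_nonneg hθ0]
    exact (mul_le_of_le_one_left (norm_nonneg _) hθ1).trans hxy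
  have := key x hx (θ • (y - x)) hball ((2 + 4 * K) * δ) (by nlinarith) le_rfl
  convert this using 1
  rw [add_sub_add_right_eq_sub]
  exact add_right_comm _ _ _

namespace BisectionMethod

variable {M : BisectionMethod d} {Ω : Set (Pt d)} (hM : M.IsOn Ω) (hU : M.UniformConformity)
  {σ ρ : ℝ} (hSh : M.IsShapeRegular σ) (hQ : M.IsQuasiUniform ρ)
include hM hU hSh

/-- The number of elements around a vertex is bounded by shape regularity. -/
lemma IsAdmissible.card_ring_le {T : Mesh d} (hT : M.IsAdmissible Ω T) (p : Pt d) :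
    ((T.ring p).card : ℝ) ≤ |σ| ^ d := by
  rcases (T.ring p).eq_empty_or_nonempty with h0 | hne
  · rw [h0]; simp
  have hex : ∀ τ ∈ T.ring p, ∃ (x : Pt d) (r : ℝ),
      0 < r ∧ Metric.closedBall x r ⊆ τ.hull ∧ Metric.diam τ.hull ≤ σ * r := fun τ hτ =>
    IsNode.exists_ball hU hSh (hT.isNode τ (Mesh.mem_ring.1 hτ).1)
  choose! x r hr hsub hdiam using hex
  obtain ⟨τ₀, hτ₀, hmin⟩ := Finset.exists_min_image (T.ring p) r hne
  set s := r τ₀ with hs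
  have hs0 : 0 < s := hr τ₀ hτ₀
  -- Homotheties centred at `p` shrink all inscribed balls to the smallest radius `s`. The images
  -- stay in their elements and in a ball of radius |σ| s about `p`, so their number is bounded by
  -- volume.
  set B : Elem d → Set (Pt d) := fun τ =>
    Metric.closedBall (AffineMap.lineMap p (x τ) (s / r τ)) s with hB
  have hBsub : ∀ τ ∈ T.ring p, B τ ⊆ τ.hull ∩ Metric.closedBall p (|σ| * s) := by
    intro τ hτ y hy
    have hr0 := hr τ hτ
    have hl0 : 0 < s / r τ := div_pos hs0 hr0
    have hl1 : s / r τ ≤ 1 := (div_le_one hr0).2 (hmin τ hτ)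
    have hpτ := τ.subset_hull (Mesh.mem_ring.1 hτ).2
    set z : Pt d := p + (s / r τ)⁻¹ • (y - p) with hz
    have hyz : y = AffineMap.lineMap p z (s / r τ) := by
      rw [AffineMap.lineMap_apply_module', hz, add_sub_cancel_left, smul_smul,
        mul_inv_cancel₀ hl0.ne', one_smul, sub_add_cancel]
    have hzB : z ∈ Metric.closedBall (x τ) (r τ) := by
      rw [hB, hyz] at hy
      rw [Metric.mem_closedBall] at hy ⊢
      rw [dist_eq_norm, AffineMap.lineMap_apply_module', AffineMap.lineMap_apply_module',
        add_sub_add_right_eq_sub, ← smul_sub, sub_sub_sub_cancel_right, norm_smul,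
        Real.norm_of_nonneg hl0.le, ← dist_eq_norm, div_mul_eq_mul_div, div_le_iff₀ hr0] at hy
      exact le_of_mul_le_mul_left hy hs0
    have hzτ := hsub τ hτ hzB
    refine ⟨?_, ?_⟩
    · rw [hyz]
      exact (convex_convexHull ℝ _).lineMap_mem hpτ hzτ ⟨hl0.le, hl1⟩
    · rw [Metric.mem_closedBall, hyz, dist_lineMap_left, Real.norm_of_nonneg hl0.le]
      have h1 : dist p z ≤ |σ| * r τ :=
        ((Metric.dist_le_diam_of_mem (IsSimplex.hull_isCompact τ.verts).isBounded hpτ hzτ).trans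
          (hdiam τ hτ)).trans (mul_le_mul_of_nonneg_right (le_abs_self σ) hr0.le)
      calc s / r τ * dist p z ≤ s / r τ * (|σ| * r τ) := mul_le_mul_of_nonneg_left h1 hl0.le
        _ = |σ| * s := by field_simp
  have hdisj : Set.Pairwise (T.ring p : Set (Elem d)) fun τ τ' => AEDisjoint volume (B τ) (B τ') := by
    intro τ hτ τ' hτ' hne
    rw [AEDisjoint, measure_eq_zero_iff_ae_notMem]
    filter_upwards [hT.ae_eq_of_mem_hull hM] with y hy hyB
    exact hne (hy τ (Mesh.mem_ring.1 hτ).1 τ' (Mesh.mem_ring.1 hτ').1 (hBsub τ hτ hyB.1).1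
      (hBsub τ' hτ' hyB.2).1)
  have hvol : ∑ τ ∈ T.ring p, volume.real (B τ) ≤
      volume.real (Metric.closedBall p (|σ| * s)) := by
    rw [← measureReal_biUnion_finset₀ hdisj (fun τ _ => measurableSet_closedBall.nullMeasurableSet)
      fun τ _ => measure_closedBall_lt_top.ne]
    exact measureReal_mono (Set.iUnion₂_subset fun τ hτ => (hBsub τ hτ).trans
      Set.inter_subset_right) measure_closedBall_lt_top.ne
  have hω : 0 < volume.real (Metric.ball (0 : Pt d) 1) :=
    ENNReal.toReal_pos (Metric.measure_ball_pos volume _ one_pos).ne' measure_ball_lt_top.ne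
  simp only [hB] at hvol
  rw [Finset.sum_congr rfl fun τ _ => volume_real_closedBall _ hs0.le, Finset.sum_const,
    nsmul_eq_mul, volume_real_closedBall _ (by positivity), mul_pow, mul_assoc] at hvol
  exact le_of_mul_le_mul_right hvol (by positivity)

include hQ

/-- The generations of elements with a common edge are comparable. -/
lemma IsNode.two_pow_gen_le {τ τ' : Elem d} (h : M.IsNode τ) (h' : M.IsNode τ') {p q : Pt d}
    (hpq : p ≠ q) (hp : p ∈ τ.verts) (hq : q ∈ τ.verts) (hp' : p ∈ τ'.verts) (hq' : q ∈ τ'.verts) :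
    (2 : ℝ) ^ τ'.gen ≤ (|ρ| * |σ|) ^ d * |σ| ^ (2 * d) * 2 ^ τ.gen := by
  obtain ⟨x, r, hr, hsub, hdiam⟩ := h.exists_ball hU hSh
  obtain ⟨x', r', hr', hsub', hdiam'⟩ := h'.exists_ball hU hSh
  have hs := h.isSimplex hM
  have hnorm : 0 < ‖p - q‖ := norm_pos_iff.2 (sub_ne_zero.2 hpq)
  -- Moving from the centre of the inscribed ball by `r` in the direction p - q raises the
  -- coordinate of `p` by r/‖p - q‖, and this coordinate stays between 0 and 1.
  have hrle : r ≤ ‖p - q‖ := by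
    set t := r / ‖p - q‖ with ht
    have hmem : x + t • (p - q) ∈ τ.hull := hsub (by
      rw [Metric.mem_closedBall, dist_eq_norm, add_sub_cancel_left, norm_smul, ht,
        Real.norm_of_nonneg (by positivity), div_mul_cancel₀ _ hnorm.ne'])
    have hx := hsub (Metric.mem_closedBall_self hr.le)
    have h1 := hs.bary_le_one hmem p
    have h2 := hs.mem_hull_iff.1 hx p
    have hlin : (bary τ.verts p).linear (p - q) = 1 := by
      have := (bary τ.verts p).linearMap_vsub p q
      rw [vsub_eq_sub, vsub_eq_sub, hs.bary_self hp, hs.bary_ne hq hpq, sub_zero] at this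
      exact this
    have h3 : bary τ.verts p (x + t • (p - q)) = bary τ.verts p x + t := by
      rw [add_comm x, ← vadd_eq_add, AffineMap.map_vadd, map_smul, hlin, smul_eq_mul, mul_one,
        vadd_eq_add, add_comm]
    have h4 : t ≤ 1 := by linarith
    exact (div_le_one hnorm).1 h4
  have hd' : ‖p - q‖ ≤ |σ| * r' := by
    rw [← dist_eq_norm]
    exact ((Metric.dist_le_diam_of_mem (IsSimplex.hull_isCompact τ'.verts).isBounded
      (τ'.subset_hull hp') (τ'.subset_hull hq')).trans hdiam').trans
      (mul_le_mul_of_nonneg_right (le_abs_self σ) hr'.le)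
  have hd : Metric.diam τ.hull ≤ |σ| * (|σ| * r') :=
    hdiam.trans ((mul_le_mul_of_nonneg_right (le_abs_self σ) hr.le).trans
      (mul_le_mul_of_nonneg_left (hrle.trans hd') (abs_nonneg σ)))
  have hball := measureReal_mono (μ := volume) hsub' τ'.volume_hull_ne_top
  rw [volume_real_closedBall x' hr'.le] at hball
  have hω : 0 < volume.real (Metric.ball (0 : Pt d) 1) :=
    ENNReal.toReal_pos (Metric.measure_ball_pos volume _ one_pos).ne' measure_ball_lt_top.ne
  have hpos : 0 < volume.real τ'.hull := lt_of_lt_of_le (by positivity) hball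
  have hvol : volume.real τ.hull ≤ |σ| ^ (2 * d) * volume.real τ'.hull := by
    calc volume.real τ.hull
        ≤ Metric.diam τ.hull ^ d * volume.real (Metric.ball (0 : Pt d) 1) :=
          τ.volume_hull_le (τ.subset_hull hp)
      _ ≤ (|σ| * (|σ| * r')) ^ d * volume.real (Metric.ball (0 : Pt d) 1) := by
          gcongr
      _ = |σ| ^ (2 * d) * (r' ^ d * volume.real (Metric.ball (0 : Pt d) 1)) := by
          rw [mul_pow, mul_pow, two_mul, pow_add]; ring
      _ ≤ _ := by gcongr
  obtain ⟨τ₀, h₀, hv⟩ := h.exists_volume_real_eq hM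
  obtain ⟨τ₀', h₀', hv'⟩ := h'.exists_volume_real_eq hM
  have h1 := volume_initialMesh_le hU hSh hQ h₀' h₀
  rw [← hv, ← hv'] at h1
  refine le_of_mul_le_mul_right ?_ hpos
  calc (2 : ℝ) ^ τ'.gen * volume.real τ'.hull
      ≤ (|ρ| * |σ|) ^ d * (2 ^ τ.gen * volume.real τ.hull) := h1
    _ ≤ (|ρ| * |σ|) ^ d * (2 ^ τ.gen * (|σ| ^ (2 * d) * volume.real τ'.hull)) := by gcongr
    _ = _ := by ring

omit hU hSh hQ

/-- The first ring of a vertex is connected through elements with a common edge. -/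
lemma IsAdmissible.exists_common_edge (hΩ : IsBoundedLipschitzDomain Ω) (hd : 2 ≤ d) {T : Mesh d}
    (hT : M.IsAdmissible Ω T) {p : Pt d} (P : Elem d → Prop) {τ₁ τ₂ : Elem d}
    (h₁ : τ₁ ∈ T.ring p) (h₂ : τ₂ ∈ T.ring p) (hP₁ : P τ₁) (hP₂ : ¬ P τ₂) :
    ∃ τ ∈ T.ring p, ∃ τ' ∈ T.ring p, P τ ∧ ¬ P τ' ∧ ∃ q, p ≠ q ∧ q ∈ τ.verts ∧ q ∈ τ'.verts := by
  by_contra! hno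
  -- If elements of the two classes share no vertex but `p`, conformity makes `p` their only common
  -- point.
  have hmeet : ∀ τ ∈ T.ring p, ∀ τ' ∈ T.ring p, P τ → ¬ P τ' → ∀ x ∈ τ.hull, x ∈ τ'.hull →
      x = p := by
    intro τ hτ τ' hτ' hP hP' x hx hx'
    obtain ⟨hτT, hpτ⟩ := Mesh.mem_ring.1 hτ
    have hs := hT.isSimplex hM hτT
    have h0 : ∀ v ∈ τ.verts, v ≠ p → bary τ.verts v x = 0 := by
      intro v hv hvp
      rw [hT.bary_eq τ hτT τ' (Mesh.mem_ring.1 hτ').1 x hx hx']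
      exact bary_of_notMem (hno τ hτ τ' hτ' hP hP' v hvp.symm hv) x
    have hsum := hs.sum_bary x
    rw [Finset.sum_eq_single_of_mem p hpτ h0] at hsum
    have hx := hs.sum_bary_smul x
    rw [Finset.sum_eq_single_of_mem p hpτ fun v hv hvp => by rw [h0 v hv hvp, zero_smul], hsum,
      one_smul] at hx
    exact hx.symm
  obtain ⟨h₁T, hp₁⟩ := Mesh.mem_ring.1 h₁
  obtain ⟨h₂T, hp₂⟩ := Mesh.mem_ring.1 h₂
  have hpT : p ∈ T.vertices := Mesh.mem_vertices.2 ⟨τ₁, h₁T, hp₁⟩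
  obtain ⟨ε, hε, hnear⟩ := Metric.eventually_nhds_iff_ball.1 (hT.eventually_mem_ring hM hpT)
  set F : (Elem d → Prop) → Set (Pt d) := fun Q => ⋃ τ ∈ (T.ring p).filter Q, τ.hull with hF
  have hclosed : ∀ Q, IsClosed (F Q) := fun Q =>
    isClosed_biUnion_finset fun τ _ => τ.isClosed_hull
  have hmemF : ∀ Q x, x ∈ F Q ↔ ∃ τ ∈ T.ring p, Q τ ∧ x ∈ τ.hull := by
    intro Q x
    simp [hF, and_assoc]
  -- Near `p` the two classes form closed sets covering the closure of `Ω` and meeting at most at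
  -- `p`, so no connected set that avoids `p` reaches both.
  have key : ∀ Z : Set (Pt d), IsPreconnected Z → Z ⊆ closure Ω ∩ Metric.ball p ε → p ∉ Z →
      (Z ∩ τ₁.hull).Nonempty → (Z ∩ τ₂.hull).Nonempty → False := by
    intro Z hZ hZsub hpZ hZ₁ hZ₂
    have hcov : Z ⊆ F P ∪ F fun τ => ¬ P τ := by
      intro y hy
      obtain ⟨τ, hτ, hyτ⟩ := hT.exists_mem_hull (hZsub hy).1
      have hτr := hnear y (hZsub hy).2 τ hτ hyτ
      by_cases hPτ : P τ
      · exact Or.inl ((hmemF _ _).2 ⟨τ, hτr, hPτ, hyτ⟩)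
      · exact Or.inr ((hmemF _ _).2 ⟨τ, hτr, hPτ, hyτ⟩)
    obtain ⟨x, hxZ, hx1, hx2⟩ := isPreconnected_closed_iff.1 hZ (F P) (F fun τ => ¬ P τ)
      (hclosed _) (hclosed _) hcov
      (hZ₁.mono fun y hy => ⟨hy.1, (hmemF _ _).2 ⟨τ₁, h₁, hP₁, hy.2⟩⟩)
      (hZ₂.mono fun y hy => ⟨hy.1, (hmemF _ _).2 ⟨τ₂, h₂, hP₂, hy.2⟩⟩)
    obtain ⟨τ, hτ, hPτ, hxτ⟩ := (hmemF _ _).1 hx1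
    obtain ⟨τ', hτ', hPτ', hxτ'⟩ := (hmemF _ _).1 hx2
    exact hpZ (hmeet τ hτ τ' hτ' hPτ hPτ' x hxτ hxτ' ▸ hxZ)
  -- The connected set is a small sphere about `p` in the interior case, connected because d ≥ 2,
  -- and a path inside `Ω` in the boundary case, where it avoids `p` since `p` is not in `Ω`.
  by_cases hpΩ : p ∈ Ω
  · obtain ⟨ε', hε', hball⟩ := Metric.isOpen_iff.1 hΩ.isOpen p hpΩ
    have hvert : ∀ τ ∈ T.ring p, ∃ v ∈ τ.verts, v ≠ p := fun τ hτ =>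
      Finset.exists_mem_ne (by rw [(hT.isSimplex hM (Mesh.mem_ring.1 hτ).1).card_eq]; omega) p
    obtain ⟨v₁, hv₁, hne₁⟩ := hvert τ₁ h₁
    obtain ⟨v₂, hv₂, hne₂⟩ := hvert τ₂ h₂
    set δ := min (min ε ε' / 2) (min (dist p v₁) (dist p v₂)) with hδ
    have hδ0 : 0 < δ := lt_min (by positivity) (lt_min (dist_pos.2 hne₁.symm) (dist_pos.2 hne₂.symm))
    have hδε : δ < min ε ε' :=
      lt_of_le_of_lt (min_le_left _ _) (half_lt_self (by positivity))
    have hpt : ∀ (τ : Elem d) (v : Pt d), p ∈ τ.verts → v ∈ τ.verts → v ≠ p → δ ≤ dist p v →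
        (Metric.sphere p δ ∩ τ.hull).Nonempty := by
      intro τ v hp hv hne hle
      have hdv : 0 < dist p v := dist_pos.2 hne.symm
      refine ⟨AffineMap.lineMap p v (δ / dist p v), ?_, ?_⟩
      · rw [Metric.mem_sphere, dist_lineMap_left, Real.norm_of_nonneg (by positivity),
          div_mul_cancel₀ _ hdv.ne']
      · exact (convex_convexHull ℝ _).lineMap_mem (τ.subset_hull hp) (τ.subset_hull hv)
          ⟨by positivity, (div_le_one hdv).2 hle⟩
    refine key (Metric.sphere p δ) (isPreconnected_sphere ?_ p δ) (fun y hy => ?_) (fun h => ?_)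
      (hpt τ₁ v₁ hp₁ hv₁ hne₁ ((min_le_right _ _).trans (min_le_left _ _)))
      (hpt τ₂ v₂ hp₂ hv₂ hne₂ ((min_le_right _ _).trans (min_le_right _ _)))
    · rw [← Module.finrank_eq_rank, finrank_euclideanSpace_fin]
      exact_mod_cast hd
    · have hyδ : dist y p < min ε ε' := (Metric.mem_sphere.1 hy).trans_lt hδε
      exact ⟨subset_closure (hball (hyδ.trans_le (min_le_right _ _))),
        hyδ.trans_le (min_le_left _ _)⟩
    · rw [Metric.mem_sphere, dist_self] at h
      exact hδ0.ne h
  · have hpc : p ∈ closure Ω := hT.hull_subset_closure h₁T (τ₁.subset_hull hp₁)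
    have hpf : p ∈ frontier Ω := by
      rw [hΩ.isOpen.frontier_eq]; exact ⟨hpc, hpΩ⟩
    obtain ⟨δ, hδ, hjoin⟩ := hΩ.exists_joinedIn hpf hε
    have hpt : ∀ τ ∈ T, p ∈ τ.verts → ∃ x ∈ Ω ∩ Metric.ball p δ, x ∈ τ.hull := by
      intro τ hτ hpτ
      have hne := (hT.isSimplex hM hτ).interior_nonempty
      have hcl : p ∈ closure (interior τ.hull) := by
        rw [Elem.hull, (convex_convexHull ℝ _).closure_interior_eq_closure_of_nonempty_interior hne]
        exact subset_closure (τ.subset_hull hpτ)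
      obtain ⟨y, hyb, hyi⟩ := mem_closure_iff.1 hcl _ Metric.isOpen_ball (Metric.mem_ball_self hδ)
      have hycl : y ∈ closure Ω := hT.hull_subset_closure hτ (interior_subset hyi)
      obtain ⟨z, ⟨hzb, hzi⟩, hzΩ⟩ := mem_closure_iff.1 hycl _
        (Metric.isOpen_ball.inter isOpen_interior) ⟨hyb, hyi⟩
      exact ⟨z, ⟨hzΩ, hzb⟩, interior_subset hzi⟩
    obtain ⟨x, hx, hxτ⟩ := hpt τ₁ h₁T hp₁
    obtain ⟨y, hy, hyτ⟩ := hpt τ₂ h₂T hp₂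
    obtain ⟨γ, hγ⟩ := hjoin x hx y hy
    refine key (Set.range γ) (isPreconnected_range γ.continuous) ?_ ?_
      ⟨x, ⟨0, γ.source⟩, hxτ⟩ ⟨y, ⟨1, γ.target⟩, hyτ⟩
    · rintro _ ⟨t, rfl⟩
      exact ⟨subset_closure (hγ t).1, (hγ t).2⟩
    · rintro ⟨t, ht⟩
      exact hpΩ (ht ▸ (hγ t).1)

omit hM

/-- If the generations in a finite family have no gaps larger than `K`, their spread is bounded. -/
lemma gen_le_add_of_no_gap {R : Finset (Elem d)} {N K : ℕ} (hN : R.card ≤ N)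
    (hgap : ∀ n, (∃ τ ∈ R, τ.gen ≤ n) → (∃ τ ∈ R, n < τ.gen) → ∃ τ ∈ R, n < τ.gen ∧ τ.gen ≤ n + K)
    {τ τ' : Elem d} (hτ : τ ∈ R) (hτ' : τ' ∈ R) : τ.gen ≤ τ'.gen + N * K := by
  by_contra! hlt
  -- N disjoint windows above the generation of `τ'` each contain an element; together with `τ'`
  -- these are N + 1 elements, too many.
  have hex : ∀ i < N, ∃ ς ∈ R, τ'.gen + i * K < ς.gen ∧ ς.gen ≤ τ'.gen + (i + 1) * K := by
    intro i hi
    obtain ⟨ς, h1, h2, h3⟩ := hgap (τ'.gen + i * K) ⟨τ', hτ', by omega⟩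
      ⟨τ, hτ, by have := Nat.mul_le_mul_right K hi.le; omega⟩
    exact ⟨ς, h1, h2, by rw [add_mul, one_mul]; omega⟩
  have : Nonempty (Elem d) := ⟨τ⟩
  choose! f hf hf1 hf2 using hex
  have hinj : Set.InjOn f (Finset.range N) := by
    have hlt : ∀ i < N, ∀ j < N, i < j → f i ≠ f j := by
      intro i hi j hj hij h
      have h1 := hf2 i hi
      have h2 := hf1 j hj
      have := Nat.mul_le_mul_right K (show i + 1 ≤ j from hij)
      rw [h] at h1
      omega
    intro i hi j hj h
    have hi := Finset.mem_range.1 hi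
    have hj := Finset.mem_range.1 hj
    rcases lt_trichotomy i j with h1 | h1 | h1
    · exact absurd h (hlt i hi j hj h1)
    · exact h1
    · exact absurd h.symm (hlt j hj i hi h1)
  have hmaps : (Finset.range N).image f ⊆ R.erase τ' := by
    refine Finset.image_subset_iff.2 fun i hi => ?_
    have hi := Finset.mem_range.1 hi
    refine Finset.mem_erase.2 ⟨fun h => ?_, hf i hi⟩
    have := hf1 i hi
    rw [h] at this
    omega
  have hcard := Finset.card_le_card hmaps
  rw [Finset.card_image_of_injOn hinj, Finset.card_range, Finset.card_erase_of_mem hτ'] at hcard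
  have := Finset.card_pos.2 ⟨τ', hτ'⟩
  omega

/-- The ring bound holds with a constant that depends only on the shape regularity. -/
theorem exists_ringBound (hd : 2 ≤ d) (σ ρ : ℝ) : ∃ κ : ℕ,
    ∀ (Ω : Set (Pt d)) (M : BisectionMethod d), IsBoundedLipschitzDomain Ω → M.IsOn Ω →
      M.IsShapeRegular σ → M.UniformConformity → M.IsQuasiUniform ρ →
      ∀ (J : ℕ) (e : ℕ → Finset (Pt d)), M.IsCompatibleSequence e J → M.RingBound e J κ := by
  obtain ⟨K, hK⟩ := pow_unbounded_of_one_lt ((|ρ| * |σ|) ^ d * |σ| ^ (2 * d)) (one_lt_two (α := ℝ))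
  set N := ⌈|σ| ^ d⌉₊ with hN
  -- N bounds the size of a ring and K the jump of generations across an edge, so N K bounds the
  -- spread; adding N serves both bounds with one integer.
  refine ⟨N * K + N, fun Ω M hΩ hM hSh hU hQ J e hc j hj p hp => ?_⟩
  have hT := isAdmissible_mesh hM hc hj
  have hcard : ((M.mesh e j).ring p).card ≤ N := by
    have := (hT.card_ring_le hM hU hSh p).trans (Nat.le_ceil _)
    exact_mod_cast this
  refine ⟨fun τ hτ τ' hτ' => ?_, by omega⟩
  have := gen_le_add_of_no_gap (K := K) hcard ?_ hτ hτ'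
  · omega
  rintro n ⟨τ₁, h₁, hn₁⟩ ⟨τ₂, h₂, hn₂⟩
  obtain ⟨a, ha, b, hb, hPa, hPb, q, hpq, hqa, hqb⟩ :=
    hT.exists_common_edge hM hΩ hd (fun τ => τ.gen ≤ n) h₁ h₂ hn₁ (not_le.2 hn₂)
  obtain ⟨haT, hpa⟩ := Mesh.mem_ring.1 ha
  obtain ⟨hbT, hpb⟩ := Mesh.mem_ring.1 hb
  refine ⟨b, hb, not_le.1 hPb, ?_⟩
  have hpow := (hT.isNode a haT).two_pow_gen_le hM hU hSh hQ (hT.isNode b hbT) hpq hpa hqa hpb hqb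
  have hlt : (2 : ℝ) ^ b.gen < 2 ^ (K + a.gen + 1) := by
    refine hpow.trans_lt ?_
    rw [pow_succ, pow_add]
    have : (0 : ℝ) < 2 ^ a.gen := by positivity
    have : (0 : ℝ) < 2 ^ K := by positivity
    nlinarith [mul_pos (sub_pos.2 hK) (show (0 : ℝ) < 2 ^ a.gen by positivity)]
  have := (pow_lt_pow_iff_right₀ (one_lt_two (α := ℝ))).1 hlt
  omega

end BisectionMethod

end

theorem mainTheorem12 (d : ℕ) (hd : 1 ≤ d) (σ ρ : ℝ) :
    -- the integer `k_*` exists, depending only on `d`, `σ` and `ρ`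
    (2 ≤ d → ∃ kstar : ℕ,
      ∀ (Ω : Set (Pt d)) (M : BisectionMethod d),
        IsBoundedLipschitzDomain Ω → M.IsOn Ω → M.IsShapeRegular σ → M.UniformConformity →
        M.IsQuasiUniform ρ →
        ∀ (J : ℕ) (e : ℕ → Finset (Pt d)), M.IsCompatibleSequence e J →
          M.RingBound e J kstar) ∧
    -- for every such integer there is the stable decomposition
    (∀ kstar : ℕ, ∃ C : ℝ, 0 < C ∧
      ∀ (Ω : Set (Pt d)) (M : BisectionMethod d),
        IsBoundedLipschitzDomain Ω → M.IsOn Ω → M.IsShapeRegular σ → M.UniformConformity →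
        M.IsQuasiUniform ρ →
        ∀ (J : ℕ) (e : ℕ → Finset (Pt d)), M.IsCompatibleSequence e J →
          M.RingBound e J kstar →
          ∀ k ≤ (M.mesh e J).maxGen, ∀ w ∈ M.W Ω e J k,
            ∃ (wn : Pt d → Pt d → ℝ) (wl : ℕ → Pt d → ℝ),
              (∀ q ∈ M.levelVertices Ω e J (k + kstar), wn q ∈ M.nodalSpace Ω e J q) ∧
              (∀ j ∈ M.nearBisections e J k kstar, wl j ∈ M.localSpace Ω e j) ∧
              w = ∑ q ∈ M.levelVertices Ω e J (k + kstar), wn q +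
                  ∑ j ∈ M.nearBisections e J k kstar, wl j ∧
              normSqL2 Ω w ≤
                C * (∑ q ∈ M.levelVertices Ω e J (k + kstar), normSqL2 Ω (wn q) +
                  ∑ j ∈ M.nearBisections e J k kstar, normSqL2 Ω (wl j)) ∧
              ∑ q ∈ M.levelVertices Ω e J (k + kstar), normSqL2 Ω (wn q) +
                  ∑ j ∈ M.nearBisections e J k kstar, normSqL2 Ω (wl j) ≤
                C * normSqL2 Ω w) := by
  refine ⟨fun hd2 => BisectionMethod.exists_ringBound hd2 σ ρ, fun κ => ?_⟩
  have h1 : (0 : ℝ) ≤ 2 * BisectionMethod.overlapConst d κ := by positivity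
  have h2 : 0 ≤ (1 + BisectionMethod.overlapConst d κ : ℝ) *
      BisectionMethod.triangularConst d κ σ ρ :=
    mul_nonneg (by positivity) (BisectionMethod.triangularConst_nonneg d κ σ ρ)
  -- The sum of the constants of the two inequalities; the summand 1 ensures positivity.
  refine ⟨2 * BisectionMethod.overlapConst d κ + (1 + BisectionMethod.overlapConst d κ) *
    BisectionMethod.triangularConst d κ σ ρ + 1, by positivity, ?_⟩
  intro Ω M hΩ hM hSh hU hQ J e hc hR k _ w hw
  obtain ⟨wn, wl, hwn, hwl, hsum, hle, hge⟩ :=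
    BisectionMethod.exists_stable_decomposition hΩ hM hU hSh hQ hc hR hw
  refine ⟨wn, wl, hwn, hwl, hsum, hle.trans ?_, hge.trans ?_⟩
  · refine mul_le_mul_of_nonneg_right (by linarith) (add_nonneg ?_ ?_) <;>
      exact Finset.sum_nonneg fun _ _ => normSqL2_nonneg _
  · exact mul_le_mul_of_nonneg_right (by linarith) (normSqL2_nonneg w)
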